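/- Let $k$ be a field and let $X^0$ be an algebraic variety over $k$ (an integral separated scheme of finite type) with a finite covering $\{U_i=\operatorname{Spec}A^0_i\}_{i\in I}$ by affine open subsets, indexed by a poset $I$ with binary minima such that $U_{i\cap j}=U_i\cap U_j$, where $i\cap j=\min\{i,j\}$. Let $\phi^0_{ij}:A^0_j\to A^0_i$ $(i<j)$ be the restriction maps and write $A^0=(A^0_i,\phi^0_{ij})$. Let $(R,\mathfrak m)$ be a commutative Artin local $k$-algebra with $R/\mathfrak m=k$. An NC scheme over $I$ is a family of associative unital algebras $A_i$ with homomorphisms $\phi_{ij}:A_j\to A_i$ for $i<j$ such that $A_i$ is flat over $A_j$ (i.e. $-\otimes_{A_j}A_i$ is exact on right modules), the multiplication $A_i\otimes_{A_j}A_i\to A_i$ is bijective, and $\phi_{ij}\phi_{jk}=\phi_{ik}$ for $i<j<k$. A quasi-coherent module on it is a family $M=(M_i)$ of right $A_i$-modules with isomorphisms $M_j\otimes_{A_j}A_i\cong M_i$ $(i<j)$ satisfying the cocycle condition; $M$ is coherent if every $M_i$ is finitely generated, and locally free if for some $r$ every $M_i$ is free of rank $r$. These modules form an abelian category $\operatorname{Qcoh}(A)$;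 $D^-\mathrm{coh}(A)$ denotes the full subcategory of the derived category $D(\operatorname{Qcoh}(A))$ of the complexes whose cohomology is bounded above and coherent, and $R\mathrm{Hom}_A$ is computed in $D(\operatorname{Qcoh}(A))$, so that $H^p(R\mathrm{Hom}_A(F,M))=\mathrm{Hom}_{D(\operatorname{Qcoh}(A))}(F,M[p])$. Let $A=(A_i,\phi_{ij})$ be an NC deformation of $X^0$ over $R$: an NC scheme over $I$ consisting of flat $R$-algebras $A_i$ and $R$-algebra homomorphisms $\phi_{ij}$, with $k$-algebra isomorphisms $\alpha_i:R/\mathfrak m\otimes_RA_i\cong A^0_i$ satisfying $\phi^0_{ij}\circ\alpha_j=\alpha_i\circ(R/\mathfrak m\otimes_R\phi_{ij})$ for $i<j$. Let $F$ be a locally free coherent module on $A$, and let $F^0=R/\mathfrak m\otimes_RF=F\otimes_AA^0$, a locally free coherent module on $A^0$. Assume that $R\mathrm{Hom}_{A^0}(F^0,N)\not\cong0$ for every $N\in D^-\mathrm{coh}(A^0)$ with $N\not\cong0$. Then $R\mathrm{Hom}_A(F,M)\not\cong0$ for every $M\in D^-\mathrm{coh}(A)$ with $M\not\cong0$. -/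

import Mathlib

open CategoryTheory Limits MulOpposite TensorProduct

universe u v v' w

noncomputable section

section BaseChange

variable {S T : Type u} [Ring S] [Ring T] (f : S →+* T)

/-- The relations `m s ⊗ t = m ⊗ f(s) t` in `M ⊗_ℤ T` (the factors are written in the opposite
order, so that the right multiplication of `T` on itself is visible to Mathlib). -/
def rightTensorRel (M : Type u) [AddCommGroup M] [Module Sᵐᵒᵖ M] :
    Submodule Tᵐᵒᵖ (T ⊗[ℤ] M) :=
  Submodule.span Tᵐᵒᵖ
    {x | ∃ (s : S) (t : T) (m : M), x = (f s * t) ⊗ₜ[ℤ] m - t ⊗ₜ[ℤ] (op s • m)}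

/-- For a homomorphism `f : S → T` of (not necessarily commutative) rings and a right `S`-module
`M`, the right `T`-module `M ⊗_S T`. A right module over a ring is a module over the opposite
ring. -/
def RightTensor (M : Type u) [AddCommGroup M] [Module Sᵐᵒᵖ M] : Type u :=
  (T ⊗[ℤ] M) ⧸ rightTensorRel f M

namespace RightTensor

variable {M N P : Type u} [AddCommGroup M] [Module Sᵐᵒᵖ M] [AddCommGroup N] [Module Sᵐᵒᵖ N]
  [AddCommGroup P] [Module Tᵐᵒᵖ P]

instance : AddCommGroup (RightTensor f M) :=
  inferInstanceAs (AddCommGroup ((T ⊗[ℤ] M) ⧸ rightTensorRel f M))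

instance : Module Tᵐᵒᵖ (RightTensor f M) :=
  inferInstanceAs (Module Tᵐᵒᵖ ((T ⊗[ℤ] M) ⧸ rightTensorRel f M))

/-- The projection from `M ⊗_ℤ T` to `M ⊗_S T`. -/
def proj (M : Type u) [AddCommGroup M] [Module Sᵐᵒᵖ M] :
    (T ⊗[ℤ] M) →ₗ[Tᵐᵒᵖ] RightTensor f M :=
  (rightTensorRel f M).mkQ

lemma proj_surjective : Function.Surjective (proj f M) :=
  Submodule.mkQ_surjective _

/-- The element `m ⊗ t` of `M ⊗_S T`. -/
def tmul (m : M) (t : T) : RightTensor f M :=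
  proj f M (t ⊗ₜ[ℤ] m)

lemma tmul_add_left (m m' : M) (t : T) :
    tmul f (m + m') t = tmul f m t + tmul f m' t := by
  simp only [tmul, TensorProduct.tmul_add, map_add]

lemma tmul_add_right (m : M) (t t' : T) :
    tmul f m (t + t') = tmul f m t + tmul f m t' := by
  simp only [tmul, TensorProduct.add_tmul, map_add]

lemma op_smul_tmul (m : M) (t t' : T) : op t' • tmul f m t = tmul f m (t * t') := by
  simp only [tmul, ← map_smul, TensorProduct.smul_tmul', op_smul_eq_mul]

lemma tmul_balanced (m : M) (s : S) (t : T) : tmul f (op s • m) t = tmul f m (f s * t) := by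
  symm
  rw [tmul, tmul, ← sub_eq_zero, ← map_sub]
  refine (Submodule.Quotient.mk_eq_zero _).2 ?_
  exact Submodule.subset_span ⟨s, t, m, rfl⟩

lemma tmul_eq_smul (m : M) (t : T) : tmul f m t = op t • tmul f m 1 := by
  rw [op_smul_tmul, one_mul]

@[elab_as_elim]
lemma induction {p : RightTensor f M → Prop} (zero : p 0)
    (tmul : ∀ m t, p (tmul f m t)) (add : ∀ x y, p x → p y → p (x + y)) (x : RightTensor f M) :
    p x := by
  obtain ⟨x, rfl⟩ := proj_surjective f x
  induction x with
  | zero => rwa [map_zero]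
  | add x y hx hy => rw [map_add]; exact add _ _ hx hy
  | tmul t m => exact tmul m t

/-- The homomorphism `M ⊗_ℤ T → P` of right `T`-modules, `m ⊗ t ↦ g(m) t`. -/
def preLift (g : M →+ P) : (T ⊗[ℤ] M) →ₗ[Tᵐᵒᵖ] P where
  toFun := TensorProduct.lift (R := ℤ) (AddMonoidHom.toIntLinearMap
        (AddMonoidHom.mk' (fun t : T => AddMonoidHom.toIntLinearMap
          (AddMonoidHom.mk' (fun m => op t • g m)
            (fun m m' => by rw [map_add, smul_add])))
          (fun t t' => by ext m; simp [add_smul])))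
  map_add' := map_add _
  map_smul' t x := by
    induction x with
    | zero => rw [smul_zero, map_zero, smul_zero]
    | add x y hx hy => rw [smul_add, map_add, map_add, hx, hy, smul_add]
    | tmul t' m =>
      rw [TensorProduct.smul_tmul', RingHom.id_apply]
      exact mul_smul t (op t') (g m)

lemma preLift_tmul (g : M →+ P) (t : T) (m : M) : preLift g (t ⊗ₜ[ℤ] m) = op t • g m := rfl

/-- The homomorphism `M ⊗_S T → P` of right `T`-modules, `m ⊗ t ↦ g(m) t`, attached to an
additive map `g : M → P` with `g(m s) = g(m) f(s)`. -/
def lift (g : M →+ P) (hg : ∀ (s : S) (m : M), g (op s • m) = op (f s) • g m) :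
    RightTensor f M →ₗ[Tᵐᵒᵖ] P :=
  (rightTensorRel f M).liftQ (preLift g) (by
    rw [rightTensorRel, Submodule.span_le]
    rintro _ ⟨s, t, m, rfl⟩
    rw [SetLike.mem_coe, LinearMap.mem_ker, map_sub, preLift_tmul, preLift_tmul, hg, op_mul,
      mul_smul, sub_self])

lemma lift_tmul (g : M →+ P) (hg : ∀ (s : S) (m : M), g (op s • m) = op (f s) • g m)
    (m : M) (t : T) : lift f g hg (tmul f m t) = op t • g m := rfl

variable {f} in
lemma hom_ext {g g' : RightTensor f M →ₗ[Tᵐᵒᵖ] P}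
    (h : ∀ m : M, g (tmul f m 1) = g' (tmul f m 1)) : g = g' := by
  ext x
  induction x using RightTensor.induction with
  | zero => rw [map_zero, map_zero]
  | add x y hx hy => rw [map_add, map_add, hx, hy]
  | tmul m t => rw [tmul_eq_smul, map_smul, map_smul, h]

/-- The homomorphism `h ⊗ id : M ⊗_S T → N ⊗_S T`. -/
def map (h : M →ₗ[Sᵐᵒᵖ] N) : RightTensor f M →ₗ[Tᵐᵒᵖ] RightTensor f N :=
  lift f (AddMonoidHom.mk' (fun m => tmul f (h m) 1)
    (fun m m' => by rw [map_add, tmul_add_left]))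
    (fun s m => by
      simp only [AddMonoidHom.mk'_apply, map_smul, tmul_balanced, op_smul_tmul, one_mul, mul_one])

lemma map_tmul (h : M →ₗ[Sᵐᵒᵖ] N) (m : M) (t : T) : map f h (tmul f m t) = tmul f (h m) t := by
  rw [map, lift_tmul, AddMonoidHom.mk'_apply, op_smul_tmul, one_mul]

end RightTensor

/-- A ring homomorphism `f : S → T` is flat if `- ⊗_S T` sends injective homomorphisms of right
`S`-modules to injective homomorphisms, i.e. if `T` is a flat left `S`-module. -/
def FlatRight : Prop :=
  ∀ ⦃M N : Type u⦄ [AddCommGroup M] [Module Sᵐᵒᵖ M] [AddCommGroup N] [Module Sᵐᵒᵖ N]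
    (h : M →ₗ[Sᵐᵒᵖ] N), Function.Injective h → Function.Injective (RightTensor.map f h)

/-- `M ↦ M ⊗_S T` as a functor from right `S`-modules to right `T`-modules. -/
def extendRight : ModuleCat.{u} Sᵐᵒᵖ ⥤ ModuleCat.{u} Tᵐᵒᵖ where
  obj M := ModuleCat.of _ (RightTensor f M)
  map h := ModuleCat.ofHom (RightTensor.map f h.hom)
  map_id M := by
    ext1; exact RightTensor.hom_ext fun m => RightTensor.map_tmul _ _ _ _
  map_comp g h := by
    ext1; exact RightTensor.hom_ext fun m => by
      refine (RightTensor.map_tmul _ _ _ _).trans ?_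
      change _ = RightTensor.map f h.hom (RightTensor.map f g.hom (RightTensor.tmul f m 1))
      rw [RightTensor.map_tmul, RightTensor.map_tmul]
      rfl

/-- Restriction of scalars of right modules along `f : S → T`. -/
abbrev restrictRight : ModuleCat.{u} Tᵐᵒᵖ ⥤ ModuleCat.{u} Sᵐᵒᵖ :=
  ModuleCat.restrictScalars (RingHom.op f)

variable {f} in
/-- The homomorphism of right `T`-modules `M ⊗_S T → P`, `m ⊗ t ↦ g(m) t`, attached to a
homomorphism `g : M → P` of right `S`-modules. -/
def extendRightDesc {M : ModuleCat.{u} Sᵐᵒᵖ} {P : ModuleCat.{u} Tᵐᵒᵖ}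
    (g : M ⟶ (restrictRight f).obj P) : (extendRight f).obj M ⟶ P :=
  ModuleCat.ofHom (RightTensor.lift f (M := M) (P := P)
    (AddMonoidHom.mk' (fun m => g.hom m) (fun m m' => map_add g.hom m m'))
    (fun s m => map_smul g.hom (op s) m))

lemma extendRightDesc_tmul {M : ModuleCat.{u} Sᵐᵒᵖ} {P : ModuleCat.{u} Tᵐᵒᵖ}
    (g : M ⟶ (restrictRight f).obj P) (m : M) (t : T) :
    (extendRightDesc g).hom (RightTensor.tmul f m t) = op t • (show P from g.hom m) := rfl

/-- The homomorphism of right `S`-modules `M → M ⊗_S T`, `m ↦ m ⊗ 1`. -/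
def extendRightUnit (M : ModuleCat.{u} Sᵐᵒᵖ) :
    M ⟶ (restrictRight f).obj ((extendRight f).obj M) :=
  ModuleCat.ofHom (Y := (restrictRight f).obj ((extendRight f).obj M))
    { toFun := fun m => RightTensor.tmul f m 1
      map_add' := fun m m' => RightTensor.tmul_add_left f m m' 1
      map_smul' := fun s m => by
        refine (RightTensor.tmul_balanced f m s.unop 1).trans ?_
        rw [mul_one, RightTensor.tmul_eq_smul]
        rfl }

lemma extendRight_hom_ext {M : ModuleCat.{u} Sᵐᵒᵖ} {P : ModuleCat.{u} Tᵐᵒᵖ}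
    {g h : (extendRight f).obj M ⟶ P}
    (H : ∀ m : M, g.hom (RightTensor.tmul f m 1) = h.hom (RightTensor.tmul f m 1)) : g = h := by
  ext1; exact RightTensor.hom_ext H

lemma extendRight_map_comp_desc {M N : ModuleCat.{u} Sᵐᵒᵖ} {P : ModuleCat.{u} Tᵐᵒᵖ}
    (g : M ⟶ N) (h : N ⟶ (restrictRight f).obj P) :
    (extendRight f).map g ≫ extendRightDesc h = extendRightDesc (g ≫ h) :=
  extendRight_hom_ext f fun m => by
    change (extendRightDesc h).hom (RightTensor.map f g.hom (RightTensor.tmul f m 1)) = _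
    rw [RightTensor.map_tmul, extendRightDesc_tmul, extendRightDesc_tmul]
    rfl

lemma extendRightDesc_comp {M : ModuleCat.{u} Sᵐᵒᵖ} {P Q : ModuleCat.{u} Tᵐᵒᵖ}
    (g : M ⟶ (restrictRight f).obj P) (h : P ⟶ Q) :
    extendRightDesc (g ≫ (restrictRight f).map h) = extendRightDesc g ≫ h :=
  extendRight_hom_ext f fun _ => (map_smul h.hom _ _).symm

/-- Extension of scalars is left adjoint to restriction of scalars. -/
def extendRestrictRight : extendRight f ⊣ restrictRight f :=
  Adjunction.mkOfHomEquiv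
    { homEquiv := fun M P =>
        { toFun := fun g => extendRightUnit f M ≫ (restrictRight f).map g
          invFun := fun g => extendRightDesc g
          left_inv := fun g => extendRight_hom_ext f fun m =>
            (extendRightDesc_tmul f _ m 1).trans (one_smul _ _)
          right_inv := fun g => by
            ext m
            exact (extendRightDesc_tmul f _ m 1).trans (one_smul _ _) }
      homEquiv_naturality_left_symm := fun g h => (extendRight_map_comp_desc f g h).symm
      homEquiv_naturality_right := fun g h => rfl }

instance : (extendRight f).IsLeftAdjoint := (extendRestrictRight f).isLeftAdjoint

instance : (extendRight f).Additive where
  map_add {M N g h} := extendRight_hom_ext f fun m => by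
    refine (RightTensor.map_tmul f _ m 1).trans ?_
    change _ = RightTensor.map f g.hom _ + RightTensor.map f h.hom _
    rw [RightTensor.map_tmul, RightTensor.map_tmul, ← RightTensor.tmul_add_left]
    rfl

variable {f} in
lemma FlatRight.preservesFiniteLimits (hf : FlatRight f) :
    PreservesFiniteLimits (extendRight f) := by
  rw [Functor.preservesFiniteLimits_iff_forall_exact_map_and_mono]
  intro E hE
  refine ⟨((Functor.preservesFiniteColimits_iff_forall_exact_map_and_epi (extendRight f)).1
    ⟨fun J _ _ => inferInstance⟩ E hE).1, ?_⟩
  rw [ModuleCat.mono_iff_injective]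
  exact hf _ ((ModuleCat.mono_iff_injective _).1 hE.mono_f)

end BaseChange

section BaseChangeSquare

variable {S T S' T' : Type u} [Ring S] [Ring T] [Ring S'] [Ring T']
  (f : S →+* T) (f' : S' →+* T') (a : S →+* S') (b : T →+* T')
  (comm : ∀ s, b (f s) = f' (a s))
  {M : ModuleCat.{u} Sᵐᵒᵖ} {M' : ModuleCat.{u} S'ᵐᵒᵖ} (g : M ⟶ (restrictRight a).obj M')

/-- The map `M ⊗_S T → M' ⊗_{S'} T'`, `m ⊗ t ↦ g(m) ⊗ b(t)`, linear over `b : T → T'`. -/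
def extendRightSquare :
    (extendRight f).obj M ⟶ (restrictRight b).obj ((extendRight f').obj M') :=
  extendRightDesc (ModuleCat.ofHom
    (Y := (restrictRight f).obj ((restrictRight b).obj ((extendRight f').obj M')))
    { toFun := fun m => RightTensor.tmul f' (M := M') (g.hom m) 1
      map_add' := fun m m' => by
        rw [map_add]
        exact RightTensor.tmul_add_left f' (M := M') _ _ 1
      map_smul' := fun s m => by
        rw [map_smul]
        refine (RightTensor.tmul_balanced f' (M := M') (g.hom m) (a s.unop) 1).trans ?_
        rw [mul_one, ← comm]
        exact RightTensor.tmul_eq_smul f' (M := M') (g.hom m) (b (f s.unop)) })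

lemma extendRightSquare_tmul (m : M) (t : T) :
    (extendRightSquare f f' a b comm g).hom (RightTensor.tmul f m t) =
      RightTensor.tmul f' (M := M') (g.hom m) (b t) := by
  refine (extendRightDesc_tmul f _ m t).trans ?_
  exact (RightTensor.tmul_eq_smul f' (M := M') (g.hom m) (b t)).symm

/-- If `M ⊗_S S' → M'` is an isomorphism, then so is
`(M ⊗_S T) ⊗_T T' → M' ⊗_{S'} T'`. -/
lemma isIso_extendRightSquare [IsIso (extendRightDesc g)] :
    IsIso (extendRightDesc (extendRightSquare f f' a b comm g)) := by
  let X := (extendRight b).obj ((extendRight f).obj M)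
  let r : M ⟶ (restrictRight a).obj ((restrictRight f').obj X) :=
    ModuleCat.ofHom (Y := (restrictRight a).obj ((restrictRight f').obj X))
      { toFun := fun m => RightTensor.tmul b (M := RightTensor f M) (RightTensor.tmul f m 1) 1
        map_add' := fun m m' => by
          rw [RightTensor.tmul_add_left, RightTensor.tmul_add_left]
          rfl
        map_smul' := fun s m => by
          induction s using MulOpposite.rec' with
          | h s =>
            rw [RightTensor.tmul_balanced, mul_one, RightTensor.tmul_eq_smul f m (f s),
              RightTensor.tmul_balanced, mul_one, comm]
            exact RightTensor.tmul_eq_smul b (M := RightTensor f M) _ _ }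
  let q : (extendRight f').obj M' ⟶ X :=
    extendRightDesc (inv (extendRightDesc g) ≫ extendRightDesc r)
  have hq (m : M) : q.hom (RightTensor.tmul f' (M := M') (g.hom m) 1) =
      RightTensor.tmul b (RightTensor.tmul f m 1) 1 := by
    refine (extendRightDesc_tmul f' _ _ 1).trans ((one_smul _ _).trans ?_)
    have h1 : g.hom m = (extendRightDesc g).hom (RightTensor.tmul a m 1) :=
      ((extendRightDesc_tmul a g m 1).trans (one_smul _ _)).symm
    have h2 : (inv (extendRightDesc g)).hom (g.hom m) = RightTensor.tmul a m 1 := by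
      rw [h1]
      exact IsIso.hom_inv_id_apply (extendRightDesc g) (RightTensor.tmul a m 1)
    change (extendRightDesc r).hom ((inv (extendRightDesc g)).hom (g.hom m)) = _
    rw [h2]
    exact (extendRightDesc_tmul a r m 1).trans (one_smul _ _)
  have hD (m : M) : (extendRightDesc (extendRightSquare f f' a b comm g)).hom
      (RightTensor.tmul b (RightTensor.tmul f m 1) 1) =
        RightTensor.tmul f' (M := M') (g.hom m) 1 := by
    refine (extendRightDesc_tmul b _ _ 1).trans ((one_smul _ _).trans ?_)
    exact (extendRightSquare_tmul f f' a b comm g m 1).trans (by rw [map_one])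
  refine ⟨q, ?_, ?_⟩
  · apply ((extendRestrictRight b).homEquiv _ _).injective
    refine extendRight_hom_ext f fun m => ?_
    exact (congrArg q.hom (hD m)).trans (hq m)
  · apply ((extendRestrictRight f').homEquiv _ _).injective
    rw [← cancel_epi (extendRightDesc g)]
    refine extendRight_hom_ext a fun m => ?_
    have h1 : (extendRightDesc g).hom (RightTensor.tmul a m 1) = g.hom m :=
      (extendRightDesc_tmul a g m 1).trans (one_smul _ _)
    change (extendRightDesc (extendRightSquare f f' a b comm g)).hom (q.hom
        (RightTensor.tmul f' (M := M') ((extendRightDesc g).hom (RightTensor.tmul a m 1)) 1)) =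
      RightTensor.tmul f' (M := M') ((extendRightDesc g).hom (RightTensor.tmul a m 1)) 1
    rw [h1]
    exact (congrArg (extendRightDesc (extendRightSquare f f' a b comm g)).hom (hq m)).trans (hD m)

end BaseChangeSquare

section NCScheme

/-- The presheaf of opposite rings of a presheaf of algebras; modules over it are presheaves of
right modules. -/
def oppositeRings {K : Type v} [CommRing K] {I : Type w} [Preorder I]
    (A : Iᵒᵖ ⥤ AlgCat.{u} K) : Iᵒᵖ ⥤ RingCat.{u} where
  obj i := RingCat.of (A.obj i)ᵐᵒᵖ
  map h := RingCat.ofHom (RingHom.op (A.map h).hom.toRingHom)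
  map_id i := by
    ext x
    change op ((A.map (𝟙 i)).hom x.unop) = x
    rw [A.map_id]; rfl
  map_comp g h := by
    ext x
    change op ((A.map (g ≫ h)).hom x.unop) = op ((A.map h).hom ((A.map g).hom x.unop))
    rw [A.map_comp]; rfl

/-- Presheaves of right modules over a presheaf `A` of associative algebras on a poset:
right `A_i`-modules `M_i` with compatible maps `M_j → M_i` for `i ≤ j`, linear over
`A_j → A_i`. -/
abbrev RightPresheaf {K : Type v} [CommRing K] {I : Type w} [Preorder I]
    (A : Iᵒᵖ ⥤ AlgCat.{u} K) :=
  PresheafOfModules.{u} (oppositeRings A)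

section RightPresheaf

variable {K : Type v} [CommRing K] {I : Type w} [Preorder I] (A : Iᵒᵖ ⥤ AlgCat.{u} K)

/-- The homomorphism of rings `φ_{ij} : A_j → A_i`. -/
abbrev phi {j i : Iᵒᵖ} (h : j ⟶ i) : A.obj j →+* A.obj i := (A.map h).hom.toRingHom

/-- The functor `M ↦ M_i` with values in right `A_i`-modules. -/
def component (i : Iᵒᵖ) : RightPresheaf A ⥤ ModuleCat.{u} (A.obj i)ᵐᵒᵖ :=
  PresheafOfModules.evaluation.{u} (oppositeRings A) i

instance (i : Iᵒᵖ) : PreservesFiniteLimits (component A i) :=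
  inferInstanceAs (PreservesFiniteLimits (PresheafOfModules.evaluation.{u} (oppositeRings A) i))

instance (i : Iᵒᵖ) : PreservesFiniteColimits (component A i) :=
  inferInstanceAs (PreservesFiniteColimits (PresheafOfModules.evaluation.{u} (oppositeRings A) i))

variable {A} in
/-- The map `M_j → M_i`, linear over `φ_{ij}`. -/
def compMap (M : RightPresheaf A) {j i : Iᵒᵖ} (h : j ⟶ i) :
    (component A j).obj M ⟶ (restrictRight (phi A h)).obj ((component A i).obj M) :=
  M.map h

variable {A} in
lemma compMap_naturality {M N : RightPresheaf A} (g : M ⟶ N) {j i : Iᵒᵖ} (h : j ⟶ i) :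
    compMap M h ≫ (restrictRight (phi A h)).map ((component A i).map g) =
      (component A j).map g ≫ compMap N h :=
  g.naturality h

/-- The natural map `M_j ⊗_{A_j} A_i → M_i`, `m ⊗ a ↦ m|_i a`, for a presheaf of right modules. -/
def gluing {j i : Iᵒᵖ} (h : j ⟶ i) :
    component A j ⋙ extendRight (phi A h) ⟶ component A i where
  app M := extendRightDesc (compMap M h)
  naturality M N g := by
    rw [Functor.comp_map, extendRight_map_comp_desc, ← compMap_naturality, extendRightDesc_comp]

end RightPresheaf

/-- An NC scheme over a poset `I` with binary minima, linear over a commutative ring `K`: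
associative unital `K`-algebras `A_i` and homomorphisms `φ_{ij} : A_j → A_i` for `i ≤ j` (as a
functor on the opposite of `I`, which contains the cocycle condition), such that the `φ_{ij}` are
flat and the multiplication maps `A_i ⊗_{A_j} A_i → A_i` are bijective. -/
structure NCScheme (K : Type v) [CommRing K] (I : Type w) [SemilatticeInf I] where
  /-- the algebras `A_i` and the gluing homomorphisms `φ_{ij}` -/
  alg : Iᵒᵖ ⥤ AlgCat.{u} K
  flat : ∀ ⦃i j : I⦄ (h : i < j), FlatRight (phi alg (homOfLE h.le).op)
  birational : ∀ ⦃i j : I⦄ (h : i < j), Function.Bijective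
    ((extendRestrictRight (phi alg (homOfLE h.le).op)).counit.app
      (ModuleCat.of (alg.obj (Opposite.op i))ᵐᵒᵖ (alg.obj (Opposite.op i)))).hom

variable {K : Type v} [CommRing K] {I : Type w} [SemilatticeInf I] (A : NCScheme.{u} K I)

/-- Quasi-coherent modules: the gluing maps `M_j ⊗_{A_j} A_i → M_i` are isomorphisms. -/
def isQuasiCoherent : ObjectProperty (RightPresheaf A.alg) := fun M =>
  ∀ ⦃i j : I⦄ (h : i < j), IsIso ((gluing A.alg (homOfLE h.le).op).app M)

/-- The category `Qcoh(A)`. -/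
abbrev Qcoh := (isQuasiCoherent A).FullSubcategory

section Abelian

/-- The objects at which a natural transformation is an isomorphism. -/
def isoLocus {C D : Type*} [Category C] [Category D] {F G : C ⥤ D} (α : F ⟶ G) :
    ObjectProperty C := fun X => IsIso (α.app X)

lemma isoLocus_of_isLimit {C D J : Type*} [Category C] [Category D] [Category J]
    {F G : C ⥤ D} (α : F ⟶ G) {E : J ⥤ C} {c : Cone E} (hc : IsLimit c)
    [PreservesLimit E F] [PreservesLimit E G] (h : ∀ j, isoLocus α (E.obj j)) :
    isoLocus α c.pt := by
  have (j : J) : IsIso ((Functor.whiskerLeft E α).app j) := h j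
  have : IsIso (Functor.whiskerLeft E α) := NatIso.isIso_of_isIso_app _
  have he : α.app c.pt = (IsLimit.conePointsIsoOfNatIso (isLimitOfPreserves F hc)
      (isLimitOfPreserves G hc) (asIso (Functor.whiskerLeft E α))).hom := by
    refine (isLimitOfPreserves G hc).hom_ext fun j => ?_
    refine Eq.trans ?_ (IsLimit.conePointsIsoOfNatIso_hom_comp (isLimitOfPreserves F hc)
      (isLimitOfPreserves G hc) (asIso (Functor.whiskerLeft E α)) j).symm
    exact (α.naturality (c.π.app j)).symm
  change IsIso (α.app c.pt)
  rw [he]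
  infer_instance

lemma isoLocus_of_isColimit {C D J : Type*} [Category C] [Category D] [Category J]
    {F G : C ⥤ D} (α : F ⟶ G) {E : J ⥤ C} {c : Cocone E} (hc : IsColimit c)
    [PreservesColimit E F] [PreservesColimit E G] (h : ∀ j, isoLocus α (E.obj j)) :
    isoLocus α c.pt := by
  have (j : J) : IsIso ((Functor.whiskerLeft E α).app j) := h j
  have : IsIso (Functor.whiskerLeft E α) := NatIso.isIso_of_isIso_app _
  have he : α.app c.pt = (IsColimit.coconePointsIsoOfNatIso (isColimitOfPreserves F hc)
      (isColimitOfPreserves G hc) (asIso (Functor.whiskerLeft E α))).hom := by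
    refine (isColimitOfPreserves F hc).hom_ext fun j => ?_
    refine Eq.trans ?_ (IsColimit.comp_coconePointsIsoOfNatIso_hom (isColimitOfPreserves F hc)
      (isColimitOfPreserves G hc) (asIso (Functor.whiskerLeft E α)) j).symm
    exact α.naturality (c.ι.app j)
  change IsIso (α.app c.pt)
  rw [he]
  infer_instance

lemma isQuasiCoherent_of_isLimit {J : Type} [SmallCategory J] [FinCategory J]
    {E : J ⥤ RightPresheaf A.alg} {c : Cone E} (hc : IsLimit c)
    (h : ∀ j, isQuasiCoherent A (E.obj j)) : isQuasiCoherent A c.pt := by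
  intro i j hij
  have := (A.flat hij).preservesFiniteLimits
  exact isoLocus_of_isLimit _ hc fun j => h j hij

lemma isQuasiCoherent_of_isColimit {J : Type} [SmallCategory J] [FinCategory J]
    {E : J ⥤ RightPresheaf A.alg} {c : Cocone E} (hc : IsColimit c)
    (h : ∀ j, isQuasiCoherent A (E.obj j)) : isQuasiCoherent A c.pt := by
  intro i j hij
  exact isoLocus_of_isColimit _ hc fun j => h j hij

instance : (isQuasiCoherent A).IsClosedUnderKernels where
  kernels_le := by
    rintro _ ⟨f, k, hk, hf⟩
    refine isQuasiCoherent_of_isLimit A hk ?_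
    rintro (_ | _)
    exacts [hf.1, hf.2]

instance : (isQuasiCoherent A).IsClosedUnderCokernels where
  cokernels_le := by
    rintro _ ⟨f, k, hk, hf⟩
    refine isQuasiCoherent_of_isColimit A hk ?_
    rintro (_ | _)
    exacts [hf.1, hf.2]

instance : (isQuasiCoherent A).IsClosedUnderFiniteProducts where
  isClosedUnderLimitsOfShape J _ :=
    { limitsOfShape_le := by
        rintro X ⟨p⟩
        have := Fintype.ofFinite J
        classical exact isQuasiCoherent_of_isLimit A p.isLimit p.prop_diag_obj }

instance : (isQuasiCoherent A).ContainsZero where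
  exists_zero := ⟨⊤_ (RightPresheaf A.alg), (isZero_zero _).of_iso
    (HasZeroObject.zeroIsoTerminal).symm, isQuasiCoherent_of_isLimit A
      (limit.isLimit (Functor.empty.{0} (RightPresheaf A.alg))) (by rintro ⟨⟨⟩⟩)⟩

/-- `Qcoh(A)` is abelian, kernels and cokernels being computed componentwise. -/
instance : Abelian (Qcoh A) := inferInstance

/-- A model of the derived category of `Qcoh(A)`. -/
instance : HasDerivedCategory (Qcoh A) := HasDerivedCategory.standard _

end Abelian

/-- A quasi-coherent module is coherent if all `M_i` are finitely generated right modules. -/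
def isCoherent : ObjectProperty (Qcoh A) := fun M =>
  ∀ i : I, Module.Finite (A.alg.obj (Opposite.op i))ᵐᵒᵖ ((component A.alg (Opposite.op i)).obj M.obj)

/-- A quasi-coherent module is locally free if, for some `r`, all `M_i` are free of rank `r`. -/
def isLocallyFree : ObjectProperty (Qcoh A) := fun M =>
  ∃ r : ℕ, ∀ i : I, Nonempty ((component A.alg (Opposite.op i)).obj M.obj
    ≃ₗ[(A.alg.obj (Opposite.op i))ᵐᵒᵖ] (Fin r → A.alg.obj (Opposite.op i)))

/-- The category `D^-coh(A)` as a full subcategory of the derived category of `Qcoh(A)`: the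
complexes whose cohomology is bounded above and coherent. -/
def dMinusCoh : ObjectProperty (DerivedCategory (Qcoh A)) := fun M =>
  (∃ n : ℤ, ∀ m : ℤ, n < m → IsZero ((DerivedCategory.homologyFunctor (Qcoh A) m).obj M)) ∧
    ∀ m : ℤ, isCoherent A ((DerivedCategory.homologyFunctor (Qcoh A) m).obj M)

variable {A}

/-- The `p`-th cohomology `R^p Hom_A(F, M) = Hom_{D(Qcoh(A))}(F, M[p])` of `RHom_A(F, M)`. -/
abbrev RHomCohomology (F : Qcoh A) (M : DerivedCategory (Qcoh A)) (p : ℤ) : Type _ :=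
  (DerivedCategory.singleFunctor (Qcoh A) 0).obj F ⟶ M⟦p⟧

/-- `RHom_A(F, M) ≇ 0`. -/
def RHomNonzero (F : Qcoh A) (M : DerivedCategory (Qcoh A)) : Prop :=
  ∃ p : ℤ, Nontrivial (RHomCohomology F M p)

/-- `F` generates `D^-coh(A)`. -/
def GeneratesDMinusCoh (F : Qcoh A) : Prop :=
  ∀ M : DerivedCategory (Qcoh A), dMinusCoh A M → ¬ IsZero M → RHomNonzero F M

end NCScheme
section BaseChange

variable {K : Type v} [CommRing K] {K' : Type v'} [CommRing K'] {I : Type w}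

section

variable [Preorder I] {A : Iᵒᵖ ⥤ AlgCat.{u} K} {A' : Iᵒᵖ ⥤ AlgCat.{u} K'}
  (β : A ⋙ forget₂ (AlgCat.{u} K) RingCat.{u} ⟶ A' ⋙ forget₂ (AlgCat.{u} K') RingCat.{u})

/-- The ring homomorphism `β_i : A_i → A'_i`. -/
abbrev betaHom (i : Iᵒᵖ) : A.obj i →+* A'.obj i := (β.app i).hom

lemma betaHom_comm {j i : Iᵒᵖ} (h : j ⟶ i) (x : A.obj j) :
    phi A' h (betaHom β j x) = betaHom β i (phi A h x) :=
  (congrArg (fun g => g.hom x) (β.naturality h)).symm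

/-- The presheaf `M ⊗_A A'` of right modules, with components `M_i ⊗_{A_i} A'_i`. -/
def baseChangePresheaf (M : RightPresheaf A) : RightPresheaf A' where
  obj i := (extendRight (betaHom β i)).obj ((component A i).obj M)
  map {j i} h := extendRightSquare (betaHom β j) (betaHom β i) (phi A h) (phi A' h)
    (betaHom_comm β h) (compMap M h)
  map_id i := extendRight_hom_ext _ fun m => by
    refine (extendRightSquare_tmul _ _ _ _ (betaHom_comm β (𝟙 i)) (compMap M (𝟙 i)) m 1).trans ?_
    have h1 : (compMap M (𝟙 i)).hom m = m := by
      change (M.map (𝟙 i)).hom m = m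
      rw [M.map_id]; rfl
    have h2 : phi A' (𝟙 i) 1 = 1 := map_one _
    change RightTensor.tmul (betaHom β i) (M := (component A i).obj M)
      ((compMap M (𝟙 i)).hom m) (phi A' (𝟙 i) 1) = RightTensor.tmul (betaHom β i) m 1
    rw [h2]
    exact congrArg (RightTensor.tmul (betaHom β i) (M := (component A i).obj M) · 1) h1
  map_comp {l j i} g h := extendRight_hom_ext _ fun m => by
    refine (extendRightSquare_tmul _ _ _ _ (betaHom_comm β (g ≫ h)) (compMap M (g ≫ h)) m 1).trans
      ?_
    have h1 : (compMap M (g ≫ h)).hom m = (compMap M h).hom ((compMap M g).hom m) :=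
      M.map_comp_apply g h m
    refine Eq.trans (b := RightTensor.tmul (betaHom β i) (M := (component A i).obj M)
      ((compMap M h).hom ((compMap M g).hom m)) 1) ?_ ?_
    · rw [map_one]
      exact congrArg (RightTensor.tmul (betaHom β i) (M := (component A i).obj M) · 1) h1
    · symm
      refine (congrArg (extendRightSquare (betaHom β j) (betaHom β i) (phi A h) (phi A' h)
        (betaHom_comm β h) (compMap M h)).hom (extendRightSquare_tmul (betaHom β l) (betaHom β j)
          (phi A g) (phi A' g) (betaHom_comm β g) (compMap M g) m 1)).trans ?_
      refine (extendRightSquare_tmul (betaHom β j) (betaHom β i) (phi A h) (phi A' h)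
        (betaHom_comm β h) (compMap M h) _ _).trans ?_
      rw [map_one, map_one]

end

variable [SemilatticeInf I] {A : NCScheme.{u} K I} {A' : NCScheme.{u} K' I}
  (β : A.alg ⋙ forget₂ (AlgCat.{u} K) RingCat.{u} ⟶
    A'.alg ⋙ forget₂ (AlgCat.{u} K') RingCat.{u})

/-- The quasi-coherent module `M ⊗_A A'` on `A'`, for a homomorphism `A → A'` and a
quasi-coherent module `M` on `A`. -/
def baseChangeQcoh (M : Qcoh A) : Qcoh A' where
  obj := baseChangePresheaf β M.obj
  property i j h := by
    have : IsIso (extendRightDesc (compMap M.obj (homOfLE h.le).op)) := M.property h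
    exact isIso_extendRightSquare _ _ _ _ (betaHom_comm β (homOfLE h.le).op)
      (compMap M.obj (homOfLE h.le).op)

end BaseChange
section Commutative

variable {S T : Type u} [CommRing S] [CommRing T] (f : S →+* T)

/-- For commutative rings, the canonical map from Mathlib's tensor product. -/
def fromTensor [Algebra S T] (hf : algebraMap S T = f) (M : Type u) [AddCommGroup M]
    [Module Sᵐᵒᵖ M] [Module S M] [IsCentralScalar S M] : T ⊗[S] M →+ RightTensor f M :=
  TensorProduct.liftAddHom
    (AddMonoidHom.mk' (fun t => AddMonoidHom.mk' (fun m => RightTensor.tmul f m t)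
      (fun m m' => RightTensor.tmul_add_left f m m' t))
      (fun t t' => by ext m; exact RightTensor.tmul_add_right f m t t'))
    (fun s t m => by
      change RightTensor.tmul f m (s • t) = RightTensor.tmul f (s • m) t
      rw [← op_smul_eq_smul s m, RightTensor.tmul_balanced, Algebra.smul_def, hf])

lemma fromTensor_tmul [Algebra S T] (hf : algebraMap S T = f) (M : Type u) [AddCommGroup M]
    [Module Sᵐᵒᵖ M] [Module S M] [IsCentralScalar S M] (t : T) (m : M) :
    fromTensor f hf M (t ⊗ₜ m) = RightTensor.tmul f m t := rfl

lemma fromTensor_bijective [Algebra S T] (hf : algebraMap S T = f) (M : Type u) [AddCommGroup M]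
    [Module Sᵐᵒᵖ M] [Module S M] [IsCentralScalar S M] :
    Function.Bijective (fromTensor f hf M) := by
  constructor
  · let q : RightTensor f M →ₗ[Tᵐᵒᵖ] T ⊗[S] M := RightTensor.lift f
      (AddMonoidHom.mk' (fun m => (1 : T) ⊗ₜ[S] m) (fun m m' => TensorProduct.tmul_add _ _ _))
      (fun s m => by
        change (1 : T) ⊗ₜ[S] (op s • m) = op (f s) • ((1 : T) ⊗ₜ[S] m)
        rw [op_smul_eq_smul, TensorProduct.smul_tmul', ← TensorProduct.smul_tmul, ← hf,
          Algebra.smul_def, op_smul_eq_mul, mul_one, one_mul])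
    have hq : Function.LeftInverse q (fromTensor f hf M) := fun x => by
      induction x with
      | zero => rw [map_zero, map_zero]
      | add x y hx hy => rw [map_add, map_add, hx, hy]
      | tmul t m =>
        rw [fromTensor_tmul]
        refine (RightTensor.lift_tmul f _ _ m t).trans ?_
        change op t • ((1 : T) ⊗ₜ[S] m) = _
        rw [TensorProduct.smul_tmul', op_smul_eq_mul, one_mul]
    exact hq.injective
  · intro x
    induction x using RightTensor.induction with
    | zero => exact ⟨0, map_zero _⟩
    | add x y hx hy =>
      obtain ⟨x, rfl⟩ := hx
      obtain ⟨y, rfl⟩ := hy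
      exact ⟨x + y, map_add _ _ _⟩
    | tmul m t => exact ⟨t ⊗ₜ m, rfl⟩

lemma flatRight_of_flat (hf : f.Flat) : FlatRight f := by
  intro M N _ _ _ _ h hh
  let _ : Algebra S T := f.toAlgebra
  have : Module.Flat S T := hf
  let _ : Module S M := Module.compHom M (RingEquiv.toOpposite S).toRingHom
  let _ : Module S N := Module.compHom N (RingEquiv.toOpposite S).toRingHom
  have : IsCentralScalar S M := ⟨fun _ _ => rfl⟩
  have : IsCentralScalar S N := ⟨fun _ _ => rfl⟩
  let h' : M →ₗ[S] N :=
    { toFun := h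
      map_add' := map_add h
      map_smul' := fun s m => map_smul h (op s) m }
  have H := Module.Flat.lTensor_preserves_injective_linearMap (M := T) h' hh
  have comm (x : T ⊗[S] M) : RightTensor.map f h (fromTensor f rfl M x) =
      fromTensor f rfl N (h'.lTensor T x) := by
    induction x with
    | zero => simp only [map_zero]
    | add x y hx hy => simp only [map_add, hx, hy]
    | tmul t m => exact RightTensor.map_tmul f h m t
  intro x y hxy
  obtain ⟨x, rfl⟩ := (fromTensor_bijective f rfl M).2 x
  obtain ⟨y, rfl⟩ := (fromTensor_bijective f rfl M).2 y
  rw [comm, comm] at hxy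
  rw [H ((fromTensor_bijective f rfl N).1 hxy)]

lemma counit_bijective_of_epi (hf : Epi (CommRingCat.ofHom f)) :
    Function.Bijective ((extendRestrictRight f).counit.app (ModuleCat.of Tᵐᵒᵖ T)).hom := by
  let _ : Algebra S T := f.toAlgebra
  have hepi : Algebra.IsEpi S T := CommRingCat.epi_iff_epi.1 hf
  let M : ModuleCat.{u} Sᵐᵒᵖ := (restrictRight f).obj (ModuleCat.of Tᵐᵒᵖ T)
  let p : RightTensor f M → T := ((extendRestrictRight f).counit.app (ModuleCat.of Tᵐᵒᵖ T)).hom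
  have hp (m t : T) : p (RightTensor.tmul f (M := M) m t) = m * t :=
    extendRightDesc_tmul (M := M) f (𝟙 M) m t
  let q : T ⊗[S] T →+ RightTensor f M := TensorProduct.liftAddHom
    (AddMonoidHom.mk' (fun t => AddMonoidHom.mk' (fun m => RightTensor.tmul f (M := M) m t)
      (fun m m' => RightTensor.tmul_add_left f (M := M) m m' t))
      (fun t t' => by ext m; exact RightTensor.tmul_add_right f (M := M) m t t'))
    (fun s t m => by
      change RightTensor.tmul f (M := M) m (f s * t) = RightTensor.tmul f (M := M) (f s * m) t
      rw [mul_comm (f s) m]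
      exact (RightTensor.tmul_balanced f (M := M) m s t).symm)
  have hq : Function.Surjective q := fun x => by
    induction x using RightTensor.induction with
    | zero => exact ⟨0, map_zero _⟩
    | add x y hx hy =>
      obtain ⟨x, rfl⟩ := hx
      obtain ⟨y, rfl⟩ := hy
      exact ⟨x + y, map_add _ _ _⟩
    | tmul m t => exact ⟨t ⊗ₜ m, rfl⟩
  have hpq (x : T ⊗[S] T) : p (q x) = TensorProduct.lift (LinearMap.mul S T) x := by
    induction x with
    | zero => rw [map_zero, map_zero]; exact map_zero _
    | add x y hx hy => rw [map_add, map_add, ← hx, ← hy]; exact map_add _ _ _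
    | tmul t m => exact (hp m t).trans (mul_comm m t)
  constructor
  · intro x y hxy
    obtain ⟨x, rfl⟩ := hq x
    obtain ⟨y, rfl⟩ := hq y
    change p (q x) = p (q y) at hxy
    rw [hpq, hpq] at hxy
    rw [hepi.injective_lift_mul hxy]
  · exact fun t => ⟨RightTensor.tmul f (M := M) t 1, (hp t 1).trans (mul_one (show T from t))⟩

end Commutative

section Deformation

open AlgebraicGeometry Opposite

/-- A covering `{U_i}` of a scheme by affine open subsets, indexed by a poset `I` with binary
minima such that `U_{i ∩ j} = U_i ∩ U_j` (in particular `i ≤ j` implies `U_i ⊆ U_j`). -/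
structure AffineCovering (X : Scheme.{u}) (I : Type w) [SemilatticeInf I] where
  /-- the open subsets `U_i` -/
  U : I → X.Opens
  isAffineOpen : ∀ i, IsAffineOpen (U i)
  map_inf : ∀ i j, U (i ⊓ j) = U i ⊓ U j
  iSup_eq_top : ⨆ i, U i = ⊤

variable (k : Type u) [Field k] {X : Scheme.{u}} [X.Over (Spec (CommRingCat.of k))]

/-- The structure map `k → Γ(X, U)` of a scheme over `k`. -/
def structMap (U : X.Opens) : k →+* Γ(X, U) :=
  ((Scheme.ΓSpecIso (CommRingCat.of k)).inv ≫
    (X ↘ Spec (CommRingCat.of k)).appLE ⊤ U (le_top (a := U))).hom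

/-- `Γ(X, U)` as a `k`-algebra. -/
def sectionsAlg (U : X.Opens) : AlgCat.{u} k :=
  letI := (structMap k U).toAlgebra
  AlgCat.of k Γ(X, U)

/-- The restriction map `Γ(X, V) → Γ(X, U)` for `U ⊆ V`. -/
def sectionsRes {U V : X.Opens} (h : U ≤ V) : sectionsAlg k V ⟶ sectionsAlg k U :=
  letI := (structMap k U).toAlgebra
  letI := (structMap k V).toAlgebra
  AlgCat.ofHom
    { (X.presheaf.map (homOfLE h).op).hom with
      commutes' := fun c => by
        change (X.presheaf.map (homOfLE h).op).hom (structMap k V c) = structMap k U c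
        have e := Scheme.Hom.appLE_map (X ↘ Spec (CommRingCat.of k)) (U := ⊤) (V := V)
          (le_top (a := V)) (homOfLE h).op
        exact congrArg
          (fun g => g.hom ((Scheme.ΓSpecIso (CommRingCat.of k)).inv.hom c)) e }

namespace AffineCovering

variable {I : Type w} [SemilatticeInf I] (𝒰 : AffineCovering X I)

lemma mono {i j : I} (h : i ≤ j) : 𝒰.U i ≤ 𝒰.U j := by
  have := 𝒰.map_inf i j
  rw [inf_eq_left.2 h] at this
  exact inf_eq_left.1 this.symm

/-- The algebras `A^0_i = Γ(X, U_i)` with the restriction maps `φ^0_{ij}`. -/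
def sections : Iᵒᵖ ⥤ AlgCat.{u} k where
  obj i := sectionsAlg k (𝒰.U i.unop)
  map h := sectionsRes k (𝒰.mono (leOfHom h.unop))
  map_id i := by
    ext x
    exact congrArg (fun g => g.hom x) (X.presheaf.map_id (op (𝒰.U i.unop)))
  map_comp g h := by
    ext x
    exact congrArg (fun g => g.hom x) (X.presheaf.map_comp
      (homOfLE (𝒰.mono (leOfHom g.unop))).op (homOfLE (𝒰.mono (leOfHom h.unop))).op)

/-- The NC scheme `A^0 = (A^0_i, φ^0_{ij})` of the covering. -/
def ncScheme : NCScheme.{u} k I where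
  alg := 𝒰.sections k
  flat i j h := by
    refine flatRight_of_flat (X.presheaf.map (homOfLE (𝒰.mono h.le)).op).hom ?_
    have := Flat.flat_appLE (𝟙 X) (𝒰.isAffineOpen j) (𝒰.isAffineOpen i) (𝒰.mono h.le)
    have e : (𝟙 X : X ⟶ X).appLE (𝒰.U j) (𝒰.U i) (𝒰.mono h.le) =
        X.presheaf.map (homOfLE (𝒰.mono h.le)).op := Category.id_comp _
    exact (congrArg (fun g => g.hom.Flat) e).mp this
  birational i j h := by
    refine counit_bijective_of_epi (X.presheaf.map (homOfLE (𝒰.mono h.le)).op).hom ⟨?_⟩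
    intro Z g g' hg
    have e := (𝒰.isAffineOpen j).map_fromSpec (𝒰.isAffineOpen i) (homOfLE (𝒰.mono h.le)).op
    have : Mono (Spec.map (X.presheaf.map (homOfLE (𝒰.mono h.le)).op)) :=
      mono_of_mono_fac e
    apply Spec.map_injective
    rw [← cancel_mono (Spec.map (X.presheaf.map (homOfLE (𝒰.mono h.le)).op)),
      ← Spec.map_comp, ← Spec.map_comp]
    exact congrArg Spec.map hg

end AffineCovering

/-- An NC deformation over a local `k`-algebra `R`, with maximal ideal `m`, of the scheme `X` with
the covering `{U_i}`: an NC scheme `A` over `R` whose algebras are flat over `R`, with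
isomorphisms `α_i : R/m ⊗_R A_i ≅ A^0_i` of `k`-algebras, compatible with the gluing
homomorphisms. -/
structure NCDeformation {I : Type w} [SemilatticeInf I] (𝒰 : AffineCovering X I)
    (R : Type v) [CommRing R] [IsLocalRing R] [Algebra k R] extends NCScheme.{u} R I where
  flat_over : ∀ i : I, Module.Flat R (alg.obj (op i))
  /-- the isomorphisms `α_i` -/
  α : ∀ i : I, (IsLocalRing.ResidueField R ⊗[R] alg.obj (op i)) ≃ₐ[k] (𝒰.sections k).obj (op i)
  α_comm : ∀ ⦃i j : I⦄ (h : i ≤ j) (x : IsLocalRing.ResidueField R ⊗[R] alg.obj (op j)),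
    ((𝒰.sections k).map (homOfLE h).op).hom (α j x) =
      α i (Algebra.TensorProduct.map (AlgHom.id R (IsLocalRing.ResidueField R))
        (alg.map (homOfLE h).op).hom x)

namespace NCDeformation

variable {k} {I : Type w} [SemilatticeInf I] {𝒰 : AffineCovering X I}
    {R : Type v} [CommRing R] [IsLocalRing R] [Algebra k R] (A : NCDeformation k 𝒰 R)

/-- The homomorphisms `A_i → A^0_i`, `a ↦ α_i(1 ⊗ a)`. -/
def reduction : A.alg ⋙ forget₂ (AlgCat.{u} R) RingCat.{u} ⟶
    (𝒰.ncScheme k).alg ⋙ forget₂ (AlgCat.{u} k) RingCat.{u} where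
  app i := RingCat.ofHom ((A.α i.unop).toAlgHom.toRingHom.comp
    (Algebra.TensorProduct.includeRight
      (R := R) (A := IsLocalRing.ResidueField R) (B := A.alg.obj i)).toRingHom)
  naturality j i h := by
    ext x
    refine Eq.trans ?_ (A.α_comm (leOfHom h.unop)
      ((1 : IsLocalRing.ResidueField R) ⊗ₜ[R] (x : A.alg.obj j))).symm
    rw [Algebra.TensorProduct.map_tmul, map_one]
    rfl

/-- The quasi-coherent module `F^0 = R/m ⊗_R F = F ⊗_A A^0` on `A^0`; its components are
`F_i ⊗_{A_i} A^0_i = F_i ⊗_{A_i} (R/m ⊗_R A_i) = R/m ⊗_R F_i`. -/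
def reductionQcoh (F : Qcoh A.toNCScheme) : Qcoh (𝒰.ncScheme k) :=
  baseChangeQcoh A.reduction F

end NCDeformation

end Deformation
end

/-! Suppose M is a nonzero object of D^-coh(A) with Hom(F, M[p]) = 0 for all p. Let L = - ⊗_A A^0,
with right adjoint ρ, the restriction of scalars, which is exact. Let n be the top degree in which M
has cohomology, and represent M by a complex P in degrees ≤ n whose terms are flat over R. Then L P
is the derived reduction of M. It is shown to be a nonzero object of D^-coh(A^0) with Hom(L F, L
P[p]) = 0 for all p, which contradicts the hypothesis on F^0 = L F. The formal argument is
`generatesBoundedAbove_of_map`.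

Nonvanishing: L is right exact, so H^n(L P) = L(H^n P), and this is nonzero by Nakayama's lemma for
the nilpotent ideal m (`Qcoh.isZero_of_isZero_baseChange`).

Vanishing and coherence: ρ L P = P/mP is the cokernel of the column P^b → P formed by generators of
m. Since R is Noetherian and P is flat over R, taking syzygies of matrices over R again and again
resolves P/mP by finite powers of P (`Qcoh.isSyzygyClosed_isMatrixCokernel`). This resolution is
usually infinite, but all its syzygies sit in degrees ≤ n. Each step embeds Hom(F, Z[p]) into Hom(F,
Z'[p+1]) for the next syzygy Z', and F has cohomological dimension at most |I| on complexes in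
degrees ≤ n, uniformly in the complex (`Qcoh.homVanishes_of_acyclicAt`). Hence Hom(F, ρ L P[p]) = 0
for all p. The same short exact sequences show that ρ L P has coherent cohomology, so L P lies in
D^-coh(A^0). Finally Hom(L F, L P[p]) embeds into Hom(F, ρ L P[p]) by the derived adjunction
(`eq_zero_of_homVanishes_restriction`).

The geometric inputs, flat covers (`Qcoh.exists_isFlat`) and the bound on the cohomological
dimension, rest on the functors T_i, restriction to a chart followed by direct image, (T_i M)_l =
M_{l ∩ i}. That T_i M is quasi-coherent requires A_a ⊗_{A_j} A_b = A_{a ∩ b}. This is known for A^0,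
where intersections of affine opens give pushouts, and lifts to A by nilpotence of m and flatness
over R (`IsReduction.bijective_squareMap`). Flatness over R is expressed by linear equations with
coefficients in R, so that it applies directly to right modules on which R acts through the centre
of A_i. -/

section Resolution

/-! ### Left resolutions of bounded above complexes by objects of a covering class. -/

open HomologicalComplex

variable {C : Type*} [Category* C] {𝓕 : ObjectProperty C}

/-- A stage in the construction of a resolution of a chain complex by objects of `𝓕`. -/
structure ResolutionStage (𝓕 : ObjectProperty C) (Y : C) where
  /-- the object constructed at this stage -/
  P : C
  prop : 𝓕 P
  /-- the object constructed at the previous stage -/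
  Q : C
  /-- the differential -/
  d : P ⟶ Q
  /-- the map to the resolved complex -/
  f : P ⟶ Y

namespace ResolutionStage

variable (h𝓕 : ∀ X : C, ∃ (P : C) (_ : 𝓕 P) (p : P ⟶ X), Epi p)

/-- A cover of `X` by an object of `𝓕`. -/
noncomputable def cover (X : C) : C := (h𝓕 X).choose

lemma prop_cover (X : C) : 𝓕 (cover h𝓕 X) := (h𝓕 X).choose_spec.choose

/-- The projection of the cover. -/
noncomputable def coverπ (X : C) : cover h𝓕 X ⟶ X := (h𝓕 X).choose_spec.choose_spec.choose

instance (X : C) : Epi (coverπ h𝓕 X) := (h𝓕 X).choose_spec.choose_spec.choose_spec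

variable [Abelian C]

/-- The object to be covered in the next stage. -/
noncomputable abbrev next {Y Y' : C} (S : ResolutionStage 𝓕 Y) (g : Y' ⟶ Y) : C :=
  pullback (kernel.ι S.d ≫ S.f) g

/-- The next stage. -/
noncomputable def step {Y Y' : C} (S : ResolutionStage 𝓕 Y) (g : Y' ⟶ Y) :
    ResolutionStage 𝓕 Y' where
  P := cover h𝓕 (S.next g)
  prop := prop_cover h𝓕 _
  Q := S.P
  d := coverπ h𝓕 (S.next g) ≫ pullback.fst _ _ ≫ kernel.ι S.d
  f := coverπ h𝓕 (S.next g) ≫ pullback.snd _ _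

variable (K : ChainComplex C ℕ)

/-- The stages of the resolution of a chain complex. -/
noncomputable def stages : ∀ n : ℕ, ResolutionStage 𝓕 (K.X n)
  | 0 => { P := cover h𝓕 (K.X 0), prop := prop_cover h𝓕 _, Q := K.X 0, d := 0, f := coverπ h𝓕 _ }
  | n + 1 => (stages n).step h𝓕 (K.d (n + 1) n)

/-- The resolution of a chain complex by objects of `𝓕`. -/
noncomputable def complex : ChainComplex C ℕ :=
  ChainComplex.of (fun n => (stages h𝓕 K n).P) (fun n => (stages h𝓕 K (n + 1)).d) (fun n => by
    change (coverπ h𝓕 ((stages h𝓕 K (n + 1)).next (K.d (n + 2) (n + 1))) ≫ pullback.fst _ _ ≫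
      kernel.ι (stages h𝓕 K (n + 1)).d) ≫ (stages h𝓕 K (n + 1)).d = 0
    rw [Category.assoc, Category.assoc, kernel.condition, comp_zero, comp_zero])

lemma complex_d (n : ℕ) : (complex h𝓕 K).d (n + 1) n = (stages h𝓕 K (n + 1)).d :=
  ChainComplex.of_d (fun n => (stages h𝓕 K n).P) (fun n => (stages h𝓕 K (n + 1)).d) n

/-- The map from the resolution. -/
noncomputable def complexπ : complex h𝓕 K ⟶ K where
  f n := (stages h𝓕 K n).f
  comm' i j hij := by
    obtain rfl : j + 1 = i := hij
    rw [complex_d]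
    change (coverπ h𝓕 ((stages h𝓕 K j).next (K.d (j + 1) j)) ≫ pullback.snd _ _) ≫ _ =
      (coverπ h𝓕 ((stages h𝓕 K j).next (K.d (j + 1) j)) ≫ pullback.fst _ _ ≫
        kernel.ι (stages h𝓕 K j).d) ≫ (stages h𝓕 K j).f
    rw [Category.assoc, Category.assoc, Category.assoc, pullback.condition]

/-- The pair (x, y) is a point of the pullback that the next stage covers, so it lifts after
refining T. Both halves of the quasi-isomorphism are instances of this. -/
lemma exists_lift (n : ℕ) {T : C} (x : T ⟶ (stages h𝓕 K n).P) (y : T ⟶ K.X (n + 1))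
    (hx : x ≫ (stages h𝓕 K n).d = 0) (h : x ≫ (stages h𝓕 K n).f = y ≫ K.d (n + 1) n) :
    ∃ (T' : C) (π : T' ⟶ T) (_ : Epi π) (z : T' ⟶ (stages h𝓕 K (n + 1)).P),
      z ≫ (stages h𝓕 K (n + 1)).d = π ≫ x ∧ z ≫ (stages h𝓕 K (n + 1)).f = π ≫ y := by
  obtain ⟨T', π, hπ, z, hz⟩ := surjective_up_to_refinements_of_epi
    (coverπ h𝓕 ((stages h𝓕 K n).next (K.d (n + 1) n)))
    (pullback.lift (kernel.lift _ x hx) y (by rw [kernel.lift_ι_assoc, h]))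
  refine ⟨T', π, hπ, z, ?_, ?_⟩
  · change z ≫ coverπ h𝓕 ((stages h𝓕 K n).next (K.d (n + 1) n)) ≫ pullback.fst _ _ ≫
        kernel.ι (stages h𝓕 K n).d = _
    rw [← reassoc_of% hz, pullback.lift_fst_assoc, kernel.lift_ι]
  · change z ≫ coverπ h𝓕 ((stages h𝓕 K n).next (K.d (n + 1) n)) ≫ pullback.snd _ _ = _
    rw [← reassoc_of% hz, pullback.lift_snd]

lemma comp_stages_d (n : ℕ) {T : C} (x : T ⟶ (complex h𝓕 K).X n)
    (hx : x ≫ (complex h𝓕 K).d n ((ComplexShape.down ℕ).next n) = 0) :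
    x ≫ (stages h𝓕 K n).d = 0 := by
  cases n with
  | zero => exact comp_zero
  | succ n =>
    rw [ChainComplex.next_nat_succ, complex_d] at hx
    exact hx

/-- Injectivity on homology is `exists_lift` for a cycle x whose image is the boundary of y.
Surjectivity in positive degree is `exists_lift` with x = 0, and in degree 0 it holds because P_0
covers K_0. -/
instance quasiIso_complexπ : QuasiIso (complexπ h𝓕 K) := by
  refine ⟨fun n => ?_⟩
  rw [quasiIsoAt_iff_isIso_homologyMap]
  have : Mono (homologyMap (complexπ h𝓕 K) n) := by
    rw [mono_homologyMap_iff_up_to_refinements _ (n + 1) n _ (ChainComplex.prev ℕ n) rfl]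
    intro T x hx y hy
    obtain ⟨T', π, hπ, z, h1, -⟩ := exists_lift h𝓕 K n x y (comp_stages_d h𝓕 K n x hx) hy
    exact ⟨T', π, hπ, z, by rw [complex_d]; exact h1.symm⟩
  have : Epi (homologyMap (complexπ h𝓕 K) n) := by
    rw [epi_homologyMap_iff_up_to_refinements _ (n + 1) n _ (ChainComplex.prev ℕ n) rfl]
    intro T y hy
    cases n with
    | zero =>
      obtain ⟨T', π, hπ, z, hz⟩ := surjective_up_to_refinements_of_epi (coverπ h𝓕 (K.X 0)) y
      refine ⟨T', π, hπ, z, ?_, 0, ?_⟩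
      · rw [shape _ _ _ (by simp)]; exact comp_zero
      · rw [zero_comp, add_zero]; exact hz
    | succ n =>
      rw [ChainComplex.next_nat_succ] at hy ⊢
      obtain ⟨T', π, hπ, z, h1, h2⟩ := exists_lift h𝓕 K n 0 y zero_comp (by rw [hy, zero_comp])
      refine ⟨T', π, hπ, z, ?_, 0, ?_⟩
      · rw [complex_d]; exact h1.trans comp_zero
      · rw [zero_comp, add_zero]; exact h2.symm
  exact isIso_of_mono_of_epi _

end ResolutionStage

/-- Bounded above complexes have resolutions by objects of a class of objects of which every
object is a quotient. -/
lemma CochainComplex.exists_resolution [Abelian C] [𝓕.IsClosedUnderIsomorphisms] [𝓕.ContainsZero]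
    (h𝓕 : ∀ X : C, ∃ (P : C) (_ : 𝓕 P) (p : P ⟶ X), Epi p)
    (K : CochainComplex C ℤ) (n : ℤ) [K.IsStrictlyLE n] :
    ∃ (P : CochainComplex C ℤ) (_ : P.IsStrictlyLE n) (_ : ∀ i, 𝓕 (P.X i)) (φ : P ⟶ K),
      QuasiIso φ := by
  let e := ComplexShape.embeddingUpIntLE n
  -- The lifting condition concerns degrees n - j whose predecessor is outside the image of the
  -- embedding. There are none, since the predecessor is n - (j + 1).
  have he : e.HasLift (𝟙 (K.restriction e)) := by
    intro j hj i' hi'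
    obtain ⟨h1, h2⟩ := hj
    have h3 := h2 (j + 1)
    refine absurd ?_ h3
    change (n - ((j + 1 : ℕ) : ℤ)) + 1 = n - (j : ℤ)
    push_cast
    ring
  let g : K ⟶ (K.restriction e).extend e := e.liftExtend (𝟙 _) he
  have hP (X : ChainComplex C ℕ) (i : ℤ) (hi : n < i) : IsZero ((X.extend e).X i) := by
    refine X.isZero_extend_X e i (fun j hj => ?_)
    change n - (j : ℤ) = i at hj
    lia
  have hf (i : ℤ) (hi : i ≤ n) : e.f (n - i).toNat = i := by
    change n - ((n - i).toNat : ℤ) = i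
    lia
  have hg : IsIso g := by
    refine @HomologicalComplex.Hom.isIso_of_components _ _ _ _ _ _ _ _ (fun i => ?_)
    by_cases hi : i ≤ n
    · rw [ComplexShape.Embedding.isIso_liftExtend_f_iff _ _ _ (hf i hi)]
      change IsIso (𝟙 _)
      infer_instance
    · exact (K.isZero_of_isStrictlyLE n i (by lia)).isIso (hP _ i (by lia)) _
  let P := ResolutionStage.complex h𝓕 (K.restriction e)
  refine ⟨P.extend e, ?_, ?_, extendMap (ResolutionStage.complexπ h𝓕 (K.restriction e)) e ≫ inv g,
    ?_⟩
  · rw [CochainComplex.isStrictlyLE_iff]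
    exact hP P
  · intro i
    by_cases hi : i ≤ n
    · exact 𝓕.prop_of_iso (P.extendXIso e (hf i hi)).symm
        (ResolutionStage.stages h𝓕 (K.restriction e) _).prop
    · exact 𝓕.prop_of_isZero (hP _ _ (by lia))
  · have : QuasiIso (extendMap (ResolutionStage.complexπ h𝓕 (K.restriction e)) e) := by
      rw [quasiIso_extendMap_iff]
      infer_instance
    infer_instance

end Resolution

/-! ### Vanishing of Hom(X, Y[p]) in distinguished triangles. -/

section Vanishing

open Pretriangulated

/-- `Hom(X, Y[p]) = 0`. -/
def HomVanishes {D : Type*} [Category* D] [Preadditive D] [HasShift D ℤ] (X Y : D) (p : ℤ) : Prop :=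
  ∀ f : X ⟶ Y⟦p⟧, f = 0

namespace HomVanishes

section

variable {D : Type*} [Category* D] [Preadditive D] [HasShift D ℤ] {X : D}

lemma of_iso {Y Y' : D} (e : Y ≅ Y') {p : ℤ} (h : HomVanishes X Y p) : HomVanishes X Y' p := by
  intro f
  rw [← cancel_mono (((shiftFunctor D p).mapIso e).inv), zero_comp]
  exact h _

lemma of_isZero {Y : D} [∀ n : ℤ, (shiftFunctor D n).Additive] (h : IsZero Y) (p : ℤ) :
    HomVanishes X Y p :=
  fun _ => ((shiftFunctor D p).map_isZero h).eq_of_tgt _ _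

lemma shift {Y : D} {a b c : ℤ} (h : a + b = c) (hY : HomVanishes X Y c) :
    HomVanishes X (Y⟦a⟧) b := by
  intro f
  rw [← cancel_mono ((shiftFunctorAdd' D a b c h).inv.app Y), zero_comp]
  exact hY _

/-- The identity of Y is a sum of maps factoring through Z, so every map to Y[p] is a sum of maps
factoring through Z[p]. -/
lemma of_sum [∀ n : ℤ, (shiftFunctor D n).Additive] {Y Z : D} {J : Type*} [Fintype J]
    (π : J → (Y ⟶ Z)) (ι : J → (Z ⟶ Y)) (h : ∑ j, π j ≫ ι j = 𝟙 Y) {p : ℤ}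
    (hZ : HomVanishes X Z p) : HomVanishes X Y p := by
  intro f
  have : f ≫ (shiftFunctor D p).map (𝟙 Y) = f := by
    rw [CategoryTheory.Functor.map_id]; exact Category.comp_id f
  rw [← this, ← h, Functor.map_sum, Preadditive.comp_sum]
  refine Finset.sum_eq_zero fun j _ => ?_
  rw [Functor.map_comp, ← Category.assoc, hZ (f ≫ (shiftFunctor D p).map (π j)), zero_comp]

end

variable {D : Type*} [Category* D] [Preadditive D] [HasZeroObject D] [HasShift D ℤ]
  [∀ n : ℤ, (shiftFunctor D n).Additive] [Pretriangulated D] {X : D}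
  {T : Triangle D} (hT : T ∈ distTriang D)

include hT

/-- Exactness of Hom(X, T₂[p]) → Hom(X, T₃[p]) → Hom(X, T₁[p+1]). -/
lemma obj₃ {p q : ℤ} (hpq : p + 1 = q) (h₂ : HomVanishes X T.obj₂ p)
    (h₁ : HomVanishes X T.obj₁ q) : HomVanishes X T.obj₃ p := by
  intro f
  obtain ⟨g, rfl⟩ := Triangle.coyoneda_exact₃ _ (Triangle.shift_distinguished T hT p) f
    (h₁.shift hpq _)
  rw [h₂ g]
  exact zero_comp

/-- Exactness of Hom(X, T₃[p]) → Hom(X, T₁[p+1]) → Hom(X, T₂[p+1]). -/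
lemma obj₁ {p q : ℤ} (hpq : p + 1 = q) (h₃ : HomVanishes X T.obj₃ p)
    (h₂ : HomVanishes X T.obj₂ q) : HomVanishes X T.obj₁ q := by
  intro f
  obtain ⟨g, hg⟩ := Triangle.coyoneda_exact₁ _ (Triangle.shift_distinguished T hT p)
    (f ≫ (shiftFunctorAdd' D p 1 q hpq).hom.app T.obj₁) (h₂.shift hpq _)
  rw [← cancel_mono ((shiftFunctorAdd' D p 1 q hpq).hom.app T.obj₁)]
  refine hg.trans ?_
  rw [h₃ g]
  exact zero_comp.trans zero_comp.symm

end HomVanishes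

end Vanishing

/-! ### Acyclic complexes and zero morphisms in the derived category. -/

namespace DerivedCategory

variable {C : Type*} [Category* C] [Abelian C] [HasDerivedCategory C]

open ZeroObject in
lemma isZero_Q_obj_iff (K : CochainComplex C ℤ) : IsZero (Q.obj K) ↔ K.Acyclic := by
  constructor
  · intro h i
    rw [HomologicalComplex.exactAt_iff_isZero_homology]
    exact ((homologyFunctor C i).map_isZero h).of_iso ((homologyFunctorFactors C i).app K).symm
  · intro h
    have : QuasiIso (0 : K ⟶ 0) := by
      refine ⟨fun i => ?_⟩
      rw [quasiIsoAt_iff_exactAt _ _ (h i), HomologicalComplex.exactAt_iff_isZero_homology]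
      exact (HomologicalComplex.homologyFunctor C _ i).map_isZero (isZero_zero _)
    have := (isIso_Q_map_iff_quasiIso (C := C) (0 : K ⟶ 0)).2 this
    exact (Q.map_isZero (isZero_zero _)).of_iso (asIso (Q.map (0 : K ⟶ 0)))

lemma acyclic_mappingCone_iff {K L : CochainComplex C ℤ} (f : K ⟶ L) :
    (CochainComplex.mappingCone f).Acyclic ↔ QuasiIso f := by
  rw [← isZero_Q_obj_iff, ← isIso_Q_map_iff_quasiIso]
  exact Pretriangulated.Triangle.isZero₃_iff_isIso₁ _ (mappingCone_triangle_distinguished f)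

/-- The derived category is a localization of the homotopy category with a calculus of fractions, so
two maps that become equal there are already equalized by a quasi-isomorphism into the source. -/
lemma exists_homotopy_of_Q_map_eq_zero {K L : CochainComplex C ℤ} (f : K ⟶ L) (hf : Q.map f = 0) :
    ∃ (K' : CochainComplex C ℤ) (s : K' ⟶ K) (_ : QuasiIso s), Nonempty (Homotopy (s ≫ f) 0) := by
  have h : Qh.map ((HomotopyCategory.quotient _ _).map f) =
      Qh.map ((HomotopyCategory.quotient _ _).map (0 : K ⟶ L)) := by
    rw [Functor.map_zero, Functor.map_zero]
    exact hf
  rw [MorphismProperty.map_eq_iff_precomp Qh (HomotopyCategory.quasiIso C (.up ℤ))] at h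
  obtain ⟨K', s, hs, h⟩ := h
  obtain ⟨K', rfl⟩ := HomotopyCategory.quotient_obj_surjective K'
  obtain ⟨s, rfl⟩ := (HomotopyCategory.quotient _ _).map_surjective s
  rw [HomotopyCategory.quotient_map_mem_quasiIso_iff] at hs
  refine ⟨K', s, hs, ⟨HomotopyCategory.homotopyOfEq _ _ ?_⟩⟩
  rw [Functor.map_comp, h, ← Functor.map_comp, comp_zero]

end DerivedCategory

/-! ### Functors exact on a class of objects preserve quasi-isomorphisms of bounded above complexes
of such objects. -/

section LeftExactness

open HomologicalComplex

variable {C : Type*} [Category* C] [Abelian C] {C₀ : Type*} [Category* C₀] [Abelian C₀]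

/-- The short complex `Z^i → K^i → Z^{i+1}`. -/
noncomputable abbrev CochainComplex.cyclesShortComplex (K : CochainComplex C ℤ) (i : ℤ) :
    ShortComplex C :=
  ShortComplex.mk (K.iCycles i) (K.toCycles i (i + 1)) (by
    rw [← cancel_mono (K.iCycles (i + 1)), Category.assoc, toCycles_i, iCycles_d, zero_comp])

/-- Left exactness is formal; exactness of K in degree i + 1 says that every cycle there is a
boundary, which is the surjectivity on the right. -/
lemma CochainComplex.cyclesShortComplex_shortExact (K : CochainComplex C ℤ) (i : ℤ)
    (h : K.ExactAt (i + 1)) : (K.cyclesShortComplex i).ShortExact where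
  exact := by
    rw [ShortComplex.exact_iff_exact_up_to_refinements]
    intro T x hx
    refine ⟨T, 𝟙 _, inferInstance, K.liftCycles x (i + 1) (by simp) ?_, ?_⟩
    · have h1 : x ≫ K.toCycles i (i + 1) = 0 := hx
      rw [← K.toCycles_i i (i + 1), reassoc_of% h1, zero_comp]
    · rw [Category.id_comp]
      exact (K.liftCycles_i _ _ _ _).symm
  mono_f := inferInstanceAs (Mono (K.iCycles i))
  epi_g := by
    change Epi (K.toCycles i (i + 1))
    rw [epi_iff_surjective_up_to_refinements]
    intro T y
    rw [K.exactAt_iff_exact_up_to_refinements i (i + 1) (i + 2) (by simp) (by simp; lia)] at h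
    obtain ⟨T', π, hπ, x, hx⟩ := h (y ≫ K.iCycles (i + 1)) (by simp)
    refine ⟨T', π, hπ, x, ?_⟩
    rw [← cancel_mono (K.iCycles (i + 1)), Category.assoc, hx, Category.assoc, toCycles_i]

/-- A functor is exact on the short exact sequences of objects satisfying `𝓕`, and `𝓕` is stable
under kernels of epimorphisms. -/
structure CategoryTheory.Functor.ExactOn (L : C ⥤ C₀) [L.Additive] (𝓕 : ObjectProperty C) :
    Prop where
  prop_X₁ : ∀ S : ShortComplex C, S.ShortExact → 𝓕 S.X₂ → 𝓕 S.X₃ → 𝓕 S.X₁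
  map : ∀ S : ShortComplex C, S.ShortExact → 𝓕 S.X₁ → 𝓕 S.X₂ → 𝓕 S.X₃ → (S.map L).ShortExact

variable {L : C ⥤ C₀} [L.Additive] {𝓕 : ObjectProperty C}

/-- Descending induction: Z^i vanishes above n, and Z^i is the kernel of the epimorphism P^i →
Z^{i+1}. -/
lemma CategoryTheory.Functor.ExactOn.prop_cycles [𝓕.IsClosedUnderIsomorphisms] [𝓕.ContainsZero]
    (hL : L.ExactOn 𝓕) (P : CochainComplex C ℤ) (n : ℤ) [P.IsStrictlyLE n] (hP : ∀ i, 𝓕 (P.X i))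
    (h : P.Acyclic) (i : ℤ) : 𝓕 (P.cycles i) := by
  suffices ∀ (k : ℕ) (i : ℤ), n < i + k → 𝓕 (P.cycles i) from
    this (n + 1 - i).toNat i (by lia)
  intro k
  induction k with
  | zero =>
    intro i hi
    exact 𝓕.prop_of_isZero (IsZero.of_mono (P.iCycles i)
      (P.isZero_of_isStrictlyLE n i (by simpa using hi)))
  | succ k hk =>
    intro i hi
    exact hL.prop_X₁ _ (P.cyclesShortComplex_shortExact i (h _)) (hP i)
      (hk (i + 1) (by push_cast at hi; lia))

/-- P is spliced from the sequences Z^i → P^i → Z^{i+1}, whose terms all satisfy 𝓕, and L keeps each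
of them exact. -/
lemma CategoryTheory.Functor.ExactOn.map_acyclic [𝓕.IsClosedUnderIsomorphisms] [𝓕.ContainsZero]
    (hL : L.ExactOn 𝓕) (P : CochainComplex C ℤ) (n : ℤ) [P.IsStrictlyLE n] (hP : ∀ i, 𝓕 (P.X i))
    (h : P.Acyclic) : ((L.mapHomologicalComplex (.up ℤ)).obj P).Acyclic := by
  intro j
  obtain ⟨i, rfl⟩ : ∃ i, i + 1 = j := ⟨j - 1, by lia⟩
  have hZ := hL.prop_cycles P n hP h
  have S (i : ℤ) := hL.map _ (P.cyclesShortComplex_shortExact i (h _)) (hZ i) (hP i) (hZ (i + 1))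
  rw [exactAt_iff_exact_up_to_refinements _ i (i + 1) (i + 1 + 1) (by simp) (by simp)]
  intro T (x : T ⟶ L.obj (P.X (i + 1))) (hx' : x ≫ L.map (P.d (i + 1) (i + 1 + 1)) = 0)
  have h1 : x ≫ L.map (P.toCycles (i + 1) (i + 1 + 1)) = 0 := by
    have : Mono (L.map (P.iCycles (i + 1 + 1))) := (S (i + 1 + 1)).mono_f
    rw [← cancel_mono (L.map (P.iCycles (i + 1 + 1))), Category.assoc, ← L.map_comp, toCycles_i,
      hx', zero_comp]
  obtain ⟨T', π, hπ, (y : T' ⟶ L.obj (P.cycles (i + 1))),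
    (hy' : π ≫ x = y ≫ L.map (P.iCycles (i + 1)))⟩ := (S (i + 1)).exact.exact_up_to_refinements x h1
  have : Epi (L.map (P.toCycles i (i + 1))) := (S i).epi_g
  obtain ⟨T'', π', hπ', z, hz⟩ :=
    surjective_up_to_refinements_of_epi (L.map (P.toCycles i (i + 1))) y
  refine ⟨T'', π' ≫ π, epi_comp _ _, z, ?_⟩
  change (π' ≫ π) ≫ x = z ≫ L.map (P.d i (i + 1))
  rw [Category.assoc, hy', reassoc_of% hz, ← L.map_comp, toCycles_i]

/-- The cone of f is an acyclic bounded above complex with terms in 𝓕, and L commutes with the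
formation of cones. -/
lemma CategoryTheory.Functor.ExactOn.map_quasiIso [𝓕.IsClosedUnderIsomorphisms] [𝓕.ContainsZero]
    [𝓕.IsClosedUnderExtensions]
    (hL : L.ExactOn 𝓕) {P P' : CochainComplex C ℤ} (f : P ⟶ P') [QuasiIso f] (n : ℤ)
    [P.IsStrictlyLE n] [P'.IsStrictlyLE n] (hP : ∀ i, 𝓕 (P.X i)) (hP' : ∀ i, 𝓕 (P'.X i)) :
    QuasiIso ((L.mapHomologicalComplex (.up ℤ)).map f) := by
  let _ : HasDerivedCategory C := HasDerivedCategory.standard _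
  let _ : HasDerivedCategory C₀ := HasDerivedCategory.standard _
  have h := (DerivedCategory.acyclic_mappingCone_iff f).2 inferInstance
  have hX (i : ℤ) : Nonempty ((CochainComplex.mappingCone f).X i ≅ P.X (i + 1) ⊞ P'.X i) :=
    ⟨HomologicalComplex.homotopyCofiber.XIsoBiprod f i (i + 1) (by simp)⟩
  have : (CochainComplex.mappingCone f).IsStrictlyLE n := by
    rw [CochainComplex.isStrictlyLE_iff]
    intro i hi
    rw [CochainComplex.mappingCone.isZero_X_iff]
    exact ⟨P.isZero_of_isStrictlyLE n _ (by lia), P'.isZero_of_isStrictlyLE n _ (by lia)⟩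
  rw [← DerivedCategory.acyclic_mappingCone_iff]
  have h2 := hL.map_acyclic (CochainComplex.mappingCone f) n
    (fun i => 𝓕.prop_of_iso (hX i).some.symm (𝓕.prop_biprod (hP _) (hP' _))) h
  have e := CochainComplex.mappingCone.mapHomologicalComplexIso f L
  rw [← DerivedCategory.isZero_Q_obj_iff] at h2 ⊢
  exact h2.of_iso (DerivedCategory.Q.mapIso e).symm

end LeftExactness

/-! ### The derived adjunction. -/

section DerivedAdjunction

open DerivedCategory HomologicalComplex

variable {C : Type*} [Category* C] [Abelian C] [HasDerivedCategory C]
  {C₀ : Type*} [Category* C₀] [Abelian C₀] [HasDerivedCategory C₀]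
  {L : C ⥤ C₀} {ρ : C₀ ⥤ C} [L.Additive] [ρ.Additive] (adj : L ⊣ ρ)

/-- The counit of the adjunction on cochain complexes. -/
abbrev counitComplex (Y : CochainComplex C₀ ℤ) :
    (L.mapHomologicalComplex (.up ℤ)).obj ((ρ.mapHomologicalComplex (.up ℤ)).obj Y) ⟶ Y where
  f i := adj.counit.app (Y.X i)
  comm' i j _ := (adj.counit.naturality (Y.d i j)).symm

/-- The unit of the adjunction on cochain complexes. -/
abbrev unitComplex (X : CochainComplex C ℤ) :
    X ⟶ (ρ.mapHomologicalComplex (.up ℤ)).obj ((L.mapHomologicalComplex (.up ℤ)).obj X) where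
  f i := adj.unit.app (X.X i)
  comm' i j _ := (adj.unit.naturality (X.d i j)).symm

include adj in
/-- The derived adjunction between `L` and the exact functor `ρ`, in the form of the injectivity of
`Hom(L E, Y) → Hom(E, ρ Y)` for a bounded above complex `E` of `L`-acyclic objects. -/
lemma eq_zero_of_homVanishes_restriction [PreservesFiniteLimits ρ] [PreservesFiniteColimits ρ]
    {𝓕 : ObjectProperty C} [𝓕.IsClosedUnderIsomorphisms] [𝓕.ContainsZero]
    [𝓕.IsClosedUnderExtensions] (h𝓕 : ∀ X : C, ∃ (P : C) (_ : 𝓕 P) (p : P ⟶ X), Epi p)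
    (hL : L.ExactOn 𝓕) (E : CochainComplex C ℤ) (n : ℤ) [E.IsStrictlyLE n] (hE : ∀ i, 𝓕 (E.X i))
    (N : CochainComplex C₀ ℤ)
    (h : ∀ ψ : Q.obj E ⟶ Q.obj ((ρ.mapHomologicalComplex (.up ℤ)).obj N), ψ = 0)
    (φ : Q.obj ((L.mapHomologicalComplex (.up ℤ)).obj E) ⟶ Q.obj N) : φ = 0 := by
  -- φ is the roof g : L E → Y followed by the inverse of a quasi-isomorphism s : N → Y, so only g
  -- has to be killed. Its adjoint g' : E → ρ Y dies in the derived category by the hypothesis,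
  -- because ρ s is again a quasi-isomorphism.
  obtain ⟨Y, g, s, hs, rfl⟩ := left_fac φ
  suffices Q.map g = 0 by rw [this, zero_comp]
  rw [isIso_Q_map_iff_quasiIso] at hs
  let g' : E ⟶ (ρ.mapHomologicalComplex (.up ℤ)).obj Y :=
    unitComplex adj E ≫ (ρ.mapHomologicalComplex (.up ℤ)).map g
  have hg' : Q.map g' = 0 := by
    have : QuasiIso ((ρ.mapHomologicalComplex (.up ℤ)).map s) := inferInstance
    have := (isIso_Q_map_iff_quasiIso _ ((ρ.mapHomologicalComplex (.up ℤ)).map s)).2 this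
    rw [← cancel_mono (inv (Q.map ((ρ.mapHomologicalComplex (.up ℤ)).map s))), zero_comp]
    exact h _
  obtain ⟨E', t, ht, ⟨H⟩⟩ := exists_homotopy_of_Q_map_eq_zero g' hg'
  -- E' is only cohomologically bounded by n; truncating it allows a resolution P in degrees ≤ n,
  -- which is needed for L to preserve the quasi-isomorphism P → E.
  have : E'.IsLE n := by
    have h1 := (isLE_Q_obj_iff E n).2 inferInstance
    rw [← isLE_Q_obj_iff]
    have := (isIso_Q_map_iff_quasiIso _ t).2 ht
    exact TStructure.t.isLE_of_iso (asIso (Q.map t)).symm n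
  have hι : QuasiIso (E'.ιTruncLE n) := inferInstance
  obtain ⟨P, _, hP, p, hp⟩ := CochainComplex.exists_resolution h𝓕 (E'.truncLE n) n
  let r : P ⟶ E := (p ≫ E'.ιTruncLE n) ≫ t
  have : QuasiIso r := inferInstance
  have hr : Homotopy (r ≫ g') 0 :=
    (Homotopy.ofEq (Category.assoc _ _ _)).trans ((H.compLeft (p ≫ E'.ιTruncLE n)).trans
      (Homotopy.ofEq comp_zero))
  have hLr := hL.map_quasiIso r n hP hE
  -- g is recovered from g' by the counit, so the null-homotopy of r ≫ g' yields one of L r ≫ g,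
  -- where L r is a quasi-isomorphism.
  have hg : (L.mapHomologicalComplex (.up ℤ)).map g' ≫ counitComplex adj Y = g := by
    have aux {V : C} {W : C₀} (q : L.obj V ⟶ W) :
        L.map (adj.unit.app V ≫ ρ.map q) ≫ adj.counit.app W = q :=
      (adj.homEquiv V W).symm_apply_apply q
    ext i
    exact aux (V := E.X i) (W := Y.X i) (g.f i)
  have hH : Homotopy ((L.mapHomologicalComplex (.up ℤ)).map r ≫ g) 0 := by
    have h1 := (L.mapHomotopy hr).compRight (counitComplex adj Y)
    refine (Homotopy.ofEq ?_).trans (h1.trans (Homotopy.ofEq ?_))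
    · rw [(L.mapHomologicalComplex (.up ℤ)).map_comp r g', Category.assoc, hg]
    · rw [Functor.map_zero, zero_comp]
  have h2 := Q_map_eq_of_homotopy _ hH
  have := (isIso_Q_map_iff_quasiIso _ _).2 hLr
  rw [Q.map_comp, Q.map_zero, ← comp_zero (f := Q.map ((L.mapHomologicalComplex (.up ℤ)).map r)),
    cancel_epi] at h2
  exact h2

end DerivedAdjunction

/-! ### Dimension shifting along resolutions by summands of powers of P. -/

section DimensionShifting

open DerivedCategory HomologicalComplex

variable {C : Type*} [Category* C] [Abelian C]

/-- `E` is a direct summand of a finite direct sum of copies of `P`. -/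
def IsSummandOfSum {𝒜 : Type*} [Category* 𝒜] [Preadditive 𝒜] (P E : 𝒜) : Prop :=
  ∃ (n : ℕ) (π : Fin n → (E ⟶ P)) (ι : Fin n → (P ⟶ E)), ∑ j, π j ≫ ι j = 𝟙 E

lemma IsSummandOfSum.map {𝒜 ℬ : Type*} [Category* 𝒜] [Preadditive 𝒜] [Category* ℬ] [Preadditive ℬ]
    (F : 𝒜 ⥤ ℬ) [F.Additive] {P E : 𝒜} (h : IsSummandOfSum P E) :
    IsSummandOfSum (F.obj P) (F.obj E) := by
  obtain ⟨n, π, ι, h⟩ := h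
  refine ⟨n, fun j => F.map (π j), fun j => F.map (ι j), ?_⟩
  simp only [← F.map_comp, ← F.map_sum, h, F.map_id]

lemma IsSummandOfSum.isZero {𝒜 : Type*} [Category* 𝒜] [Preadditive 𝒜]
    {P E : 𝒜} (h : IsSummandOfSum P E) (hP : IsZero P) : IsZero E := by
  obtain ⟨n, π, ι, h⟩ := h
  rw [IsZero.iff_id_eq_zero, ← h]
  exact Finset.sum_eq_zero fun j _ => by rw [hP.eq_of_tgt (π j) 0, zero_comp]

/-- A class of complexes each of which is a quotient of a direct summand of a finite direct sum of
copies of `P`, with kernel in the same class. -/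
def IsSyzygyClosed (P : CochainComplex C ℤ) (𝒮 : ObjectProperty (CochainComplex C ℤ)) : Prop :=
  ∀ Z, 𝒮 Z → ∃ (S : ShortComplex (CochainComplex C ℤ)) (_ : S.ShortExact) (_ : 𝒮 S.X₁)
    (_ : IsSummandOfSum P S.X₂), Nonempty (S.X₃ ≅ Z)

namespace IsSyzygyClosed

variable {P : CochainComplex C ℤ} {𝒮 : ObjectProperty (CochainComplex C ℤ)}
  (h𝒮 : IsSyzygyClosed P 𝒮)

include h𝒮

/-- Z is degreewise a quotient of a summand of a power of P. This gives all syzygies the same bound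
n, without which the dimension shifting would not terminate. -/
lemma isStrictlyLE (n : ℤ) [P.IsStrictlyLE n] (Z : CochainComplex C ℤ) (hZ : 𝒮 Z) : Z.IsStrictlyLE n := by
  obtain ⟨S, h, -, hE, ⟨e⟩⟩ := h𝒮 Z hZ
  rw [CochainComplex.isStrictlyLE_iff]
  intro i hi
  have : Epi S.g := h.epi_g
  refine IsZero.of_epi (S.g.f i ≫ e.hom.f i) ?_
  exact (hE.map (HomologicalComplex.eval C _ i)).isZero (P.isZero_of_isStrictlyLE n i hi)

/-- For 0 → Z' → E → Z → 0 with E a summand of a power of P, Hom(X, E[p]) = 0, so Hom(X, Z[p])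
embeds into Hom(X, Z'[p+1]). After finitely many steps the degree exceeds d, where every complex in
degrees ≤ n has no Hom. -/
lemma homVanishes [HasDerivedCategory C] {n : ℤ} [P.IsStrictlyLE n] {X : DerivedCategory C} (d : ℤ)
    (hd : ∀ Z : CochainComplex C ℤ, Z.IsStrictlyLE n → ∀ p, d < p → HomVanishes X (Q.obj Z) p)
    (hP : ∀ p, HomVanishes X (Q.obj P) p) (Z : CochainComplex C ℤ) (hZ : 𝒮 Z) (p : ℤ) :
    HomVanishes X (Q.obj Z) p := by
  suffices ∀ (k : ℕ) (p : ℤ) (Z : CochainComplex C ℤ), 𝒮 Z → d < p + k →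
      HomVanishes X (Q.obj Z) p from this (d + 1 - p).toNat p Z hZ (by lia)
  intro k
  induction k with
  | zero => exact fun p Z hZ hp => hd Z (h𝒮.isStrictlyLE n Z hZ) p (by simpa using hp)
  | succ k hk =>
    intro p Z hZ hp
    obtain ⟨S, h, hZ', hE, ⟨e⟩⟩ := h𝒮 Z hZ
    obtain ⟨m, π, ι, hE⟩ := hE.map Q
    exact (HomVanishes.obj₃ (triangleOfSES_distinguished h) rfl (HomVanishes.of_sum π ι hE (hP p))
      (hk (p + 1) S.X₁ hZ' (by push_cast at hp; lia))).of_iso (Q.mapIso e)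

/-- H^p(Z) lies between H^p(E) and H^{p+1}(Z') in an exact sequence. The induction starts in degrees
above n, where the cohomology of every syzygy vanishes. -/
lemma homology (n : ℤ) [P.IsStrictlyLE n] (Coh : ObjectProperty C) [Coh.ContainsZero] [Coh.IsClosedUnderIsomorphisms]
    (hCoh : ∀ S : ShortComplex C, S.Exact → Coh S.X₁ → Coh S.X₃ → Coh S.X₂)
    (hSum : ∀ Y Y' : C, IsSummandOfSum Y Y' → Coh Y → Coh Y')
    (hP : ∀ p, Coh (P.homology p)) (Z : CochainComplex C ℤ) (hZ : 𝒮 Z) (p : ℤ) :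
    Coh (Z.homology p) := by
  suffices ∀ (k : ℕ) (p : ℤ) (Z : CochainComplex C ℤ), 𝒮 Z → n < p + k →
      Coh (Z.homology p) from this (n + 1 - p).toNat p Z hZ (by lia)
  intro k
  induction k with
  | zero =>
    intro p Z hZ hp
    have := h𝒮.isStrictlyLE n Z hZ
    exact Coh.prop_of_isZero (Z.isZero_of_isLE n p (by simpa using hp))
  | succ k hk =>
    intro p Z hZ hp
    obtain ⟨S, h, hZ', hE, ⟨e⟩⟩ := h𝒮 Z hZ
    refine Coh.prop_of_iso ((homologyFunctor C _ p).mapIso e) ?_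
    exact hCoh _ (h.homology_exact₃ p (p + 1) (by simp))
      (hSum _ _ (hE.map (homologyFunctor C _ p)) (hP p))
      (hk (p + 1) S.X₁ hZ' (by push_cast at hp; lia))

end IsSyzygyClosed

end DimensionShifting

/-! ### Reduction of generation along a functor satisfying Nakayama's lemma. -/

section Generation

open DerivedCategory HomologicalComplex

variable {C : Type*} [Category* C] [Abelian C] {C₀ : Type*} [Category* C₀] [Abelian C₀]

/-- The complexes whose cohomology is bounded above and satisfies `Coh`. -/
def HasBoundedAboveCohomologyIn [HasDerivedCategory C] (Coh : ObjectProperty C)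
    (M : DerivedCategory C) : Prop :=
  (∃ n : ℤ, ∀ m : ℤ, n < m → IsZero ((DerivedCategory.homologyFunctor C m).obj M)) ∧
    ∀ m : ℤ, Coh ((DerivedCategory.homologyFunctor C m).obj M)

/-- If the bound could be lowered at each step, all cohomology would vanish and M would be zero. -/
lemma exists_minimal_isLE [HasDerivedCategory C] (M : DerivedCategory C) (hM : ¬ IsZero M)
    (h : ∃ n : ℤ, ∀ m : ℤ, n < m → IsZero ((DerivedCategory.homologyFunctor C m).obj M)) :
    ∃ n : ℤ, M.IsLE n ∧ ¬ IsZero ((DerivedCategory.homologyFunctor C n).obj M) := by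
  obtain ⟨n, hn⟩ := h
  by_contra! H
  have hLE (k : ℕ) : M.IsLE (n - k) := by
    induction k with
    | zero => rw [isLE_iff]; simpa using hn
    | succ k hk =>
      have h1 := H _ hk
      rw [isLE_iff] at hk ⊢
      intro i hi
      obtain hi' | rfl := (show n - (k : ℤ) ≤ i by push_cast at hi; lia).lt_or_eq
      · exact hk i hi'
      · exact h1
  refine hM ?_
  have h0 (i : ℤ) : IsZero ((DerivedCategory.homologyFunctor C i).obj M) := by
    have := (isLE_iff _ _).1 (hLE (n - i + 1).toNat)
    exact this i (by lia)
  have : IsIso (0 : M ⟶ M) := by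
    rw [DerivedCategory.isIso_iff]
    exact fun i => (h0 i).isIso (h0 i) _
  rw [IsZero.iff_id_eq_zero]
  exact (cancel_epi (0 : M ⟶ M)).1 (by rw [zero_comp, zero_comp])

/-- In the top degree H^n is the cokernel of P^{n-1} → P^n, which the right exact functor L
preserves; thus H^n(L P) = L(H^n P), and L kills only zero objects. -/
lemma isZero_homology_of_isZero_homology_map {L : C ⥤ C₀} [L.Additive] [PreservesFiniteColimits L]
    (hL : ∀ X, IsZero (L.obj X) → IsZero X) (P : CochainComplex C ℤ) (n : ℤ) [P.IsStrictlyLE n]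
    (h : ((L.mapHomologicalComplex (.up ℤ)).obj P).ExactAt n) : P.ExactAt n := by
  have hX : IsZero (P.X (n + 1)) := P.isZero_of_isStrictlyLE n _ (by lia)
  rw [HomologicalComplex.exactAt_iff' _ (n - 1) n (n + 1) (by simp) (by simp),
    ShortComplex.exact_iff_epi _ ((L.map_isZero hX).eq_of_tgt _ _)] at h
  rw [P.exactAt_iff' (n - 1) n (n + 1) (by simp) (by simp),
    ShortComplex.exact_iff_epi _ (hX.eq_of_tgt _ _)]
  have h' : Epi (L.map (P.d (n - 1) n)) := h
  have := hL _ ((isZero_cokernel_of_epi (L.map (P.d (n - 1) n))).of_iso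
    (PreservesCokernel.iso L (P.d (n - 1) n)))
  exact Preadditive.epi_of_isZero_cokernel (P.d (n - 1) n) this

end Generation

section Reduction

open DerivedCategory HomologicalComplex

variable {C : Type*} [Category* C] [Abelian C] [HasDerivedCategory C]
  {C₀ : Type*} [Category* C₀] [Abelian C₀] [HasDerivedCategory C₀]
  {L : C ⥤ C₀} {ρ : C₀ ⥤ C} [L.Additive] [ρ.Additive] (adj : L ⊣ ρ)

/-- All morphisms from `F` to shifts of the objects with bounded above cohomology in `Coh` detect
the nonzero objects. -/
def GeneratesBoundedAbove (Coh : ObjectProperty C) (F : C) : Prop :=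
  ∀ M : DerivedCategory C, HasBoundedAboveCohomologyIn Coh M → ¬ IsZero M →
    ∃ p : ℤ, ¬ HomVanishes ((singleFunctor C 0).obj F) M p

omit [HasDerivedCategory C] [HasDerivedCategory C₀] in
lemma isStrictlyLE_mapHomologicalComplex (P : CochainComplex C ℤ) (n : ℤ)
    [P.IsStrictlyLE n] :
    CochainComplex.IsStrictlyLE ((L.mapHomologicalComplex (.up ℤ)).obj P) n := by
  rw [CochainComplex.isStrictlyLE_iff]
  exact fun i hi => L.map_isZero (P.isZero_of_isStrictlyLE n i hi)

include adj in
/-- Generation of `D^-` by `F` follows from generation by `L F`, for a functor `L` with Nakayama's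
lemma and an exact right adjoint `ρ`, if the complexes `ρ L P` have resolutions by sums of `P`. -/
theorem generatesBoundedAbove_of_map [PreservesFiniteLimits ρ] [PreservesFiniteColimits ρ]
    [PreservesFiniteColimits L]
    {𝓕 : ObjectProperty C} [𝓕.IsClosedUnderIsomorphisms] [𝓕.ContainsZero]
    [𝓕.IsClosedUnderExtensions] (h𝓕 : ∀ X : C, ∃ (P : C) (_ : 𝓕 P) (p : P ⟶ X), Epi p)
    (hL : L.ExactOn 𝓕) (hNak : ∀ X, IsZero (L.obj X) → IsZero X)
    {Coh : ObjectProperty C} {Coh₀ : ObjectProperty C₀} [Coh.ContainsZero]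
    [Coh.IsClosedUnderIsomorphisms]
    (hCoh : ∀ S : ShortComplex C, S.Exact → Coh S.X₁ → Coh S.X₃ → Coh S.X₂)
    (hSum : ∀ Y Y' : C, IsSummandOfSum Y Y' → Coh Y → Coh Y')
    (hρ : ∀ Y, Coh (ρ.obj Y) → Coh₀ Y) [Coh₀.IsClosedUnderIsomorphisms]
    (hSyz : ∀ P : CochainComplex C ℤ, (∀ i, 𝓕 (P.X i)) → ∃ 𝒮, IsSyzygyClosed P 𝒮 ∧
      𝒮 ((ρ.mapHomologicalComplex (.up ℤ)).obj ((L.mapHomologicalComplex (.up ℤ)).obj P)))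
    (F : C) (hF : 𝓕 F)
    (hdim : ∀ n : ℤ, ∃ d : ℤ, ∀ Z : CochainComplex C ℤ, Z.IsStrictlyLE n → ∀ p, d < p →
      HomVanishes ((singleFunctor C 0).obj F) (Q.obj Z) p)
    (h0 : GeneratesBoundedAbove Coh₀ (L.obj F)) : GeneratesBoundedAbove Coh F := by
  intro M hM hM0
  by_contra! hvan
  obtain ⟨n, hMn, hMn0⟩ := exists_minimal_isLE M hM0 hM.1
  obtain ⟨K, hK, ⟨e⟩⟩ := exists_iso_Q_obj_of_isLE M n
  obtain ⟨P, _, hP, φ, hφ⟩ := CochainComplex.exists_resolution h𝓕 K n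
  have hφ' := (isIso_Q_map_iff_quasiIso _ φ).2 hφ
  let eM : Q.obj P ≅ M := asIso (Q.map φ) ≪≫ e.symm
  let eH (m : ℤ) : (DerivedCategory.homologyFunctor C m).obj M ≅ P.homology m :=
    (DerivedCategory.homologyFunctor C m).mapIso eM.symm ≪≫ (homologyFunctorFactors C m).app P
  let LP : CochainComplex C₀ ℤ := (L.mapHomologicalComplex (.up ℤ)).obj P
  let ρLP : CochainComplex C ℤ := (ρ.mapHomologicalComplex (.up ℤ)).obj LP
  have hLP : LP.IsStrictlyLE n := isStrictlyLE_mapHomologicalComplex P n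
  obtain ⟨𝒮, h𝒮, h𝒮P⟩ := hSyz P hP
  -- The bound d depends only on n, so it serves every syzygy of ρ L P.
  have hvan' (p : ℤ) : HomVanishes ((singleFunctor C 0).obj F) (Q.obj ρLP) p := by
    obtain ⟨d, hd⟩ := hdim n
    exact h𝒮.homVanishes d hd (fun p => (hvan p).of_iso eM.symm) ρLP h𝒮P p
  have hcoh (p : ℤ) : Coh (ρLP.homology p) :=
    h𝒮.homology n Coh hCoh hSum (fun p => Coh.prop_of_iso (eH p) (hM.2 p)) ρLP h𝒮P p
  have hLP0 : ¬ IsZero (Q.obj LP) := fun h => hMn0 (by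
    have h1 : LP.ExactAt n := by
      rw [exactAt_iff_isZero_homology]
      exact ((DerivedCategory.homologyFunctor C₀ n).map_isZero h).of_iso
        ((homologyFunctorFactors C₀ n).app LP).symm
    have h2 := isZero_homology_of_isZero_homology_map hNak P n h1
    rw [exactAt_iff_isZero_homology] at h2
    exact h2.of_iso (eH n))
  -- Since ρ is exact, ρ H^m(L P) = H^m(ρ L P) satisfies `Coh`, and `hρ` carries this back to H^m(L
  -- P).
  obtain ⟨p, hp⟩ := h0 (Q.obj LP) ⟨⟨n, fun m hm => isZero_of_isLE _ n m hm⟩, fun m =>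
      Coh₀.prop_of_iso ((homologyFunctorFactors C₀ m).app LP).symm
        (hρ _ (Coh.prop_of_iso ((LP.sc m).mapHomologyIso ρ) (hcoh m)))⟩ hLP0
  refine hp fun f => ?_
  let E : CochainComplex C ℤ := (HomologicalComplex.single C (.up ℤ) 0).obj F
  have hE : E.IsStrictlyLE 0 := inferInstanceAs
    (CochainComplex.IsStrictlyLE ((HomologicalComplex.single C (.up ℤ) 0).obj F) 0)
  have hE𝓕 (i : ℤ) : 𝓕 (E.X i) := by
    by_cases hi : i = 0
    · subst hi
      exact 𝓕.prop_of_iso (singleObjXSelf (.up ℤ) 0 F).symm hF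
    · exact 𝓕.prop_of_isZero (isZero_single_obj_X (.up ℤ) 0 F i hi)
  -- The derived adjunction with target L P[p]; L and ρ are moved past the shift and the single
  -- complex by the isomorphisms `e1`, `e2` and `e3`.
  have key := eq_zero_of_homVanishes_restriction adj h𝓕 hL E 0 hE𝓕 (LP⟦p⟧) (fun ψ => by
      let e1 : Q.obj ((ρ.mapHomologicalComplex (.up ℤ)).obj (LP⟦p⟧)) ≅ (Q.obj ρLP)⟦p⟧ :=
        Q.mapIso (((ρ.mapHomologicalComplex (.up ℤ)).commShiftIso p).app LP) ≪≫
          ((Q (C := C)).commShiftIso p).app ρLP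
      rw [← cancel_mono e1.hom, zero_comp]
      exact hvan' p (ψ ≫ e1.hom))
  let e2 : Q.obj ((L.mapHomologicalComplex (.up ℤ)).obj E) ≅
    (singleFunctor C₀ 0).obj (L.obj F) :=
      Q.mapIso ((singleMapHomologicalComplex L (.up ℤ) 0).app F)
  let e3 : Q.obj (LP⟦p⟧) ≅ (Q.obj LP)⟦p⟧ := ((Q (C := C₀)).commShiftIso p).app LP
  rw [← cancel_epi e2.hom, ← cancel_mono e3.inv, comp_zero, zero_comp]
  exact key _

end Reduction

/-! ### Tensor products of right modules: additive maps, surjective ring maps and base change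
squares. -/

namespace RightTensor

section

variable {S T : Type u} [Ring S] [Ring T] (f : S →+* T) {M : Type u} [AddCommGroup M]
  [Module Sᵐᵒᵖ M]

lemma zero_tmul (t : T) : tmul f (0 : M) t = 0 := by
  simp only [tmul, TensorProduct.tmul_zero, map_zero]

lemma tmul_zero (m : M) : tmul f m (0 : T) = 0 := by
  simp only [tmul, TensorProduct.zero_tmul, map_zero]

lemma tmul_sum {J : Type*} (s : Finset J) (m : M) (t : J → T) :
    tmul f m (∑ j ∈ s, t j) = ∑ j ∈ s, tmul f m (t j) :=
  map_sum (AddMonoidHom.mk' (fun t => tmul f m t) (tmul_add_right f m)) t s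

lemma sum_tmul {J : Type*} (s : Finset J) (m : J → M) (t : T) :
    tmul f (∑ j ∈ s, m j) t = ∑ j ∈ s, tmul f (m j) t :=
  map_sum (AddMonoidHom.mk' (fun m : M => tmul f m t) (fun m m' => tmul_add_left f m m' t)) m s

variable {f} in
lemma addHom_ext {P : Type*} [AddCommGroup P] {g g' : RightTensor f M →+ P}
    (h : ∀ m t, g (tmul f m t) = g' (tmul f m t)) : g = g' := by
  ext x
  induction x using RightTensor.induction with
  | zero => rw [map_zero, map_zero]
  | add x y hx hy => rw [map_add, map_add, hx, hy]
  | tmul m t => exact h m t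

/-- The additive map out of `M ⊗_S T` attached to a balanced biadditive map. -/
noncomputable def liftAdd {P : Type*} [AddCommGroup P] (g : T →+ M →+ P)
    (hg : ∀ s t m, g t (op s • m) = g (f s * t) m) : RightTensor f M →+ P :=
  QuotientAddGroup.lift (rightTensorRel f M).toAddSubgroup
    (TensorProduct.liftAddHom g (fun r t m => by
      rw [map_zsmul, map_zsmul, AddMonoidHom.smul_apply])) (by
    intro x hx
    -- The relations form a right T-submodule while P is only a group, so the induction must prove
    -- vanishing on all right multiples of x.
    suffices ∀ t : T, TensorProduct.liftAddHom g (fun r t m => by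
        rw [map_zsmul, map_zsmul, AddMonoidHom.smul_apply]) (op t • x) = 0 by
      simpa using this 1
    induction hx using Submodule.span_induction with
    | mem x hx =>
      obtain ⟨s, t, m, rfl⟩ := hx
      intro t'
      rw [smul_sub, TensorProduct.smul_tmul', TensorProduct.smul_tmul', op_smul_eq_mul,
        op_smul_eq_mul, map_sub, TensorProduct.liftAddHom_tmul, TensorProduct.liftAddHom_tmul, hg,
        mul_assoc, sub_self]
    | zero => intro t; rw [smul_zero, map_zero]
    | add x y _ _ hx hy => intro t; rw [smul_add, map_add, hx, hy, add_zero]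
    | smul a x _ hx =>
      intro t
      rw [← mul_smul]
      exact hx (unop (op t * a)))

lemma liftAdd_tmul {P : Type*} [AddCommGroup P] (g : T →+ M →+ P)
    (hg : ∀ s t m, g t (op s • m) = g (f s * t) m) (m : M) (t : T) :
    liftAdd f g hg (tmul f m t) = g t m := rfl

lemma exists_tmul_one_of_surjective (hf : Function.Surjective f) (x : RightTensor f M) :
    ∃ m : M, tmul f m 1 = x := by
  induction x using RightTensor.induction with
  | zero => exact ⟨0, zero_tmul f 1⟩
  | add x y hx hy =>
    obtain ⟨m, rfl⟩ := hx
    obtain ⟨m', rfl⟩ := hy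
    exact ⟨m + m', tmul_add_left f m m' 1⟩
  | tmul m t =>
    obtain ⟨s, rfl⟩ := hf t
    exact ⟨op s • m, by rw [tmul_balanced, mul_one]⟩

/-- The kernel of `M → M ⊗_S T`, `m ↦ m ⊗ 1`, for a surjective homomorphism `S → T`. -/
lemma mem_of_tmul_one_eq_zero (hf : Function.Surjective f) (N : AddSubgroup M)
    (hN : ∀ (s : S) (m : M), f s = 0 → op s • m ∈ N)
    (m : M) (hm : tmul f m 1 = 0) : m ∈ N := by
  -- A set-theoretic section suffices: m ⊗ t ↦ m σ(t) is well defined and balanced modulo N because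
  -- the kernel of f sends M into N. Evaluating it at m ⊗ 1 recovers the class of m.
  let σ := Function.surjInv hf
  have hσ (t : T) : f (σ t) = t := Function.surjInv_eq hf t
  have key (s s' : S) (h : f s = f s') (m : M) :
      (QuotientAddGroup.mk (op s • m) : M ⧸ N) = QuotientAddGroup.mk (op s' • m) := by
    rw [QuotientAddGroup.eq, neg_add_eq_sub, ← sub_smul, ← MulOpposite.op_sub]
    exact hN _ _ (by rw [map_sub, h, sub_self])
  let g : T →+ M →+ M ⧸ N := AddMonoidHom.mk'
    (fun t => AddMonoidHom.mk' (fun m => QuotientAddGroup.mk (op (σ t) • m))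
      (fun m m' => by rw [smul_add, QuotientAddGroup.mk_add]))
    (fun t t' => by
      ext m
      refine (key _ (σ t + σ t') (by rw [map_add, hσ, hσ, hσ]) m).trans ?_
      rw [MulOpposite.op_add, add_smul, QuotientAddGroup.mk_add]
      rfl)
  have hg : ∀ s t m, g t (op s • m) = g (f s * t) m := by
    intro s t m
    change (QuotientAddGroup.mk (op (σ t) • op s • m) : M ⧸ N) =
      QuotientAddGroup.mk (op (σ (f s * t)) • m)
    rw [← mul_smul, ← op_mul]
    exact key _ _ (by rw [map_mul, hσ, hσ]) m
  have h := congrArg (liftAdd f g hg) hm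
  rw [liftAdd_tmul, map_zero] at h
  have h' : (QuotientAddGroup.mk (op (σ 1) • m) : M ⧸ N) = 0 := h
  rw [key (σ 1) 1 (by rw [hσ, map_one]), op_one, one_smul] at h'
  exact (QuotientAddGroup.eq_zero_iff m).1 h'

end

section

variable {S T S' T' : Type u} [Ring S] [Ring T] [Ring S'] [Ring T']
  (f : S →+* T) (f' : S' →+* T') (a : S →+* S') (b : T →+* T')

/-- `S'` as a right `S`-module along `a : S → S'`. -/
noncomputable abbrev restrictedRing : ModuleCat.{u} Sᵐᵒᵖ := (restrictRight a).obj (ModuleCat.of S'ᵐᵒᵖ S')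

/-- The map `S' ⊗_S T → T'`, `s ⊗ t ↦ f'(s) b(t)`. -/
noncomputable def squareMap (comm : ∀ s, b (f s) = f' (a s)) :
    RightTensor f (restrictedRing a) →+ T' :=
  liftAdd f (M := restrictedRing a)
    (AddMonoidHom.mk' (fun t => AddMonoidHom.mk' (fun s : restrictedRing a => f' s * b t)
      (fun s s' => by
        change f' ((show S' from s) + (show S' from s')) * b t = _
        rw [map_add, add_mul]))
      (fun t t' => by
        ext s
        change f' s * b (t + t') = f' s * b t + f' s * b t'
        rw [map_add, mul_add]))
    (fun s t m => by
      change f' ((show S' from m) * a s) * b t = f' m * b (f s * t)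
      rw [map_mul, map_mul, comm, mul_assoc])

lemma squareMap_tmul (comm : ∀ s, b (f s) = f' (a s)) (s : S') (t : T) :
    squareMap f f' a b comm (tmul f (M := restrictedRing a) s t) = f' s * b t := rfl

variable {f f' a b}

/-- If `S' ⊗_S T = T'`, then `W ⊗_S T = W ⊗_{S'} T'` for all right `S'`-modules `W`. -/
lemma bijective_of_squareMap {comm : ∀ s, b (f s) = f' (a s)}
    (h : Function.Bijective (squareMap f f' a b comm)) (W : ModuleCat.{u} S'ᵐᵒᵖ)
    (q : RightTensor f ((restrictRight a).obj W) →+ RightTensor f' W)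
    (hq : ∀ (w : W) (t : T), q (tmul f (M := (restrictRight a).obj W) w t) = tmul f' w (b t)) :
    Function.Bijective q := by
  let e := AddEquiv.ofBijective _ h
  have he (s : S') (t : T) : e.symm (f' s * b t) = tmul f (M := restrictedRing a) s t :=
    e.symm_apply_apply (tmul f (M := restrictedRing a) s t)
  -- The inverse sends w ⊗ t' to (μ_w ⊗ id)(e⁻¹ t') with μ_w(s) = w s. It is balanced over S'
  -- because e⁻¹ commutes with left multiplication by S', which is `hl'`.
  let μ (w : W) : restrictedRing a →ₗ[Sᵐᵒᵖ] ((restrictRight a).obj W) :=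
    { toFun := fun s : S' => op s • w
      map_add' := fun s s' => add_smul (op (show S' from s)) (op (show S' from s')) w
      map_smul' := fun s s' => mul_smul (op (a s.unop)) (op (show S' from s')) w }
  let l (s : S') : restrictedRing a →ₗ[Sᵐᵒᵖ] restrictedRing a :=
    { toFun := fun s' : S' => s * s'
      map_add' := fun s' s'' => mul_add s s' s''
      map_smul' := fun r s' => (mul_assoc s s' (a r.unop)).symm }
  have hl (s : S') (x : RightTensor f (restrictedRing a)) :
      squareMap f f' a b comm (map f (l s) x) = f' s * squareMap f f' a b comm x := by
    induction x using RightTensor.induction with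
    | zero => simp only [map_zero, mul_zero]
    | add x y hx hy => simp only [map_add, hx, hy, mul_add]
    | tmul s' t =>
      rw [map_tmul]
      refine (congrArg (· * b t) (map_mul f' s (show S' from s'))).trans ?_
      exact mul_assoc _ _ _
  have hl' (s : S') (t : T') : e.symm (f' s * t) = map f (l s) (e.symm t) := by
    apply e.injective
    rw [e.apply_symm_apply]
    refine (Eq.trans (hl s (e.symm t)) ?_).symm
    exact congrArg (f' s * ·) (e.apply_symm_apply t)
  let r : RightTensor f' W →+ RightTensor f ((restrictRight a).obj W) :=
    liftAdd f' (AddMonoidHom.mk' (fun t => AddMonoidHom.mk' (fun w => map f (μ w) (e.symm t))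
      (fun w w' => by
        induction e.symm t using RightTensor.induction with
        | zero => simp only [map_zero, add_zero]
        | add x y hx hy => rw [map_add, map_add, map_add, hx, hy]; abel
        | tmul s t =>
          rw [map_tmul, map_tmul, map_tmul, ← tmul_add_left]
          exact congrArg (tmul f · t) (smul_add (op (show S' from s)) w w')))
      (fun t t' => by ext w; change map f (μ w) _ = _; rw [map_add, map_add]; rfl))
      (fun s t w => by
        change map f (μ (op s • w)) (e.symm t) = map f (μ w) (e.symm (f' s * t))
        rw [hl']
        induction e.symm t using RightTensor.induction with
        | zero => simp only [map_zero]
        | add x y hx hy => simp only [map_add, hx, hy]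
        | tmul s' t =>
          rw [map_tmul, map_tmul, map_tmul]
          exact congrArg (tmul f · t) (mul_smul (op (show S' from s')) (op s) w).symm)
  have hr (w : W) (t : T') : r (tmul f' w t) = map f (μ w) (e.symm t) := rfl
  have h1 : r.comp q = AddMonoidHom.id _ := addHom_ext fun w t => by
    change r (q (tmul f (M := (restrictRight a).obj W) w t)) = _
    refine (congrArg r (hq w t)).trans ((hr w (b t)).trans ?_)
    rw [← one_mul (b t), ← map_one f', he]
    refine (map_tmul f (μ w) (1 : S') t).trans ?_
    exact congrArg (tmul f (M := (restrictRight a).obj W) · t) (one_smul S'ᵐᵒᵖ w)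
  have h2 : q.comp r = AddMonoidHom.id _ := addHom_ext fun w t => by
    change q (r (tmul f' w t)) = tmul f' w t
    rw [hr]
    obtain ⟨x, rfl⟩ := e.surjective t
    rw [e.symm_apply_apply]
    induction x using RightTensor.induction with
    | zero => simp only [map_zero]; exact (tmul_zero f' w).symm
    | add x y hx hy => simp only [map_add, hx, hy, tmul_add_right]
    | tmul s t =>
      rw [map_tmul]
      refine (hq _ _).trans ((tmul_balanced f' w s (b t)).trans ?_)
      rfl
  exact ⟨fun x y hxy => (DFunLike.congr_fun h1 x).symm.trans
    ((congrArg r hxy).trans (DFunLike.congr_fun h1 y)), fun x => ⟨r x, DFunLike.congr_fun h2 x⟩⟩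

end

end RightTensor

/-! ### Flatness by systems of linear equations. -/

section MatrixFlat

variable {K : Type*} [CommRing K]

/-- The rows of `D'` span the relations between the rows of `D`. -/
def Matrix.IsSyzygy {l m n : ℕ} (D' : Matrix (Fin l) (Fin m) K) (D : Matrix (Fin m) (Fin n) K) :
    Prop :=
  D' * D = 0 ∧ ∀ a : Fin m → K, Matrix.vecMul a D = 0 → ∃ c, Matrix.vecMul c D' = a

/-- The relations between the rows of D form a submodule of K^m, finitely generated as K is
Noetherian; generators are the rows of D'. -/
lemma Matrix.exists_isSyzygy [IsNoetherianRing K] {m n : ℕ} (D : Matrix (Fin m) (Fin n) K) :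
    ∃ (l : ℕ) (D' : Matrix (Fin l) (Fin m) K), D'.IsSyzygy D := by
  obtain ⟨l, s, hs⟩ := Submodule.fg_iff_exists_fin_generating_family.1
    (IsNoetherian.noetherian (LinearMap.ker D.vecMulLinear))
  have hs' (i : Fin l) : Matrix.vecMul (s i) D = 0 :=
    LinearMap.mem_ker.1 (hs.le (Submodule.subset_span ⟨i, rfl⟩))
  refine ⟨l, Matrix.of s, ?_, fun a ha => ?_⟩
  · ext i j
    exact congrFun (hs' i) j
  · have : a ∈ Submodule.span K (Set.range s) := hs.ge (LinearMap.mem_ker.2 ha)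
    obtain ⟨c, rfl⟩ := (Submodule.mem_span_range_iff_exists_fun K).1 this
    exact ⟨c, by rw [Matrix.vecMul_eq_sum]; rfl⟩

variable {B : Type*} [Ring B] (θ : K →+* B)

/-- A module `W` over a `K`-algebra is flat over `K`, in terms of systems of linear equations. -/
def IsMatrixFlat (W : Type*) [AddCommGroup W] [Module B W] : Prop :=
  ∀ ⦃l m n : ℕ⦄ (D' : Matrix (Fin l) (Fin m) K) (D : Matrix (Fin m) (Fin n) K), D'.IsSyzygy D →
    ∀ x : Fin m → W, (∀ j, ∑ i, θ (D i j) • x i = 0) →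
      ∃ y : Fin l → W, ∀ i, x i = ∑ k, θ (D' k i) • y k

variable {θ}
variable {W W' W'' : Type*} [AddCommGroup W] [Module B W] [AddCommGroup W'] [Module B W']
  [AddCommGroup W''] [Module B W'']

lemma sum_smul_sum_smul {l m : ℕ} (D' : Matrix (Fin l) (Fin m) K) (d : Fin m → K) (y : Fin l → W) :
    ∑ i, θ (d i) • ∑ k, θ (D' k i) • y k = ∑ k, θ (∑ i, D' k i * d i) • y k := by
  simp only [Finset.smul_sum, ← mul_smul, ← map_mul]
  rw [Finset.sum_comm]
  refine Finset.sum_congr rfl fun k _ => ?_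
  rw [map_sum, Finset.sum_smul]
  exact Finset.sum_congr rfl fun i _ => by rw [mul_comm]

lemma Matrix.IsSyzygy.sum_smul_sum_smul {l m n : ℕ} {D' : Matrix (Fin l) (Fin m) K}
    {D : Matrix (Fin m) (Fin n) K} (h : D'.IsSyzygy D) (y : Fin l → W) (j : Fin n) :
    ∑ i, θ (D i j) • ∑ k, θ (D' k i) • y k = 0 := by
  rw [_root_.sum_smul_sum_smul D' (fun i => D i j) y]
  refine Finset.sum_eq_zero fun k _ => ?_
  have : ∑ i, D' k i * D i j = 0 := congrFun (congrFun h.1 k) j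
  rw [this, map_zero, zero_smul]

lemma IsMatrixFlat.of_linearEquiv (e : W ≃ₗ[B] W') (h : IsMatrixFlat θ W) : IsMatrixFlat θ W' := by
  intro l m n D' D hD x hx
  obtain ⟨y, hy⟩ := h D' D hD (fun i => e.symm (x i)) (fun j => by
    simp only [← map_smul, ← map_sum, hx, map_zero])
  refine ⟨fun k => e (y k), fun i => ?_⟩
  simp only [← map_smul, ← map_sum, ← hy, e.apply_symm_apply]

lemma IsMatrixFlat.of_subsingleton [Subsingleton W] : IsMatrixFlat θ W :=
  fun _ _ _ _ _ _ _ _ => ⟨0, fun _ => Subsingleton.elim _ _⟩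

section

variable (f : W' →ₗ[B] W) (g : W →ₗ[B] W'') (hf : Function.Injective f)
  (hg : Function.Surjective g) (hfg : Function.Exact f g)

include hf hg hfg

/-- Solve the system in W'', lift the solution to W, and solve for the error in W'. The error still
satisfies the equations because D' D = 0. -/
lemma IsMatrixFlat.of_exact (h' : IsMatrixFlat θ W') (h'' : IsMatrixFlat θ W'') :
    IsMatrixFlat θ W := by
  intro l m n D' D hD x hx
  obtain ⟨y'', hy''⟩ := h'' D' D hD (fun i => g (x i)) (fun j => by
    simp only [← map_smul, ← map_sum, hx, map_zero])
  choose y hy using fun k => hg (y'' k)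
  have h1 (i : Fin m) : ∃ z, f z = x i - ∑ k, θ (D' k i) • y k := (hfg _).1 (by
    simp only [map_sub, map_sum, map_smul, hy, hy'', sub_self])
  choose z hz using h1
  obtain ⟨t, ht⟩ := h' D' D hD z (fun j => hf (by
    simp only [map_sum, map_smul, map_zero, hz, smul_sub, Finset.sum_sub_distrib, hx,
      hD.sum_smul_sum_smul, sub_self]))
  refine ⟨fun k => f (t k) + y k, fun i => ?_⟩
  simp only [smul_add, Finset.sum_add_distrib, ← map_smul, ← map_sum, ← ht, hz, sub_add_cancel]

variable [IsNoetherianRing K]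

/-- The form of Tor₁(W'', -) = 0 used here: a system over W' that is solvable in W is solvable in
W'. The image of x in W'' solves the homogeneous system, so it comes from the syzygies; subtracting
a lift moves x into W' without changing the right-hand side. For the column of generators of an
ideal J this reads W' ∩ J W = J W'. -/
lemma IsMatrixFlat.exists_lift (h'' : IsMatrixFlat θ W'') {m n : ℕ} (D : Matrix (Fin m) (Fin n) K)
    (x : Fin m → W) (x' : Fin n → W') (hx : ∀ j, f (x' j) = ∑ i, θ (D i j) • x i) :
    ∃ y : Fin m → W', ∀ j, x' j = ∑ i, θ (D i j) • y i := by
  obtain ⟨l, D', hD⟩ := D.exists_isSyzygy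
  obtain ⟨z'', hz''⟩ := h'' D' D hD (fun i => g (x i)) (fun j => by
    simp only [← map_smul, ← map_sum, ← hx]
    exact (hfg _).2 ⟨_, rfl⟩)
  choose z hz using fun k => hg (z'' k)
  have h1 (i : Fin m) : ∃ y, f y = x i - ∑ k, θ (D' k i) • z k := (hfg _).1 (by
    simp only [map_sub, map_sum, map_smul, hz, hz'', sub_self])
  choose y hy using h1
  refine ⟨y, fun j => hf ?_⟩
  simp only [map_sum, map_smul, hy, smul_sub, Finset.sum_sub_distrib, hD.sum_smul_sum_smul, hx,
    sub_zero]

/-- Solve in W using flatness of W, then bring the solution into W' by `exists_lift` applied to D'.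
-/
lemma IsMatrixFlat.ker (h : IsMatrixFlat θ W) (h'' : IsMatrixFlat θ W'') : IsMatrixFlat θ W' := by
  intro l m n D' D hD x hx
  obtain ⟨y, hy⟩ := h D' D hD (fun i => f (x i)) (fun j => by
    simp only [← map_smul, ← map_sum, hx, map_zero])
  exact h''.exists_lift f g hf hg hfg D' y x hy

end

/-- The equational criterion: the map X : K^m → W given by x kills the image of D, so it factors
through a finite free module by a map that already kills it. The coordinates of that map are
relations between the rows of D, hence combinations of the rows of D'. -/
lemma IsMatrixFlat.of_flat (W : Type*) [AddCommGroup W] [Module B W] [Module K W]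
    (hθ : ∀ (c : K) (x : W), θ c • x = c • x) [Module.Flat K W] : IsMatrixFlat θ W := by
  intro l m n D' D hD x hx
  simp only [hθ] at hx ⊢
  let X : (Fin m → K) →ₗ[K] W := Fintype.linearCombination K x
  let φ : (Fin n → K) →ₗ[K] (Fin m → K) := D.mulVecLin
  have hX : X ∘ₗ φ = 0 := by
    refine (Pi.basisFun K (Fin n)).ext fun j => ?_
    simpa [X, φ, Fintype.linearCombination_apply] using hx j
  obtain ⟨k, a, y, hya, haf⟩ := Module.Flat.exists_factorization_of_comp_eq_zero_of_free hX
  have h1 (p : Fin k) : ∃ c, Matrix.vecMul c D' = fun i => a (Pi.single i 1) p := by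
    refine hD.2 _ ?_
    ext j
    have h2 := DFunLike.congr_fun (LinearMap.congr_fun haf (Pi.single j 1)) p
    have h3 : φ (Pi.single j 1) = ∑ i, D i j • (Pi.single i (1 : K) : Fin m → K) := by
      ext i
      simp [φ, Finset.sum_apply, Pi.single_apply]
    rw [LinearMap.comp_apply, h3, map_sum, Finsupp.finsetSum_apply] at h2
    simp only [map_smul, Finsupp.smul_apply, smul_eq_mul, LinearMap.zero_apply,
      Finsupp.zero_apply] at h2
    rw [Pi.zero_apply, ← h2]
    change ∑ i, a (Pi.single i 1) p * D i j = _
    refine Finset.sum_congr rfl fun i _ => ?_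
    exact mul_comm (a (Pi.single i 1) p) (D i j)
  choose c hc using h1
  refine ⟨fun q => ∑ p, c p q • y (Finsupp.single p 1), fun i => ?_⟩
  have h4 : x i = X (Pi.single i 1) := by simp [X, Fintype.linearCombination_apply]
  have h5 (z : Fin k →₀ K) : y z = ∑ p, z p • y (Finsupp.single p 1) := by
    conv_lhs => rw [← Finsupp.univ_sum_single z, map_sum]
    refine Finset.sum_congr rfl fun p _ => ?_
    rw [← map_smul, Finsupp.smul_single, smul_eq_mul, mul_one]
  rw [h4, hya, LinearMap.comp_apply, h5]
  simp only [Finset.smul_sum, ← mul_smul]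
  rw [Finset.sum_comm]
  refine Finset.sum_congr rfl fun p _ => ?_
  rw [← Finset.sum_smul, ← congrFun (hc p) i]
  congr 1
  change ∑ q, c p q * D' q i = _
  exact Finset.sum_congr rfl fun q _ => mul_comm (c p q) (D' q i)

end MatrixFlat

/-! ### Nakayama's lemma for a nilpotent ideal of scalars. -/

section Nilpotent

variable {K : Type*} [CommRing K] {B : Type*} [Ring B] {θ : K →+* B} {b : ℕ} {r : Fin b → K}

/-- With J the nilpotent ideal generated by the r_j, the hypothesis says W = J W, so W = J^N W = 0.
No finiteness of W is needed. -/
lemma mem_range_sum_smul (hr : IsNilpotent (Ideal.span (Set.range r))) (W : Type*)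
    [AddCommGroup W] [Module B W]
    (h : ∀ x : W, ∃ y : Fin b → W, x = ∑ j, θ (r j) • y j) : Subsingleton W := by
  let _ : Module K W := Module.compHom W θ
  have h1 : Ideal.span (Set.range r) • (⊤ : Submodule K W) = ⊤ := by
    rw [eq_top_iff]
    rintro x -
    obtain ⟨y, rfl⟩ := h x
    refine Submodule.sum_mem _ fun j _ => ?_
    exact Submodule.smul_mem_smul (M := W) (Ideal.subset_span ⟨j, rfl⟩) (Submodule.mem_top)
  obtain ⟨N, hN⟩ := hr
  have h2 (n : ℕ) : Ideal.span (Set.range r) ^ n • (⊤ : Submodule K W) = ⊤ := by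
    induction n with
    | zero => rw [pow_zero, Ideal.one_eq_top, Submodule.top_smul]
    | succ n hn => rw [pow_succ, Submodule.mul_smul, h1, hn]
  have h3 : (⊤ : Submodule K W) = ⊥ := by
    rw [← h2 N, hN, Submodule.zero_eq_bot, Submodule.bot_smul]
  exact (Submodule.subsingleton_iff K).1 (subsingleton_of_bot_eq_top h3.symm)

/-- Nakayama applied to the cokernel of f. -/
lemma surjective_of_nilpotent (hr : IsNilpotent (Ideal.span (Set.range r)))
    {W W' : Type*} [AddCommGroup W] [Module B W] [AddCommGroup W']
    [Module B W'] (f : W →ₗ[B] W')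
    (h : ∀ x : W', ∃ (w : W) (y : Fin b → W'), x = f w + ∑ j, θ (r j) • y j) :
    Function.Surjective f := by
  have := mem_range_sum_smul (θ := θ) hr (W' ⧸ LinearMap.range f) (fun x => by
    obtain ⟨x, rfl⟩ := Submodule.mkQ_surjective _ x
    obtain ⟨w, y, rfl⟩ := h x
    refine ⟨fun j => Submodule.mkQ _ (y j), ?_⟩
    have : (LinearMap.range f).mkQ (f w) = 0 :=
      (Submodule.Quotient.mk_eq_zero _).2 ⟨w, rfl⟩
    rw [map_add, this, zero_add, map_sum]
    simp only [map_smul])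
  rw [← LinearMap.range_eq_top]
  exact Submodule.Quotient.subsingleton_iff.1 this

end Nilpotent

/-! ### Noetherian modules over nilpotent thickenings. -/

section Noetherian

variable {B B₀ : Type*} [Ring B] [Ring B₀] (π : B →+* B₀) {W : Type*} [AddCommGroup W]
  [Module B W] [Module B₀ W] (h : ∀ (x : B) (w : W), x • w = π x • w)

include h

lemma mem_span_of_smul_eq {s : Set W} {x : W} (hx : x ∈ Submodule.span B s) :
    x ∈ Submodule.span B₀ s := by
  induction hx using Submodule.span_induction with
  | mem x hx => exact Submodule.subset_span hx
  | zero => exact zero_mem _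
  | add x y _ _ hx hy => exact add_mem hx hy
  | smul a x _ hx => rw [h]; exact Submodule.smul_mem _ _ hx

lemma mem_span_of_smul_eq_of_surjective (hπ : Function.Surjective π) {s : Set W} {x : W}
    (hx : x ∈ Submodule.span B₀ s) : x ∈ Submodule.span B s := by
  induction hx using Submodule.span_induction with
  | mem x hx => exact Submodule.subset_span hx
  | zero => exact zero_mem _
  | add x y _ _ hx hy => exact add_mem hx hy
  | smul a x _ hx =>
    obtain ⟨a, rfl⟩ := hπ a
    rw [← h]
    exact Submodule.smul_mem _ _ hx

lemma finite_of_smul_eq [hW : Module.Finite B W] : Module.Finite B₀ W := by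
  obtain ⟨s, hs⟩ := hW.fg_top
  refine ⟨⟨s, ?_⟩⟩
  rw [eq_top_iff]
  intro x _
  exact mem_span_of_smul_eq π h (hs ▸ Submodule.mem_top)

lemma isNoetherian_of_smul_eq (hπ : Function.Surjective π) [IsNoetherian B₀ W] :
    IsNoetherian B W := by
  refine ⟨fun V => ?_⟩
  let V₀ : Submodule B₀ W :=
    { V.toAddSubmonoid with
      smul_mem' := fun a x hx => by
        obtain ⟨a, rfl⟩ := hπ a
        rw [← h]
        exact V.smul_mem _ hx }
  obtain ⟨s, hs⟩ := IsNoetherian.noetherian V₀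
  refine ⟨s, le_antisymm (Submodule.span_le.2 fun x hx => ?_) fun x hx => ?_⟩
  · exact (hs.le (Submodule.subset_span hx) : x ∈ V₀)
  · exact mem_span_of_smul_eq_of_surjective π h hπ (hs.ge (show x ∈ V₀ from hx))

end Noetherian

/-- Let J be the ideal generated by the r_j. Induction on the power of J killing W: J W is killed by
one power less, and W / J W is a finite module over the Noetherian ring B₀. -/
lemma isNoetherian_of_nilpotent {K : Type*} [CommRing K] {B B₀ : Type*} [Ring B] [Ring B₀]
    {θ : K →+* B} {b : ℕ} {r : Fin b → K} (hr : IsNilpotent (Ideal.span (Set.range r)))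
    (hθ : ∀ c x, θ c * x = x * θ c) (π : B →+* B₀) (hπ : Function.Surjective π)
    (hker : ∀ x, π x = 0 → ∃ y : Fin b → B, x = ∑ j, θ (r j) * y j) [IsNoetherianRing B₀]
    (W : Type*) [AddCommGroup W] [Module B W] [Module.Finite B W] : IsNoetherian B W := by
  obtain ⟨N, hN⟩ := hr
  suffices ∀ (n : ℕ) (W : Type _) [AddCommGroup W] [Module B W] [Module.Finite B W]
      (_ : ∀ c ∈ Ideal.span (Set.range r) ^ n, ∀ w : W, θ c • w = 0), IsNoetherian B W from
    this N W (fun c hc w => by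
      rw [hN] at hc
      rw [(Submodule.mem_bot K).1 hc, map_zero, zero_smul])
  intro n
  induction n with
  | zero =>
    intro W _ _ _ h
    have : Subsingleton W := ⟨fun x y => by
      have h1 (x : W) : x = 0 := by
        simpa using h 1 (by rw [pow_zero, Ideal.one_eq_top]; trivial) x
      rw [h1 x, h1 y]⟩
    infer_instance
  | succ n hn =>
    intro W _ _ _ h
    -- Describing J W as the image of W^b shows that it is finitely generated, before B is known to
    -- be Noetherian.
    let μ : (Fin b → W) →ₗ[B] W :=
      { toFun := fun y => ∑ j, θ (r j) • y j
        map_add' := fun y z => by simp only [Pi.add_apply, smul_add, Finset.sum_add_distrib]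
        map_smul' := fun a y => by
          simp only [Pi.smul_apply, RingHom.id_apply, Finset.smul_sum, ← mul_smul, hθ] }
    have h1 : IsNoetherian B (LinearMap.range μ) := hn _ (by
      rintro c hc ⟨_, y, rfl⟩
      ext
      change θ c • ∑ j, θ (r j) • y j = 0
      rw [Finset.smul_sum]
      refine Finset.sum_eq_zero fun j _ => ?_
      rw [← mul_smul, ← map_mul]
      exact h _ (by rw [pow_succ]; exact Ideal.mul_mem_mul hc (Ideal.subset_span ⟨j, rfl⟩)) _)
    have h2 : IsNoetherian B (W ⧸ LinearMap.range μ) := by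
      have hz (a : B) (ha : π a = 0) (x : W ⧸ LinearMap.range μ) : a • x = 0 := by
        obtain ⟨x, rfl⟩ := Submodule.mkQ_surjective _ x
        obtain ⟨y, rfl⟩ := hker a ha
        rw [← map_smul]
        refine (Submodule.Quotient.mk_eq_zero _).2 ⟨fun j => y j • x, ?_⟩
        change ∑ j, θ (r j) • y j • x = _
        rw [Finset.sum_smul]
        simp only [mul_smul]
      -- Any preimage in B may be used to define the action of B₀, because the kernel of π acts by
      -- zero on the quotient.
      let _ : SMul B₀ (W ⧸ LinearMap.range μ) := ⟨fun c x => Function.surjInv hπ c • x⟩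
      have hs (a : B) (x : W ⧸ LinearMap.range μ) : π a • x = a • x := by
        change Function.surjInv hπ (π a) • x = a • x
        rw [← sub_eq_zero, ← sub_smul]
        exact hz _ (by rw [map_sub, Function.surjInv_eq hπ, sub_self]) x
      let _ : Module B₀ (W ⧸ LinearMap.range μ) := Function.Surjective.moduleLeft π hπ hs
      have := finite_of_smul_eq (W := W ⧸ LinearMap.range μ) π (fun x w => (hs x w).symm)
      exact isNoetherian_of_smul_eq π (fun x w => (hs x w).symm) hπ
    exact (isNoetherian_iff_submodule_quotient (LinearMap.range μ)).2 ⟨h1, h2⟩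

lemma finite_of_exact {B : Type*} [Ring B] [IsNoetherianRing B] {W W' W'' : Type*}
    [AddCommGroup W] [Module B W] [AddCommGroup W'] [Module B W'] [AddCommGroup W''] [Module B W'']
    (f : W' →ₗ[B] W) (g : W →ₗ[B] W'') (hfg : Function.Exact f g) [Module.Finite B W']
    [Module.Finite B W''] : Module.Finite B W := by
  have : IsNoetherian B W' := isNoetherian_of_isNoetherianRing_of_finite B W'
  have : IsNoetherian B W'' := isNoetherian_of_isNoetherianRing_of_finite B W''
  have := isNoetherian_of_range_eq_ker f g hfg.linearMap_ker_eq.symm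
  infer_instance

/-- After identification with the commutative tensor product, `squareMap` is the comparison
isomorphism from the tensor product to the given pushout. -/
lemma RightTensor.bijective_squareMap_of_isPushout {S T S' T' : Type u} [CommRing S] [CommRing T]
    [CommRing S'] [CommRing T'] (f : S →+* T) (f' : S' →+* T') (a : S →+* S') (b : T →+* T')
    (h : IsPushout (CommRingCat.ofHom f) (CommRingCat.ofHom a) (CommRingCat.ofHom b)
      (CommRingCat.ofHom f'))
    (comm : ∀ s, b (f s) = f' (a s)) : Function.Bijective (squareMap f f' a b comm) := by
  let _ : Algebra S T := f.toAlgebra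
  let _ : Algebra S S' := a.toAlgebra
  let _ : Module S (restrictedRing a) := inferInstanceAs (Module S S')
  have : IsCentralScalar S (restrictedRing a) := ⟨fun s m => mul_comm (show S' from m) (a s)⟩
  let e : T ⊗[S] S' ≃+* T' :=
    ((CommRingCat.isPushout_tensorProduct S T S').isoIsPushout _ _ h).commRingCatIsoToRingEquiv
  have h1 (t : T) : e (t ⊗ₜ 1) = b t := congr($((CommRingCat.isPushout_tensorProduct S T
    S').inl_isoIsPushout_hom _ _ h).hom t)
  have h2 (s : S') : e (1 ⊗ₜ s) = f' s := congr($((CommRingCat.isPushout_tensorProduct S T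
    S').inr_isoIsPushout_hom _ _ h).hom s)
  let q : T ⊗[S] S' →+ T' := AddMonoidHom.comp (squareMap f f' a b comm)
    (show T ⊗[S] S' →+ RightTensor f (restrictedRing a) from
      fromTensor f rfl (restrictedRing a))
  have hq (t : T) (s : S') : q (t ⊗ₜ s) = f' s * b t := rfl
  have h3 (x : T ⊗[S] S') : q x = e x := by
    induction x with
    | zero => rw [map_zero, map_zero]
    | add x y hx hy => rw [map_add, map_add, hx, hy]
    | tmul t s =>
      have h : t ⊗ₜ[S] s = (t ⊗ₜ[S] (1 : S')) * ((1 : T) ⊗ₜ[S] s) := by simp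
      rw [hq, h, map_mul, h1, h2, mul_comm]
  have h4 := fromTensor_bijective f rfl (restrictedRing a)
  have h5 : ⇑(squareMap f f' a b comm) ∘ ⇑(fromTensor f rfl (restrictedRing a)) = e := funext h3
  exact (Function.Bijective.of_comp_iff _ h4).1 (h5 ▸ e.bijective)

section

open AlgebraicGeometry

/-- Affine base change of sections, applied to the pullback square of identity morphisms of X: the
affine opens U and V over W then have fibre product U ⊓ V. -/
lemma AlgebraicGeometry.IsAffineOpen.isPushout_inf {X : Scheme.{u}} {U V W : X.Opens}
    (hU : IsAffineOpen U) (hV : IsAffineOpen V) (hW : IsAffineOpen W) (hUW : U ≤ W) (hVW : V ≤ W)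
    {Z : X.Opens} (hZ : Z = U ⊓ V) (hZU : Z ≤ U) (hZV : Z ≤ V) :
    IsPushout (X.presheaf.map (homOfLE hUW).op) (X.presheaf.map (homOfLE hVW).op)
      (X.presheaf.map (homOfLE hZU).op) (X.presheaf.map (homOfLE hZV).op) := by
  have h (U V : X.Opens) (hUV : U ≤ V) : (𝟙 X : X ⟶ X).appLE V U hUV =
    X.presheaf.map (homOfLE hUV).op := Category.id_comp _
  have H : IsPullback (𝟙 X) (𝟙 X) (𝟙 X) (𝟙 X) := IsPullback.of_horiz_isIso ⟨rfl⟩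
  have := (isIso_pushoutSection_iff H (US := W) (UT := V) (UX := U) (UY := Z) hVW hUW hZ).1
    (isIso_pushoutSection_of_isAffineOpen H hVW hUW hZ hW hV hU)
  rw [← h U W hUW, ← h V W hVW, ← h Z U hZU, ← h Z V hZV]
  exact this

end

/-- `π : B → B₀` identifies `B₀` with the quotient of the `K`-algebra `B` by the ideal generated by
the elements `r_j` of `K`. -/
structure IsReduction {K : Type*} [CommRing K] {b : ℕ} (r : Fin b → K) {B B₀ : Type*} [Ring B]
    [Ring B₀] (θ : K →+* B) (π : B →+* B₀) : Prop where
  commutes : ∀ c x, θ c * x = x * θ c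
  surjective : Function.Surjective π
  map_eq_zero : ∀ j, π (θ (r j)) = 0
  exists_of_map_eq_zero : ∀ x, π x = 0 → ∃ y : Fin b → B, x = ∑ j, θ (r j) * y j

/-! ### Reduction modulo the r_j, and lifting of Cartesian squares of rings. -/

namespace IsReduction

open RightTensor

variable {K : Type*} [CommRing K] {b : ℕ} {r : Fin b → K}

/-- The subgroup of the sums `∑ r_j y_j`. -/
def radical (r : Fin b → K) {B : Type*} [Ring B] (θ : K →+* B) (W : Type*) [AddCommGroup W]
    [Module B W] : AddSubgroup W where
  carrier := {x | ∃ y : Fin b → W, x = ∑ j, θ (r j) • y j}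
  add_mem' := by
    rintro _ _ ⟨y, rfl⟩ ⟨z, rfl⟩
    exact ⟨y + z, by simp only [Pi.add_apply, smul_add, Finset.sum_add_distrib]⟩
  zero_mem' := ⟨0, by simp⟩
  neg_mem' := by
    rintro _ ⟨y, rfl⟩
    exact ⟨-y, by simp⟩

/-- The structure homomorphism of the opposite algebra. -/
def opHom {B : Type*} [Ring B] (θ : K →+* B) : K →+* Bᵐᵒᵖ :=
  (RingHom.op θ).comp (RingEquiv.toOpposite K).toRingHom

lemma opHom_smul {B : Type*} [Ring B] (θ : K →+* B) (c : K) {W : Type*} [AddCommGroup W]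
    [Module Bᵐᵒᵖ W] (w : W) : opHom θ c • w = op (θ c) • w := rfl

section Module

variable {S S₀ : Type u} [Ring S] [Ring S₀] {θ : K →+* S} {π : S →+* S₀}
  (h : IsReduction r θ π) {M : Type u} [AddCommGroup M] [Module Sᵐᵒᵖ M]

include h

lemma op_smul_mem_radical (m : M) (s : S) (hs : π s = 0) : op s • m ∈ radical r (opHom θ) M := by
  obtain ⟨y, rfl⟩ := h.exists_of_map_eq_zero s hs
  refine ⟨fun j => op (y j) • m, ?_⟩
  rw [Finset.op_sum, Finset.sum_smul]
  refine Finset.sum_congr rfl fun j _ => ?_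
  rw [opHom_smul, ← mul_smul, ← op_mul, h.commutes]

/-- M ⊗_S S₀ = M / J M, where J is generated by the r_j. Nakayama's lemma, exactness of reduction on
flat modules and the resolution of P / mP all use base change in this form. -/
lemma tmul_one_eq_zero_iff (m : M) : tmul π m 1 = 0 ↔ m ∈ radical r (opHom θ) M := by
  refine ⟨mem_of_tmul_one_eq_zero π h.surjective _ (fun s m hs => h.op_smul_mem_radical m s hs) m,
    ?_⟩
  rintro ⟨y, rfl⟩
  rw [RightTensor.sum_tmul]
  refine Finset.sum_eq_zero fun j _ => ?_
  rw [opHom_smul, tmul_balanced, h.map_eq_zero, zero_mul, RightTensor.tmul_zero]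

/-- If M / J M = 0 then M = J M, and J is nilpotent. -/
lemma subsingleton_of_subsingleton (hr : IsNilpotent (Ideal.span (Set.range r)))
    [Subsingleton (RightTensor π M)] : Subsingleton M :=
  mem_range_sum_smul (θ := opHom θ) hr M
    (fun x => (h.tmul_one_eq_zero_iff x).1 (Subsingleton.elim _ _))

omit h in
lemma op_commutes (h : IsReduction r θ π) (c : K) (x : Sᵐᵒᵖ) : opHom θ c * x = x * opHom θ c :=
  unop_injective (h.commutes c x.unop).symm

lemma isNoetherianRing_op (hr : IsNilpotent (Ideal.span (Set.range r)))
    [IsNoetherianRing S₀ᵐᵒᵖ] : IsNoetherianRing Sᵐᵒᵖ :=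
  isNoetherian_of_nilpotent (θ := opHom θ) hr h.op_commutes (RingHom.op π)
    (fun x => (h.surjective x.unop).imp' op fun a ha => by
      change op (π a) = x
      rw [ha, op_unop])
    (fun x hx => by
      obtain ⟨y, hy⟩ := h.exists_of_map_eq_zero x.unop (op_injective hx)
      refine ⟨fun j => op (y j), unop_injective ?_⟩
      rw [Finset.unop_sum, hy]
      exact Finset.sum_congr rfl fun j _ => h.commutes _ _) Sᵐᵒᵖ

end Module

section Square

variable {S T S' T' S₀ T₀ S₀' T₀' : Type u} [Ring S] [Ring T] [Ring S'] [Ring T']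
  [Ring S₀] [Ring T₀] [Ring S₀'] [Ring T₀']
  {f : S →+* T} {f' : S' →+* T'} {a : S →+* S'} {b : T →+* T'} {comm : ∀ s, b (f s) = f' (a s)}
  {f₀ : S₀ →+* T₀} {f₀' : S₀' →+* T₀'} {a₀ : S₀ →+* S₀'} {b₀ : T₀ →+* T₀'}
  {comm₀ : ∀ s, b₀ (f₀ s) = f₀' (a₀ s)}
  {θS : K →+* S} {θT : K →+* T} {θS' : K →+* S'} {θT' : K →+* T'}
  {πS : S →+* S₀} {πT : T →+* T₀} {πS' : S' →+* S₀'} {πT' : T' →+* T₀'}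
  (hS : IsReduction r θS πS) (hT : IsReduction r θT πT) (hS' : IsReduction r θS' πS')
  (hT' : IsReduction r θT' πT')
  (hθf : ∀ c, f (θS c) = θT c) (hθa : ∀ c, a (θS c) = θS' c) (hθb : ∀ c, b (θT c) = θT' c)
  (hπf : ∀ s, πT (f s) = f₀ (πS s)) (hπa : ∀ s, πS' (a s) = a₀ (πS s))
  (hπf' : ∀ s, πT' (f' s) = f₀' (πS' s)) (hπb : ∀ t, πT' (b t) = b₀ (πT t))

/-- The map `S' ⊗_S T → S₀' ⊗_{S₀} T₀`. -/
noncomputable def squareReduction (hπf : ∀ s, πT (f s) = f₀ (πS s))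
    (hπa : ∀ s, πS' (a s) = a₀ (πS s)) :
    RightTensor f (restrictedRing a) →+ RightTensor f₀ (restrictedRing a₀) :=
  liftAdd f (M := restrictedRing a)
    (AddMonoidHom.mk' (fun t => AddMonoidHom.mk'
      (fun s : restrictedRing a => tmul f₀ (M := restrictedRing a₀) (πS' s) (πT t))
      (fun s s' => by
        refine (congrArg (tmul f₀ (M := restrictedRing a₀) · (πT t))
          (map_add πS' (show S' from s) (show S' from s'))).trans ?_
        exact tmul_add_left f₀ (M := restrictedRing a₀) _ _ _))
      (fun t t' => by
        ext s
        exact (congrArg (tmul f₀ (M := restrictedRing a₀) (πS' s)) (map_add πT t t')).trans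
          (tmul_add_right f₀ (M := restrictedRing a₀) _ _ _)))
    (fun s t m => by
      refine Eq.trans ?_ ((tmul_balanced f₀ (M := restrictedRing a₀) (πS' m) (πS s) (πT t)).trans ?_)
      · refine congrArg (tmul f₀ (M := restrictedRing a₀) · (πT t)) ?_
        exact (map_mul πS' (show S' from m) (a s)).trans
          (congrArg ((show S₀' from πS' m) * ·) (hπa s))
      · rw [← hπf, ← map_mul]
        rfl)

include hπf' hπb in
lemma squareMap_squareReduction (x : RightTensor f (restrictedRing a)) :
    squareMap f₀ f₀' a₀ b₀ comm₀ (squareReduction (πS' := πS') hπf hπa x) =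
      πT' (squareMap f f' a b comm x) := by
  induction x using RightTensor.induction with
  | zero => simp only [map_zero]
  | add x y hx hy => simp only [map_add, hx, hy]
  | tmul s t =>
    exact ((map_mul πT' (f' s) (b t)).trans (congrArg₂ (· * ·) (hπf' s) (hπb t))).symm

include hS hT hS' hθf hθa in
-- S₀' ⊗_{S₀} T₀ is S' ⊗_S T modulo J. Set-theoretic lifts of both factors define a map back to the
-- quotient by J, because changing a lift changes the tensor by an element of J (S' ⊗_S T).
lemma mem_radical_of_squareReduction_eq_zero (x : RightTensor f (restrictedRing a))
    (hx : squareReduction (πS' := πS') hπf hπa x = 0) :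
    x ∈ radical r (opHom θT) (RightTensor f (restrictedRing a)) := by
  let Y := RightTensor f (restrictedRing a)
  let N : AddSubgroup Y := radical r (opHom θT) Y
  let τ (s : S') (t : T) : Y := tmul f (M := restrictedRing a) s t
  let σT := Function.surjInv hT.surjective
  let σS := Function.surjInv hS.surjective
  let σS' := Function.surjInv hS'.surjective
  have hσT (t) : πT (σT t) = t := Function.surjInv_eq hT.surjective t
  have hσS (t) : πS (σS t) = t := Function.surjInv_eq hS.surjective t
  have hσS' (t) : πS' (σS' t) = t := Function.surjInv_eq hS'.surjective t
  have h1 (s : S') (t : T) (ht : πT t = 0) : τ s t ∈ N := by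
    have : τ s t = op t • τ s 1 := tmul_eq_smul f (M := restrictedRing a) s t
    rw [this]
    exact hT.op_smul_mem_radical _ t ht
  have h2 (s : S') (t : T) (hs : πS' s = 0) : τ s t ∈ N := by
    obtain ⟨y, rfl⟩ := hS'.exists_of_map_eq_zero s hs
    refine ⟨fun j => τ (y j) t, ?_⟩
    refine (sum_tmul f (M := restrictedRing a) _ _ t).trans (Finset.sum_congr rfl fun j _ => ?_)
    rw [opHom_smul, hS'.commutes, ← hθa]
    refine (tmul_balanced f (M := restrictedRing a) (y j) (θS (r j)) t).trans ?_
    rw [hθf, hT.commutes]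
    exact (op_smul_tmul f (M := restrictedRing a) (y j) t (θT (r j))).symm
  have key (s s' : S') (t t' : T) (hs : πS' s = πS' s') (ht : πT t = πT t') :
      (QuotientAddGroup.mk (τ s t) : Y ⧸ N) = QuotientAddGroup.mk (τ s' t') := by
    rw [eq_comm, QuotientAddGroup.eq]
    have e1 : τ s t = τ s' t + τ (s - s') t := by
      refine Eq.trans ?_ (tmul_add_left f (M := restrictedRing a) s' (s - s' : S') t)
      exact congrArg (τ · t) (add_sub_cancel s' s).symm
    have e2 : τ s' t = τ s' t' + τ s' (t - t') := by
      refine Eq.trans ?_ (tmul_add_right f (M := restrictedRing a) s' t' (t - t'))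
      rw [add_sub_cancel]
    rw [e1, e2, add_assoc, neg_add_cancel_left]
    exact add_mem (h1 _ _ (by rw [map_sub, ht, sub_self])) (h2 _ _ (by rw [map_sub, hs, sub_self]))
  let g : T₀ →+ (restrictedRing a₀) →+ Y ⧸ N := AddMonoidHom.mk'
    (fun t => AddMonoidHom.mk' (fun s => QuotientAddGroup.mk (τ (σS' s) (σT t)))
      (fun s s' => by
        refine (key _ (σS' s + σS' s') _ (σT t) ?_ rfl).trans ?_
        · exact ((map_add πS' _ _).trans ((congrArg₂ (· + ·) (hσS' s) (hσS' s')).trans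
            (hσS' ((show S₀' from s) + (show S₀' from s'))).symm)).symm
        · rw [← QuotientAddGroup.mk_add]
          exact congrArg _ (tmul_add_left f (M := restrictedRing a) _ _ _)))
    (fun t t' => by
      ext s
      refine (key _ (σS' s) _ (σT t + σT t') rfl ?_).trans ?_
      · rw [map_add, hσT, hσT, hσT]
      · exact (congrArg _ (tmul_add_right f (M := restrictedRing a) _ _ _)).trans
          (QuotientAddGroup.mk_add _ _ _))
  have hg : ∀ s t m, g t (op s • m) = g (f₀ s * t) m := by
    intro s t (m : S₀')
    refine (key (σS' (m * a₀ s)) (σS' m * a (σS s)) (σT t) (σT t) ?_ rfl).trans ?_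
    · rw [map_mul, hσS', hσS', hπa, hσS]
    · refine (congrArg _ (tmul_balanced f (M := restrictedRing a) (σS' m) (σS s) (σT t))).trans ?_
      refine key _ _ _ _ rfl ?_
      rw [map_mul, hσT, hσT, hπf, hσS]
  have h3 (x : Y) : liftAdd f₀ g hg (squareReduction (πS' := πS') hπf hπa x) =
      QuotientAddGroup.mk x := by
    induction x using RightTensor.induction with
    | zero => simp only [map_zero]; rfl
    | add x y hx hy => rw [map_add, map_add, hx, hy]; rfl
    | tmul s t =>
      exact key _ _ _ _ (hσS' _) (hσT _)
  have h4 := h3 x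
  rw [hx, map_zero] at h4
  exact (QuotientAddGroup.eq_zero_iff x).1 h4.symm

include hS hT hS' hT' hθf hθa hθb hπf' hπb in
-- Modulo J the map is the given bijection. Surjectivity follows by Nakayama; the kernel N is then
-- handled by flatness of T' over K, which keeps N inside the source modulo J.
lemma bijective_squareMap [IsNoetherianRing K] (hr : IsNilpotent (Ideal.span (Set.range r)))
    (hπf : ∀ s, πT (f s) = f₀ (πS s)) (hπa : ∀ s, πS' (a s) = a₀ (πS s))
    (hflat : IsMatrixFlat θT' T') (H : Function.Bijective (squareMap f₀ f₀' a₀ b₀ comm₀)) :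
    Function.Bijective (squareMap f f' a b comm) := by
  let _ : Module Tᵐᵒᵖ T' := Module.compHom T' (RingHom.op b)
  let p : RightTensor f (restrictedRing a) →ₗ[Tᵐᵒᵖ] T' :=
    { squareMap f f' a b comm with
      map_smul' := fun t x => by
        induction x using RightTensor.induction with
        | zero => rw [smul_zero]; exact (map_zero _).trans (smul_zero _).symm
        | add x y hx hy =>
          rw [smul_add]
          refine (map_add (squareMap f f' a b comm) _ _).trans ?_
          refine (congrArg₂ (· + ·) hx hy).trans ?_
          rw [← smul_add]
          exact congrArg _ (map_add (squareMap f f' a b comm) _ _).symm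
        | tmul s t' =>
          refine (congrArg (squareMap f f' a b comm)
            (op_smul_tmul f (M := restrictedRing a) s t' t.unop)).trans ?_
          change f' s * b (t' * t.unop) = (f' s * b t') * b t.unop
          rw [map_mul, mul_assoc] }
  have hp (x) : p x = squareMap f f' a b comm x := rfl
  have hθ (c : K) (x : T') : opHom θT c • x = θT' c * x := by
    change x * b (θT c) = _
    rw [hθb, hT'.commutes]
  have hflat' : IsMatrixFlat (opHom θT) T' := by
    intro l m n D' D hD x hx
    simp only [hθ] at hx ⊢
    exact hflat D' D hD x hx
  have hsurj : Function.Surjective p := by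
    refine surjective_of_nilpotent hr (θ := opHom θT) p fun t => ?_
    have h1 (x₀ : RightTensor f₀ (restrictedRing a₀)) :
        ∃ x, squareMap f₀ f₀' a₀ b₀ comm₀ x₀ = πT' (p x) := by
      induction x₀ using RightTensor.induction with
      | zero => exact ⟨0, by simp only [map_zero]⟩
      | add x y hx hy =>
        obtain ⟨x, hx⟩ := hx
        obtain ⟨y, hy⟩ := hy
        exact ⟨x + y, by simp only [map_add, hx, hy]⟩
      | tmul s t =>
        obtain ⟨s, rfl⟩ := hS'.surjective s
        obtain ⟨t, rfl⟩ := hT.surjective t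
        refine ⟨tmul f (M := restrictedRing a) s t, ?_⟩
        rw [hp, ← squareMap_squareReduction (comm₀ := comm₀) hπf hπa hπf' hπb]
        rfl
    obtain ⟨x₀, hx₀⟩ := H.2 (πT' t)
    obtain ⟨x, hx⟩ := h1 x₀
    obtain ⟨y, hy⟩ := hT'.exists_of_map_eq_zero (t - p x) (by rw [map_sub, ← hx, hx₀, sub_self])
    refine ⟨x, y, ?_⟩
    simp only [hθ, ← hy, add_sub_cancel]
  refine ⟨?_, hsurj⟩
  -- Injectivity modulo J places N in J (S' ⊗_S T). Flatness of the quotient T' gives N ∩ J (S' ⊗_S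
  -- T) = J N, so N = J N and N = 0.
  have hN : Subsingleton (LinearMap.ker p) := by
    refine mem_range_sum_smul (θ := opHom θT) hr _ fun x => ?_
    have h1 : (x : RightTensor f (restrictedRing a)) ∈
        radical r (opHom θT) (RightTensor f (restrictedRing a)) := by
      refine mem_radical_of_squareReduction_eq_zero hS hT hS' hθf hθa hπf hπa x (H.1 ?_)
      rw [squareMap_squareReduction (T' := T') (f' := f') (b := b) (πT' := πT') (comm := comm)
        hπf hπa hπf' hπb, map_zero, ← hp, LinearMap.mem_ker.1 x.2, map_zero]
    obtain ⟨y, hy⟩ := h1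
    obtain ⟨z, hz⟩ := hflat'.exists_lift (LinearMap.ker p).subtype p
      (LinearMap.ker p).injective_subtype hsurj (LinearMap.exact_subtype_ker_map p)
      (Matrix.of fun j (_ : Fin 1) => r j) y (fun _ => x) (fun _ => hy)
    exact ⟨z, hz 0⟩
  rw [injective_iff_map_eq_zero]
  intro x hx
  exact congrArg Subtype.val (Subsingleton.elim (⟨x, LinearMap.mem_ker.2 hx⟩ : LinearMap.ker p) 0)

end Square

end IsReduction

/-! ### Cartesian intersections of charts. -/

namespace NCScheme

variable {K : Type v} [CommRing K] {I : Type w} [SemilatticeInf I]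

/-- The algebra `A_i`. -/
abbrev ring (A : NCScheme.{u} K I) (i : I) : Type u := A.alg.obj (Opposite.op i)

variable (A : NCScheme.{u} K I)

/-- The homomorphism `A_j → A_i` for `i ≤ j`. -/
abbrev res {i j : I} (h : i ≤ j) : A.ring j →+* A.ring i := phi A.alg (homOfLE h).op

lemma res_res {i j l : I} (h : i ≤ j) (h' : j ≤ l) (x : A.ring l) :
    A.res h (A.res h' x) = A.res (h.trans h') x :=
  (congrArg (fun g => g.hom x) (A.alg.map_comp (homOfLE h').op (homOfLE h).op)).symm

lemma res_self {i : I} (x : A.ring i) : A.res le_rfl x = x :=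
  congrArg (fun g => g.hom x) (A.alg.map_id (Opposite.op i))

lemma res_algebraMap {i j : I} (h : i ≤ j) (c : K) :
    A.res h (algebraMap K (A.ring j) c) = algebraMap K (A.ring i) c :=
  (A.alg.map (homOfLE h).op).hom.commutes c

/-- The intersections of the charts inside a chart are the expected ones:
`A_a ⊗_{A_j} A_b = A_{a ∩ b}` for `a, b ≤ j`. -/
class HasCartesianIntersections : Prop where
  bijective : ∀ ⦃a b c j : I⦄ (ha : a ≤ j) (hb : b ≤ j) (hca : c ≤ a) (hcb : c ≤ b) (_ : a ⊓ b ≤ c),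
    Function.Bijective (RightTensor.squareMap (A.res hb) (A.res hca) (A.res ha) (A.res hcb)
      (fun s => (A.res_res hcb hb s).trans (A.res_res hca ha s).symm))

end NCScheme

/-! ### Intersections, Noetherianity and flatness for A^0 and its deformations. -/

section Deformation

open AlgebraicGeometry

variable {k : Type u} [Field k] {X : Scheme.{u}} [X.Over (Spec (CommRingCat.of k))]
  {I : Type w} [SemilatticeInf I] {𝒰 : AffineCovering X I}

instance : (𝒰.ncScheme k).HasCartesianIntersections where
  bijective {a b c j} ha hb hca hcb hc := by
    have hZ : 𝒰.U c = 𝒰.U a ⊓ 𝒰.U b := by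
      rw [← 𝒰.map_inf, le_antisymm hc (le_inf hca hcb)]
    have h := ((𝒰.isAffineOpen a).isPushout_inf (𝒰.isAffineOpen b) (𝒰.isAffineOpen j)
      (𝒰.mono ha) (𝒰.mono hb) hZ (𝒰.mono hca) (𝒰.mono hcb)).flip
    exact RightTensor.bijective_squareMap_of_isPushout
      (X.presheaf.map (homOfLE (𝒰.mono hb)).op).hom (X.presheaf.map (homOfLE (𝒰.mono hca)).op).hom
      (X.presheaf.map (homOfLE (𝒰.mono ha)).op).hom (X.presheaf.map (homOfLE (𝒰.mono hcb)).op).hom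
      h _

lemma isNoetherianRing_sections [LocallyOfFiniteType (X ↘ Spec (CommRingCat.of k))] (i : I) :
    IsNoetherianRing ((𝒰.ncScheme k).ring i)ᵐᵒᵖ := by
  have h : IsLocallyNoetherian X := LocallyOfFiniteType.isLocallyNoetherian
    (X ↘ Spec (CommRingCat.of k))
  have : IsNoetherianRing Γ(X, 𝒰.U i) :=
    IsLocallyNoetherian.component_noetherian ⟨𝒰.U i, 𝒰.isAffineOpen i⟩
  exact isNoetherianRing_of_ringEquiv Γ(X, 𝒰.U i) (RingEquiv.toOpposite Γ(X, 𝒰.U i))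

namespace NCDeformation

variable {R : Type v} [CommRing R] [IsLocalRing R] [Algebra k R] (A : NCDeformation k 𝒰 R)

/-- α_i identifies A^0_i with R/m ⊗_R A_i = A_i / m A_i. -/
lemma isReduction {b : ℕ} {r : Fin b → R}
    (hr : Ideal.span (Set.range r) = IsLocalRing.maximalIdeal R) (i : I) :
    IsReduction r (algebraMap R (A.toNCScheme.ring i)) (betaHom A.reduction (Opposite.op i)) where
  commutes := Algebra.commutes
  surjective x := by
    obtain ⟨x, rfl⟩ := (A.α i).surjective x
    suffices ∃ y : A.toNCScheme.ring i, (1 : IsLocalRing.ResidueField R) ⊗ₜ[R] y = x from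
      this.imp fun y hy => congrArg (A.α i) hy
    induction x with
    | zero => exact ⟨0, TensorProduct.tmul_zero _ _⟩
    | add x y hx hy =>
      obtain ⟨x, rfl⟩ := hx
      obtain ⟨y, rfl⟩ := hy
      exact ⟨x + y, TensorProduct.tmul_add _ _ _⟩
    | tmul c x =>
      obtain ⟨c, rfl⟩ := IsLocalRing.residue_surjective c
      refine ⟨c • x, ?_⟩
      rw [← TensorProduct.smul_tmul, Algebra.smul_def, mul_one]
      rfl
  map_eq_zero j := by
    change A.α i ((1 : IsLocalRing.ResidueField R) ⊗ₜ[R] algebraMap R (A.toNCScheme.ring i) (r j)) = 0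
    rw [Algebra.algebraMap_eq_smul_one, ← TensorProduct.smul_tmul, Algebra.smul_def, mul_one]
    have : algebraMap R (IsLocalRing.ResidueField R) (r j) = 0 :=
      (IsLocalRing.residue_eq_zero_iff _).2 (hr.le (Ideal.subset_span ⟨j, rfl⟩))
    rw [this, TensorProduct.zero_tmul, map_zero]
  exists_of_map_eq_zero x hx := by
    have h1 : (1 : R ⧸ IsLocalRing.maximalIdeal R) ⊗ₜ[R] x = 0 :=
      (A.α i).injective (hx.trans (map_zero (A.α i)).symm)
    -- Vanishing of 1 ⊗ x in R/m ⊗ A_i is translated into x ∈ m A_i; expanding coefficients in the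
    -- r_j gives the sum.
    have h2 := congrArg (TensorProduct.quotTensorEquivQuotSMul (A.toNCScheme.ring i)
      (IsLocalRing.maximalIdeal R)) h1
    rw [map_zero] at h2
    have h3 : x ∈ IsLocalRing.maximalIdeal R • (⊤ : Submodule R (A.toNCScheme.ring i)) := by
      refine (Submodule.Quotient.mk_eq_zero _).1 (Eq.trans ?_ h2)
      have h4 := TensorProduct.quotTensorEquivQuotSMul_mk_tmul (IsLocalRing.maximalIdeal R) 1 x
      rw [one_smul] at h4
      exact h4.symm
    clear hx h1 h2
    suffices x ∈ IsReduction.radical r (algebraMap R (A.toNCScheme.ring i))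
        (A.toNCScheme.ring i) from this
    rw [← hr] at h3
    induction h3 using Submodule.smul_induction_on' with
    | smul c hc x _ =>
      obtain ⟨d, rfl⟩ := (Submodule.mem_span_range_iff_exists_fun R).1 hc
      refine ⟨fun j => d j • x, ?_⟩
      rw [Finset.sum_smul]
      refine Finset.sum_congr rfl fun j _ => ?_
      rw [algebraMap_smul, ← mul_smul, smul_eq_mul, mul_comm]
    | add x _ y _ hx hy => exact add_mem hx hy

lemma exists_generators [IsArtinianRing R] : ∃ (b : ℕ) (r : Fin b → R),
    Ideal.span (Set.range r) = IsLocalRing.maximalIdeal R :=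
  Submodule.fg_iff_exists_fin_generating_family.1 (IsNoetherian.noetherian _)

omit [X.Over (Spec (CommRingCat.of k))] in
lemma isNilpotent_maximalIdeal [IsArtinianRing R] : IsNilpotent (IsLocalRing.maximalIdeal R) := by
  rw [← IsLocalRing.jacobson_eq_maximalIdeal ⊥ bot_ne_top]
  exact IsArtinianRing.isNilpotent_jacobson_bot

lemma isMatrixFlat (i : I) :
    IsMatrixFlat (algebraMap R (A.toNCScheme.ring i)) (A.toNCScheme.ring i) :=
  have := A.flat_over i
  IsMatrixFlat.of_flat _ fun c x => by rw [algebraMap_smul]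

/-- Lifted from A^0: m is nilpotent since R is Artinian, and A_c is flat over R. -/
instance [IsArtinianRing R] : A.toNCScheme.HasCartesianIntersections where
  bijective {a b c j} ha hb hca hcb hc := by
    obtain ⟨m, r, hr⟩ := exists_generators (R := R)
    exact IsReduction.bijective_squareMap (A.isReduction hr j) (A.isReduction hr b)
      (A.isReduction hr a) (A.isReduction hr c) (A.toNCScheme.res_algebraMap hb)
      (A.toNCScheme.res_algebraMap ha) (A.toNCScheme.res_algebraMap hcb)
      (fun x => (betaHom_comm A.reduction (homOfLE hca).op x).symm)
      (fun x => (betaHom_comm A.reduction (homOfLE hcb).op x).symm)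
      (hr ▸ isNilpotent_maximalIdeal)
      (fun x => (betaHom_comm A.reduction (homOfLE hb).op x).symm)
      (fun x => (betaHom_comm A.reduction (homOfLE ha).op x).symm) (A.isMatrixFlat c)
      (NCScheme.HasCartesianIntersections.bijective (A := 𝒰.ncScheme k) ha hb hca hcb hc)

lemma isNoetherianRing_op [IsArtinianRing R]
    [LocallyOfFiniteType (X ↘ Spec (CommRingCat.of k))] (i : I) :
    IsNoetherianRing (A.toNCScheme.ring i)ᵐᵒᵖ := by
  obtain ⟨m, r, hr⟩ := exists_generators (R := R)
  have := isNoetherianRing_sections (k := k) (𝒰 := 𝒰) i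
  exact (A.isReduction hr i).isNoetherianRing_op (hr ▸ isNilpotent_maximalIdeal)

end NCDeformation

end Deformation

/-! ### Quasi-coherent modules through their components. -/

namespace Qcoh

variable {K : Type v} [CommRing K] {I : Type w} [SemilatticeInf I] {A : NCScheme.{u} K I}

variable (A) in
/-- The functor `M ↦ M_i`. -/
noncomputable def comp (i : I) : Qcoh A ⥤ ModuleCat.{u} (A.ring i)ᵐᵒᵖ :=
  (isQuasiCoherent A).ι ⋙ component A.alg (Opposite.op i)

/-- The module `M_i`. -/
noncomputable abbrev sec (M : Qcoh A) (i : I) : ModuleCat.{u} (A.ring i)ᵐᵒᵖ := (comp A i).obj M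

/-- The restriction map `M_j → M_i` for `i ≤ j`. -/
noncomputable def res (M : Qcoh A) {i j : I} (h : i ≤ j) : M.sec j →+ M.sec i :=
  AddMonoidHom.mk' (fun m => (compMap M.obj (homOfLE h).op).hom m)
    (fun m m' => map_add (compMap M.obj (homOfLE h).op).hom m m')

lemma res_smul (M : Qcoh A) {i j : I} (h : i ≤ j) (a : A.ring j) (m : M.sec j) :
    M.res h (op a • m) = op (A.res h a) • M.res h m :=
  map_smul (compMap M.obj (homOfLE h).op).hom (op a) m

lemma res_res (M : Qcoh A) {i j l : I} (h : i ≤ j) (h' : j ≤ l) (m : M.sec l) :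
    M.res h (M.res h' m) = M.res (h.trans h') m :=
  (M.obj.map_comp_apply (homOfLE h').op (homOfLE h).op m).symm

lemma res_self (M : Qcoh A) {i : I} (h : i ≤ i) (m : M.sec i) : M.res h m = m := by
  change (M.obj.map (𝟙 (Opposite.op i))).hom m = m
  rw [M.obj.map_id]
  rfl

lemma bijective_res (M : Qcoh A) {i j : I} (h : i ≤ j) (h' : j ≤ i) :
    Function.Bijective (M.res h) :=
  ⟨fun x y hxy => by
    have := congrArg (M.res h') hxy
    rwa [res_res, res_res, res_self, res_self] at this, fun x => ⟨M.res h' x, by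
      rw [res_res, res_self]⟩⟩

/-- The map `M_j ⊗_{A_j} A_i → M_i`. -/
noncomputable def glue (M : Qcoh A) {i j : I} (h : i ≤ j) :
    RightTensor (A.res h) (M.sec j) →ₗ[(A.ring i)ᵐᵒᵖ] M.sec i :=
  RightTensor.lift (A.res h) (M.res h) (fun a m => M.res_smul h a m)

lemma glue_tmul (M : Qcoh A) {i j : I} (h : i ≤ j) (m : M.sec j) (a : A.ring i) :
    M.glue h (RightTensor.tmul (A.res h) m a) = op a • M.res h m := rfl

lemma bijective_glue (M : Qcoh A) {i j : I} (h : i ≤ j) : Function.Bijective (M.glue h) := by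
  obtain h' | rfl := h.lt_or_eq
  · have : IsIso ((gluing A.alg (homOfLE h'.le).op).app M.obj) := M.property h'
    exact (ConcreteCategory.bijective_of_isIso ((gluing A.alg (homOfLE h'.le).op).app M.obj) :)
  -- Quasi-coherence is only required for i < j. For i = j the map is M_i ⊗_{A_i} A_i → M_i, with
  -- inverse m ↦ m ⊗ 1.
  · refine ⟨?_, fun x => ⟨RightTensor.tmul _ x 1, ?_⟩⟩
    · have key (x : RightTensor (A.res h) (M.sec i)) :
          RightTensor.tmul (A.res h) (M.glue h x) 1 = x := by
        induction x using RightTensor.induction with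
        | zero => rw [map_zero, RightTensor.zero_tmul]
        | add x y hx hy => rw [map_add, RightTensor.tmul_add_left, hx, hy]
        | tmul m a =>
          rw [glue_tmul, res_self, RightTensor.tmul_balanced, mul_one, A.res_self]
      intro x y hxy
      rw [← key x, hxy, key]
    · rw [glue_tmul, op_one, one_smul, res_self]

/-- M_i = M_j ⊗_{A_j} A_i is generated over A_i by the restrictions from M_j. -/
lemma sec_induction (M : Qcoh A) {i j : I} (h : i ≤ j) {p : M.sec i → Prop} (zero : p 0)
    (add : ∀ x y, p x → p y → p (x + y)) (smul : ∀ (m : M.sec j) (a : A.ring i), p (op a • M.res h m))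
    (x : M.sec i) : p x := by
  obtain ⟨x, rfl⟩ := (M.bijective_glue h).2 x
  induction x using RightTensor.induction with
  | zero => rwa [map_zero]
  | add x y hx hy => rw [map_add]; exact add _ _ hx hy
  | tmul m a => exact smul m a

lemma sec_hom_ext (M : Qcoh A) {i j : I} (h : i ≤ j) {P : Type*} [AddCommGroup P]
    [Module (A.ring i)ᵐᵒᵖ P] {g g' : M.sec i →ₗ[(A.ring i)ᵐᵒᵖ] P}
    (H : ∀ m, g (M.res h m) = g' (M.res h m)) : g = g' := by
  ext x
  induction x using M.sec_induction h with
  | zero => rw [map_zero, map_zero]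
  | add x y hx hy => rw [map_add, map_add, hx, hy]
  | smul m a => rw [map_smul, map_smul, H]

/-- The universal property of M_j ⊗_{A_j} A_i, transported to M_i. -/
lemma exists_sec_extension (M : Qcoh A) {i j : I} (h : i ≤ j) {P : Type u} [AddCommGroup P]
    [Module (A.ring i)ᵐᵒᵖ P] (g : M.sec j →+ P)
    (hg : ∀ (a : A.ring j) (m : M.sec j), g (op a • m) = op (A.res h a) • g m) :
    ∃ g' : M.sec i →ₗ[(A.ring i)ᵐᵒᵖ] P, ∀ m, g' (M.res h m) = g m := by
  let e := LinearEquiv.ofBijective (M.glue h) (M.bijective_glue h)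
  refine ⟨(RightTensor.lift (A.res h) g hg).comp e.symm.toLinearMap, fun m => ?_⟩
  have : e.symm (M.res h m) = RightTensor.tmul (A.res h) m 1 := by
    rw [LinearEquiv.symm_apply_eq]
    exact ((M.glue_tmul h m 1).trans (by rw [op_one, one_smul])).symm
  change RightTensor.lift (A.res h) g hg (e.symm (M.res h m)) = g m
  rw [this, RightTensor.lift_tmul, op_one, one_smul]

/-- The component `M_i → N_i` of a homomorphism `M → N`. -/
noncomputable abbrev app {M N : Qcoh A} (f : M ⟶ N) (i : I) : M.sec i →ₗ[(A.ring i)ᵐᵒᵖ] N.sec i :=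
  ((comp A i).map f).hom

lemma app_res {M N : Qcoh A} (f : M ⟶ N) {i j : I} (h : i ≤ j) (m : M.sec j) :
    app f i (M.res h m) = N.res h (app f j m) :=
  PresheafOfModules.naturality_apply f.hom (homOfLE h).op m

lemma app_comp {M N P : Qcoh A} (f : M ⟶ N) (g : N ⟶ P) (i : I) (x : M.sec i) :
    app (f ≫ g) i x = app g i (app f i x) := rfl

lemma app_add {M N : Qcoh A} (f g : M ⟶ N) (i : I) (x : M.sec i) :
    app (f + g) i x = app f i x + app g i x := rfl

lemma app_zero {M N : Qcoh A} (i : I) (x : M.sec i) :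
    app (0 : M ⟶ N) i x = 0 := rfl

lemma hom_ext {M N : Qcoh A} {f g : M ⟶ N} (h : ∀ i x, app f i x = app g i x) : f = g := by
  apply ObjectProperty.hom_ext
  apply PresheafOfModules.hom_ext
  rintro ⟨i⟩
  ext x
  exact h i x

/-- The homomorphism with given components. -/
noncomputable def homMk {M N : Qcoh A} (f : ∀ i, M.sec i →ₗ[(A.ring i)ᵐᵒᵖ] N.sec i)
    (hf : ∀ ⦃i j : I⦄ (h : i ≤ j) (m : M.sec j), f i (M.res h m) = N.res h (f j m)) : M ⟶ N :=
  ObjectProperty.homMk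
    { app := fun i => ModuleCat.ofHom (f i.unop)
      naturality := fun {j i} h => by
        ext m
        exact hf (leOfHom h.unop) m }

variable (A) in
/-- The data of the modules `M_i` and their restriction maps. -/
structure Data where
  /-- the modules `M_i` -/
  V : ∀ i : I, ModuleCat.{u} (A.ring i)ᵐᵒᵖ
  /-- the restriction maps -/
  r : ∀ ⦃i j : I⦄, i ≤ j → (V j →+ V i)
  r_smul : ∀ ⦃i j : I⦄ (h : i ≤ j) (a : A.ring j) (m : V j), r h (op a • m) = op (A.res h a) • r h m
  r_self : ∀ (i : I) (m : V i), r le_rfl m = m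
  r_r : ∀ ⦃i j l : I⦄ (h : i ≤ j) (h' : j ≤ l) (m : V l), r h (r h' m) = r (h.trans h') m
  bijective : ∀ ⦃i j : I⦄ (h : i ≤ j) (q : RightTensor (A.res h) (V j) →+ V i),
    (∀ (m : V j) (a : A.ring i), q (RightTensor.tmul (A.res h) m a) = op a • r h m) → Function.Bijective q

/-- The quasi-coherent module with given components. -/
noncomputable def Data.toQcoh (D : Data A) : Qcoh A where
  obj :=
    { obj := fun i => D.V i.unop
      map := fun {j i} h => ModuleCat.ofHom
        (Y := (restrictRight (phi A.alg h)).obj (D.V i.unop))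
        { toFun := fun m => D.r (leOfHom h.unop) m
          map_add' := fun m m' => map_add _ m m'
          map_smul' := fun a m => D.r_smul (leOfHom h.unop) a.unop m }
      map_id := fun i => by
        ext m
        exact D.r_self i.unop m
      map_comp := fun {l j i} g h => by
        ext m
        exact (D.r_r (leOfHom h.unop) (leOfHom g.unop) m).symm }
  property i j h := by
    refine (ConcreteCategory.isIso_iff_bijective _).2 ?_
    exact D.bijective h.le (RightTensor.lift (A.res h.le) (D.r h.le) (D.r_smul h.le)).toAddMonoidHom
      (fun m a => RightTensor.lift_tmul (A.res h.le) (D.r h.le) (D.r_smul h.le) m a)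

section Exactness

instance (i : I) : (comp A i).Additive where
  map_add := rfl

instance (i : I) : PreservesFiniteLimits (comp A i) := by
  have : PreservesFiniteLimits (isQuasiCoherent A).ι :=
    have := (isQuasiCoherent A).preservesKernels_ι
    Functor.preservesFiniteLimits_of_preservesKernels _
  exact comp_preservesFiniteLimits _ _

instance (i : I) : PreservesFiniteColimits (comp A i) := by
  have : PreservesFiniteColimits (isQuasiCoherent A).ι :=
    have := (isQuasiCoherent A).preservesCokernels_ι
    Functor.preservesFiniteColimits_of_preservesCokernels _
  exact comp_preservesFiniteColimits _ _

lemma isIso_iff {M N : Qcoh A} (f : M ⟶ N) : IsIso f ↔ ∀ i, Function.Bijective (app f i) := by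
  refine ⟨fun _ i => (ConcreteCategory.bijective_of_isIso ((comp A i).map f) :), fun h => ?_⟩
  let e (i : I) := LinearEquiv.ofBijective (app f i) (h i)
  refine ⟨homMk (fun i => (e i).symm.toLinearMap) (fun i j hij m => ?_), ?_, ?_⟩
  · apply (e i).injective
    refine ((e i).apply_symm_apply _).trans (Eq.trans ?_ (app_res f hij _).symm)
    exact congrArg _ ((e j).apply_symm_apply m).symm
  · exact hom_ext fun i x => (e i).symm_apply_apply x
  · exact hom_ext fun i x => (e i).apply_symm_apply x

lemma epi_iff {M N : Qcoh A} (f : M ⟶ N) : Epi f ↔ ∀ i, Function.Surjective (app f i) := by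
  refine ⟨fun _ i => (ModuleCat.epi_iff_surjective ((comp A i).map f)).1 inferInstance,
    fun h => ⟨fun g g' hg => hom_ext fun i x => ?_⟩⟩
  obtain ⟨x, rfl⟩ := h i x
  rw [← app_comp, hg, app_comp]

lemma mono_iff {M N : Qcoh A} (f : M ⟶ N) : Mono f ↔ ∀ i, Function.Injective (app f i) := by
  refine ⟨fun _ i => (ModuleCat.mono_iff_injective ((comp A i).map f)).1 inferInstance,
    fun h => ⟨fun g g' hg => hom_ext fun i x => h i ?_⟩⟩
  rw [← app_comp, hg, app_comp]

lemma isZero_iff (M : Qcoh A) : IsZero M ↔ ∀ i, Subsingleton (M.sec i) := by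
  refine ⟨fun h i => ModuleCat.subsingleton_of_isZero ((comp A i).map_isZero h), fun h => ?_⟩
  rw [IsZero.iff_id_eq_zero]
  exact hom_ext fun i x => (h i).elim _ _

/-- The component functors are exact, so they commute with homology, and together they detect zero
objects. -/
lemma exact_iff (S : ShortComplex (Qcoh A)) :
    S.Exact ↔ ∀ i, Function.Exact (app S.f i) (app S.g i) := by
  have h1 (i : I) : Function.Exact (app S.f i) (app S.g i) ↔ (S.map (comp A i)).Exact :=
    (ShortComplex.ShortExact.moduleCat_exact_iff_function_exact (S.map (comp A i))).symm
  simp only [h1]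
  refine ⟨fun h i => h.map (comp A i), fun h => ?_⟩
  rw [ShortComplex.exact_iff_isZero_homology, isZero_iff]
  intro i
  have := (ShortComplex.exact_iff_isZero_homology _).1 (h i)
  exact ModuleCat.subsingleton_of_isZero (this.of_iso (S.mapHomologyIso (comp A i)).symm)

lemma shortExact_iff (S : ShortComplex (Qcoh A)) :
    S.ShortExact ↔ ∀ i, Function.Injective (app S.f i) ∧ Function.Surjective (app S.g i) ∧
      Function.Exact (app S.f i) (app S.g i) := by
  refine ⟨fun h i => ⟨(mono_iff _).1 h.mono_f i, (epi_iff _).1 h.epi_g i,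
    (exact_iff _).1 h.exact i⟩, fun h => ?_⟩
  have : Mono S.f := (mono_iff _).2 fun i => (h i).1
  have : Epi S.g := (epi_iff _).2 fun i => (h i).2.1
  exact ⟨(exact_iff _).2 fun i => (h i).2.2⟩

end Exactness

end Qcoh

/-- W ⊗_S T = W ⊗_{S'} T' = V when S' ⊗_S T = T'. This is why both the T_i and restriction of
scalars preserve quasi-coherence. -/
lemma RightTensor.bijective_of_squareMap_of_glue {S T S' T' : Type u} [Ring S] [Ring T] [Ring S']
    [Ring T'] {f : S →+* T} {f' : S' →+* T'} {a : S →+* S'} {b : T →+* T'}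
    {comm : ∀ s, b (f s) = f' (a s)} (h : Function.Bijective (squareMap f f' a b comm))
    (W : ModuleCat.{u} S'ᵐᵒᵖ) {V : Type u} [AddCommGroup V] [Module T'ᵐᵒᵖ V]
    (g : RightTensor f' W →ₗ[T'ᵐᵒᵖ] V) (hg : Function.Bijective g)
    (q : RightTensor f ((restrictRight a).obj W) →+ V)
    (hq : ∀ (w : W) (t : T),
      q (tmul f (M := (restrictRight a).obj W) w t) = g (tmul f' w (b t))) :
    Function.Bijective q := by
  let e := LinearEquiv.ofBijective g hg
  have h1 := bijective_of_squareMap h W (e.symm.toLinearMap.toAddMonoidHom.comp q) (fun w t => by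
    apply e.injective
    exact (e.apply_symm_apply _).trans (hq w t))
  have h2 : ⇑(e.symm.toLinearMap.toAddMonoidHom.comp q) = e.symm ∘ q := rfl
  rw [h2] at h1
  exact (Function.Bijective.of_comp_iff' e.symm.bijective q).1 h1

open RightTensor in
-- S₀ ⊗_S T = T / J T = T₀, with J generated by the r_j: every tensor is of the form 1 ⊗ t, and r_j
-- moves across the tensor sign to act on S₀ by zero.
lemma IsReduction.bijective_squareMap_reduction {K : Type*} [CommRing K] {b : ℕ} {r : Fin b → K}
    {S T S₀ T₀ : Type u} [Ring S] [Ring T] [Ring S₀] [Ring T₀] {f : S →+* T} {f₀ : S₀ →+* T₀}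
    {θS : K →+* S} {θT : K →+* T} {πS : S →+* S₀} {πT : T →+* T₀} (hS : IsReduction r θS πS)
    (hT : IsReduction r θT πT) (hθ : ∀ c, f (θS c) = θT c) (comm : ∀ s, πT (f s) = f₀ (πS s)) :
    Function.Bijective (RightTensor.squareMap f f₀ πS πT comm) := by
  constructor
  · rw [injective_iff_map_eq_zero]
    intro x hx
    have h1 (x : RightTensor f (restrictedRing πS)) :
        ∃ t, x = RightTensor.tmul f (M := restrictedRing πS) (1 : S₀) t := by
      induction x using RightTensor.induction with
      | zero => exact ⟨0, (RightTensor.tmul_zero f (M := restrictedRing πS) _).symm⟩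
      | add x y hx hy =>
        obtain ⟨t, rfl⟩ := hx
        obtain ⟨t', rfl⟩ := hy
        exact ⟨t + t', (RightTensor.tmul_add_right f (M := restrictedRing πS) _ _ _).symm⟩
      | tmul s t =>
        obtain ⟨s, rfl⟩ := hS.surjective s
        refine ⟨f s * t, Eq.trans ?_ (RightTensor.tmul_balanced f (M := restrictedRing πS)
          (1 : S₀) s t)⟩
        exact congrArg (RightTensor.tmul f (M := restrictedRing πS) · t) (one_mul (πS s)).symm
    obtain ⟨t, rfl⟩ := h1 x
    rw [RightTensor.squareMap_tmul, map_one, one_mul] at hx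
    obtain ⟨y, rfl⟩ := hT.exists_of_map_eq_zero t hx
    refine (RightTensor.tmul_sum f (M := restrictedRing πS) _ _ _).trans
      (Finset.sum_eq_zero fun j _ => ?_)
    rw [← hθ]
    refine (RightTensor.tmul_balanced f (M := restrictedRing πS) (1 : S₀) (θS (r j)) (y j)).symm.trans
      (Eq.trans ?_ (RightTensor.zero_tmul f (M := restrictedRing πS) (y j)))
    refine congrArg (RightTensor.tmul f (M := restrictedRing πS) · (y j)) ?_
    exact (congrArg ((1 : S₀) * ·) (hS.map_eq_zero j)).trans (mul_zero _)
  · intro t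
    obtain ⟨t, rfl⟩ := hT.surjective t
    refine ⟨RightTensor.tmul f (M := restrictedRing πS) (1 : S₀) t, ?_⟩
    rw [RightTensor.squareMap_tmul, map_one, one_mul]

lemma CategoryTheory.Functor.exact_of_shortExact {C D : Type*} [Category* C] [Category* D]
    [Abelian C] [Abelian D] (F : C ⥤ D) [F.Additive]
    (h : ∀ S : ShortComplex C, S.ShortExact → (S.map F).ShortExact) :
    PreservesFiniteLimits F ∧ PreservesFiniteColimits F :=
  ((Functor.exact_tfae F).out 0 3).1 h

namespace Qcoh

variable {K : Type v} [CommRing K] {I : Type w} [SemilatticeInf I] {A : NCScheme.{u} K I}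

/-! ### The functors T_i. -/

section Localize

variable [A.HasCartesianIntersections] (i : I)

/-- The module `T_i M` with components `M_{l ∩ i}`, the direct image of the restriction of `M` to
the chart `i`. -/
noncomputable def localizeObj (M : Qcoh A) : Qcoh A :=
  Data.toQcoh
    { V := fun l => (restrictRight (A.res (inf_le_left : l ⊓ i ≤ l))).obj (M.sec (l ⊓ i))
      r := fun l j h => M.res (inf_le_inf_right i h)
      r_smul := fun l j h a m => by
        refine (M.res_smul (inf_le_inf_right i h) (A.res inf_le_left a) m).trans ?_
        rw [A.res_res, ← A.res_res inf_le_left h]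
        rfl
      r_self := fun l m => M.res_self (inf_le_inf_right i le_rfl) (show M.sec (l ⊓ i) from m)
      r_r := fun l j n h h' m => M.res_res (inf_le_inf_right i h) (inf_le_inf_right i h')
        (show M.sec (n ⊓ i) from m)
      -- Here A_{j ∩ i} ⊗_{A_j} A_l = A_{l ∩ i} for l ≤ j, combined with the gluing of M from j ∩ i
      -- to l ∩ i.
      bijective := fun l j h q hq => by
        refine RightTensor.bijective_of_squareMap_of_glue
          (NCScheme.HasCartesianIntersections.bijective (A := A) (inf_le_left : j ⊓ i ≤ j) h
            (inf_le_inf_right i h) inf_le_left ?_) (M.sec (j ⊓ i))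
          (M.glue (inf_le_inf_right i h)) (M.bijective_glue _) q hq
        exact le_inf inf_le_right (inf_le_left.trans inf_le_right) }

/-- An element of `M_{l ∩ i}` as an element of `(T_i M)_l`. -/
noncomputable def localizeEquiv (M : Qcoh A) (l : I) : M.sec (l ⊓ i) ≃+ (localizeObj i M).sec l :=
  AddEquiv.refl _

lemma localizeEquiv_smul (M : Qcoh A) (l : I) (a : A.ring l) (m : M.sec (l ⊓ i)) :
    localizeEquiv i M l (op (A.res (inf_le_left : l ⊓ i ≤ l) a) • m) = op a • localizeEquiv i M l m := rfl

/-- The functor `M ↦ T_i M`. -/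
noncomputable def localize : Qcoh A ⥤ Qcoh A where
  obj M := localizeObj i M
  map {M N} f := homMk (fun l => ((restrictRight (A.res (inf_le_left : l ⊓ i ≤ l))).map
    ((comp A (l ⊓ i)).map f)).hom) (fun l j h m => app_res f (inf_le_inf_right i h) m)
  map_id M := rfl
  map_comp f g := rfl

instance : (localize (A := A) i).Additive where
  map_add := rfl

lemma exact_localize : PreservesFiniteLimits (localize (A := A) i) ∧
    PreservesFiniteColimits (localize (A := A) i) :=
  Functor.exact_of_shortExact _ fun S hS => by
    refine (shortExact_iff (S.map (localize i))).2 fun l => ?_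
    have h := (shortExact_iff S).1 hS (l ⊓ i)
    refine ⟨fun x y hxy => ?_, fun y => ?_, fun y => ?_⟩
    · exact h.1 hxy
    · exact h.2.1 y
    · exact h.2.2 y

instance : PreservesFiniteLimits (localize (A := A) i) := (exact_localize i).1

instance : PreservesFiniteColimits (localize (A := A) i) := (exact_localize i).2

/-- The restriction maps `M_l → M_{l ∩ i}`. -/
noncomputable def toLocalize : 𝟭 (Qcoh A) ⟶ localize i where
  app M := homMk
    (fun l =>
      { toFun := fun m => localizeEquiv i M l (M.res inf_le_left m)
        map_add' := fun m m' => congrArg (localizeEquiv i M l) (map_add (M.res inf_le_left) m m')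
        map_smul' := fun a m => congrArg (localizeEquiv i M l) (M.res_smul inf_le_left a.unop m) })
    (fun l j h m => congrArg (localizeEquiv i M l)
      ((M.res_res _ _ m).trans (M.res_res _ _ m).symm))
  naturality M N f := hom_ext fun l m =>
    (congrArg (localizeEquiv i N l) (app_res f inf_le_left m)).symm

lemma bijective_app_toLocalize (M : Qcoh A) {l : I} (h : l ≤ i) :
    Function.Bijective (app ((toLocalize i).app M) l) :=
  M.bijective_res (inf_le_left : l ⊓ i ≤ l) (le_inf le_rfl h)

/-- T_i is idempotent, as (l ∩ i) ∩ i = l ∩ i. -/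
instance (M : Qcoh A) : IsIso ((toLocalize i).app ((localize i).obj M)) :=
  (isIso_iff _).2 fun l => M.bijective_res
    (inf_le_inf_right i (inf_le_left : l ⊓ i ≤ l)) (le_inf le_rfl inf_le_right)

end Localize

/-! ### The action of the base ring on morphisms. -/

section Linear

/-- The action of `K` on `M_i`. -/
lemma app_smul_comm (c : K) (M : Qcoh A) (i : I) (a : (A.ring i)ᵐᵒᵖ) (x : M.sec i) :
    op (algebraMap K (A.ring i) c) • a • x = a • op (algebraMap K (A.ring i) c) • x := by
  rw [← mul_smul, ← mul_smul]
  congr 1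
  exact unop_injective (Algebra.commutes c a.unop).symm

noncomputable instance (M N : Qcoh A) : SMul K (M ⟶ N) where
  smul c f := homMk
    (fun i =>
      { toFun := fun x => op (algebraMap K (A.ring i) c) • app f i x
        map_add' := fun x y => by rw [map_add, smul_add]
        map_smul' := fun a x => by rw [map_smul, app_smul_comm, RingHom.id_apply] })
    (fun i j h m => by
      change op (algebraMap K (A.ring i) c) • app f i (M.res h m) =
        N.res h (op (algebraMap K (A.ring j) c) • app f j m)
      rw [res_smul, app_res, A.res_algebraMap])

lemma app_smul {M N : Qcoh A} (c : K) (f : M ⟶ N) (i : I) (x : M.sec i) :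
    app (c • f) i x = op (algebraMap K (A.ring i) c) • app f i x := rfl

/-- This lets matrices with entries in K act on finite powers of modules and of complexes. -/
noncomputable instance : Linear K (Qcoh A) where
  homModule M N :=
    { one_smul := fun f => hom_ext fun i x => by
        rw [app_smul, map_one, op_one, one_smul]
      mul_smul := fun c d f => hom_ext fun i x => by
        rw [app_smul, app_smul, app_smul, ← mul_smul, ← op_mul, ← map_mul, mul_comm]
      smul_zero := fun c => hom_ext fun i x => by
        rw [app_smul, app_zero, smul_zero]
      smul_add := fun c f g => hom_ext fun i x => by
        rw [app_smul, app_add, app_add, smul_add, app_smul, app_smul]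
      add_smul := fun c d f => hom_ext fun i x => by
        rw [app_smul, app_add, map_add, MulOpposite.op_add, add_smul, app_smul, app_smul]
      zero_smul := fun f => hom_ext fun i x => by
        rw [app_smul, app_zero, map_zero, MulOpposite.op_zero, zero_smul] }
  smul_comp M N P c f g := hom_ext fun i x => map_smul (app g i) _ _
  comp_smul M N P f c g := hom_ext fun i x => rfl

end Linear

/-! ### Base change of quasi-coherent modules and its right adjoint. -/

section BaseChange

variable {K' : Type v'} [CommRing K'] {A' : NCScheme.{u} K' I}
  (β : A.alg ⋙ forget₂ (AlgCat.{u} K) RingCat.{u} ⟶ A'.alg ⋙ forget₂ (AlgCat.{u} K') RingCat.{u})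

/-- The homomorphism `β_i : A_i → A'_i`. -/
noncomputable abbrev coeffHom (i : I) : A.ring i →+* A'.ring i := betaHom β (Opposite.op i)

lemma coeffHom_res {i j : I} (h : i ≤ j) (a : A.ring j) :
    coeffHom β i (A.res h a) = A'.res h (coeffHom β j a) :=
  (betaHom_comm β (homOfLE h).op a).symm

/-- The elements `m ⊗ a` of `M ⊗_A A'`. -/
noncomputable def tmulCoeff (M : Qcoh A) (i : I) (m : M.sec i) (a : A'.ring i) :
    (baseChangeQcoh β M).sec i :=
  RightTensor.tmul (coeffHom β i) m a

lemma res_tmulCoeff (M : Qcoh A) {i j : I} (h : i ≤ j) (m : M.sec j) (a : A'.ring j) :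
    (baseChangeQcoh β M).res h (tmulCoeff β M j m a) =
      tmulCoeff β M i (M.res h m) (A'.res h a) :=
  extendRightSquare_tmul (coeffHom β j) (coeffHom β i) (A.res h) (A'.res h)
    (betaHom_comm β (homOfLE h).op) (compMap M.obj (homOfLE h).op) m a

lemma baseChange_induction (M : Qcoh A) (i : I) {p : (baseChangeQcoh β M).sec i → Prop}
    (zero : p 0) (add : ∀ x y, p x → p y → p (x + y)) (tmul : ∀ m a, p (tmulCoeff β M i m a))
    (x : (baseChangeQcoh β M).sec i) : p x := by
  change RightTensor (coeffHom β i) (M.sec i) at x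
  induction x using RightTensor.induction with
  | zero => exact zero
  | add x y hx hy => exact add x y hx hy
  | tmul m a => exact tmul m a

lemma tmulCoeff_add (M : Qcoh A) (i : I) (m m' : M.sec i) (a : A'.ring i) :
    tmulCoeff β M i (m + m') a = tmulCoeff β M i m a + tmulCoeff β M i m' a :=
  RightTensor.tmul_add_left (coeffHom β i) m m' a

lemma tmulCoeff_smul (M : Qcoh A) (i : I) (b : A.ring i) (m : M.sec i) (a : A'.ring i) :
    tmulCoeff β M i (op b • m) a = tmulCoeff β M i m (coeffHom β i b * a) :=
  RightTensor.tmul_balanced (coeffHom β i) m b a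

lemma op_smul_tmulCoeff (M : Qcoh A) (i : I) (m : M.sec i) (a b : A'.ring i) :
    op b • tmulCoeff β M i m a = tmulCoeff β M i m (a * b) :=
  RightTensor.op_smul_tmul (coeffHom β i) m a b

/-- The homomorphism from `M_i ⊗_{A_i} A'_i` given by a semilinear map from `M_i`. -/
noncomputable def liftCoeff (M : Qcoh A) (i : I) {P : Type u} [AddCommGroup P]
    [Module (A'.ring i)ᵐᵒᵖ P] (g : M.sec i →+ P)
    (hg : ∀ (a : A.ring i) (m : M.sec i), g (op a • m) = op (coeffHom β i a) • g m) :
    (baseChangeQcoh β M).sec i →ₗ[(A'.ring i)ᵐᵒᵖ] P :=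
  RightTensor.lift (coeffHom β i) g hg

lemma liftCoeff_tmulCoeff (M : Qcoh A) (i : I) {P : Type u} [AddCommGroup P]
    [Module (A'.ring i)ᵐᵒᵖ P] (g : M.sec i →+ P)
    (hg : ∀ (a : A.ring i) (m : M.sec i), g (op a • m) = op (coeffHom β i a) • g m)
    (m : M.sec i) (a : A'.ring i) :
    liftCoeff β M i g hg (tmulCoeff β M i m a) = op a • g m :=
  RightTensor.lift_tmul (coeffHom β i) g hg m a

lemma baseChange_addHom_ext (M : Qcoh A) (i : I) {P : Type*} [AddCommGroup P]
    {g g' : (baseChangeQcoh β M).sec i →+ P}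
    (H : ∀ m a, g (tmulCoeff β M i m a) = g' (tmulCoeff β M i m a)) : g = g' := by
  ext x
  induction x using baseChange_induction with
  | zero => rw [map_zero, map_zero]
  | add x y hx hy => rw [map_add, map_add, hx, hy]
  | tmul m a => exact H m a

lemma baseChange_hom_ext {M : Qcoh A} {N : Qcoh A'} {f g : baseChangeQcoh β M ⟶ N}
    (H : ∀ i m a, app f i (tmulCoeff β M i m a) = app g i (tmulCoeff β M i m a)) : f = g :=
  hom_ext fun i x => DFunLike.congr_fun (baseChange_addHom_ext β M i
    (g := (app f i).toAddMonoidHom) (g' := (app g i).toAddMonoidHom) (H i)) x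

/-- The homomorphism from `M ⊗_A A'` given by semilinear maps from the modules `M_i`. -/
noncomputable def baseChangeLift (M : Qcoh A) (N : Qcoh A') (g : ∀ i, M.sec i →+ N.sec i)
    (hg : ∀ i (a : A.ring i) (m : M.sec i), g i (op a • m) = op (coeffHom β i a) • g i m)
    (hg' : ∀ ⦃i j : I⦄ (h : i ≤ j) (m : M.sec j), g i (M.res h m) = N.res h (g j m)) :
    baseChangeQcoh β M ⟶ N :=
  homMk (fun i => liftCoeff β M i (g i) (hg i)) (fun i j h => DFunLike.congr_fun
    (baseChange_addHom_ext β M j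
      (g := (liftCoeff β M i (g i) (hg i)).toAddMonoidHom.comp ((baseChangeQcoh β M).res h))
      (g' := (N.res h).comp (liftCoeff β M j (g j) (hg j)).toAddMonoidHom) (fun m a => by
        refine (congrArg (liftCoeff β M i (g i) (hg i)) (res_tmulCoeff β M h m a)).trans ?_
        rw [liftCoeff_tmulCoeff, hg', ← res_smul]
        exact congrArg (N.res h) (liftCoeff_tmulCoeff β M j (g j) (hg j) m a).symm)))

lemma app_baseChangeLift (M : Qcoh A) (N : Qcoh A') (g : ∀ i, M.sec i →+ N.sec i)
    (hg : ∀ i (a : A.ring i) (m : M.sec i), g i (op a • m) = op (coeffHom β i a) • g i m)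
    (hg' : ∀ ⦃i j : I⦄ (h : i ≤ j) (m : M.sec j), g i (M.res h m) = N.res h (g j m)) (i : I)
    (m : M.sec i) (a : A'.ring i) :
    app (baseChangeLift β M N g hg hg') i (tmulCoeff β M i m a) = op a • g i m :=
  liftCoeff_tmulCoeff β M i (g i) (hg i) m a

/-- The homomorphism `M_i → M_i ⊗_{A_i} A'_i`. -/
noncomputable def toBaseChange (M : Qcoh A) (i : I) : M.sec i →+ (baseChangeQcoh β M).sec i :=
  AddMonoidHom.mk' (fun m => tmulCoeff β M i m 1) (fun m m' => tmulCoeff_add β M i m m' 1)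

lemma toBaseChange_smul (M : Qcoh A) (i : I) (a : A.ring i) (m : M.sec i) :
    toBaseChange β M i (op a • m) = op (coeffHom β i a) • toBaseChange β M i m := by
  refine (tmulCoeff_smul β M i a m 1).trans (Eq.trans ?_ (op_smul_tmulCoeff β M i m 1 _).symm)
  rw [mul_one, one_mul]

lemma res_toBaseChange (M : Qcoh A) {i j : I} (h : i ≤ j) (m : M.sec j) :
    toBaseChange β M i (M.res h m) = (baseChangeQcoh β M).res h (toBaseChange β M j m) :=
  Eq.trans (by rw [map_one]; rfl) (res_tmulCoeff β M h m 1).symm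

/-- The homomorphism `M ⊗_A A' → N ⊗_A A'` induced by `f : M → N`. -/
noncomputable def baseChangeMap {M N : Qcoh A} (f : M ⟶ N) :
    baseChangeQcoh β M ⟶ baseChangeQcoh β N :=
  baseChangeLift β M (baseChangeQcoh β N)
    (fun i => (toBaseChange β N i).comp (app f i).toAddMonoidHom)
    (fun i a m => (congrArg (toBaseChange β N i) (map_smul (app f i) (op a) m)).trans
      (toBaseChange_smul β N i a _))
    (fun i j h m => (congrArg (toBaseChange β N i) (app_res f h m)).trans
      (res_toBaseChange β N h _))

lemma app_baseChangeMap {M N : Qcoh A} (f : M ⟶ N) (i : I) (m : M.sec i) (a : A'.ring i) :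
    app (baseChangeMap β f) i (tmulCoeff β M i m a) = tmulCoeff β N i (app f i m) a :=
  (app_baseChangeLift β M (baseChangeQcoh β N)
    (fun i => (toBaseChange β N i).comp (app f i).toAddMonoidHom) _ _ i m a).trans
    ((op_smul_tmulCoeff β N i (app f i m) 1 a).trans
      (congrArg (tmulCoeff β N i (app f i m)) (one_mul a)))

/-- The functor `M ↦ M ⊗_A A'`. -/
noncomputable def baseChange : Qcoh A ⥤ Qcoh A' where
  obj M := baseChangeQcoh β M
  map f := baseChangeMap β f
  map_id M := baseChange_hom_ext β fun i m a => app_baseChangeMap β (𝟙 M) i m a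
  map_comp f g := baseChange_hom_ext β fun i m a => by
    rw [app_comp, app_baseChangeMap, app_baseChangeMap, app_baseChangeMap, app_comp]

instance : (baseChange β).Additive where
  map_add {M N f g} := baseChange_hom_ext β fun i m a => by
    change app (baseChangeMap β (f + g)) i _ = app (baseChangeMap β f + baseChangeMap β g) i _
    rw [app_add, app_baseChangeMap, app_baseChangeMap, app_baseChangeMap, app_add, tmulCoeff_add]

variable (hβ : ∀ ⦃i j : I⦄ (h : i ≤ j), Function.Bijective (RightTensor.squareMap (A.res h)
  (A'.res h) (coeffHom β j) (coeffHom β i) (coeffHom_res β h)))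

/-- A quasi-coherent module on `A'`, regarded as a quasi-coherent module on `A`. -/
noncomputable def restrictCoeffObj (N : Qcoh A') : Qcoh A :=
  Data.toQcoh
    { V := fun i => (restrictRight (coeffHom β i)).obj (N.sec i)
      r := fun i j h => N.res h
      r_smul := fun i j h a m => by
        refine (N.res_smul h (coeffHom β j a) m).trans ?_
        rw [← coeffHom_res]
        rfl
      r_self := fun i m => N.res_self le_rfl (show N.sec i from m)
      r_r := fun i j l h h' m => N.res_res h h' (show N.sec l from m)
      bijective := fun i j h q hq =>
        RightTensor.bijective_of_squareMap_of_glue (hβ h) (N.sec j) (N.glue h)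
          (N.bijective_glue h) q hq }

/-- An element of a module on `A'` as an element of the corresponding module on `A`. -/
noncomputable def restrictCoeffEquiv (N : Qcoh A') (i : I) :
    N.sec i ≃+ (restrictCoeffObj β hβ N).sec i :=
  AddEquiv.refl _

/-- The restriction of scalars along `A → A'`. -/
noncomputable def restrictCoeff : Qcoh A' ⥤ Qcoh A where
  obj N := restrictCoeffObj β hβ N
  map {M N} f := homMk (fun i => ((restrictRight (coeffHom β i)).map ((comp A' i).map f)).hom)
    (fun i j h m => app_res f h m)
  map_id M := rfl
  map_comp f g := rfl

instance : (restrictCoeff β hβ).Additive where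
  map_add := rfl

lemma exact_restrictCoeff : PreservesFiniteLimits (restrictCoeff β hβ) ∧
    PreservesFiniteColimits (restrictCoeff β hβ) :=
  Functor.exact_of_shortExact _ fun S hS => (shortExact_iff _).2 fun i =>
    have h := (shortExact_iff _).1 hS i
    ⟨fun x y hxy => h.1 hxy, fun y => h.2.1 y, fun y => h.2.2 y⟩

instance : PreservesFiniteLimits (restrictCoeff β hβ) := (exact_restrictCoeff β hβ).1

instance : PreservesFiniteColimits (restrictCoeff β hβ) := (exact_restrictCoeff β hβ).2

/-- The homomorphism `M → N` corresponding to `M ⊗_A A' → N`. -/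
noncomputable def baseChangeAdj {M : Qcoh A} {N : Qcoh A'} (f : baseChangeQcoh β M ⟶ N) :
    M ⟶ restrictCoeffObj β hβ N :=
  homMk
    (fun i =>
      { toFun := fun m => restrictCoeffEquiv β hβ N i (app f i (toBaseChange β M i m))
        map_add' := fun m m' => congrArg (restrictCoeffEquiv β hβ N i)
          ((congrArg (app f i) (map_add (toBaseChange β M i) m m')).trans
            (map_add (app f i) _ _))
        map_smul' := fun a m => congrArg (restrictCoeffEquiv β hβ N i)
          ((congrArg (app f i) (toBaseChange_smul β M i a.unop m)).trans
            (map_smul (app f i) _ _)) })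
    (fun i j h m => congrArg (restrictCoeffEquiv β hβ N i)
      ((congrArg (app f i) (res_toBaseChange β M h m)).trans (app_res f h _)))

lemma app_baseChangeAdj {M : Qcoh A} {N : Qcoh A'} (f : baseChangeQcoh β M ⟶ N) (i : I)
    (m : M.sec i) : app (baseChangeAdj β hβ f) i m =
      restrictCoeffEquiv β hβ N i (app f i (tmulCoeff β M i m 1)) := rfl

/-- The homomorphism `M ⊗_A A' → N` corresponding to `M → N`. -/
noncomputable def baseChangeAdjSymm {M : Qcoh A} {N : Qcoh A'} (g : M ⟶ restrictCoeffObj β hβ N) :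
    baseChangeQcoh β M ⟶ N :=
  baseChangeLift β M N
    (fun i => (restrictCoeffEquiv β hβ N i).symm.toAddMonoidHom.comp (app g i).toAddMonoidHom)
    (fun i a m => congrArg (restrictCoeffEquiv β hβ N i).symm (map_smul (app g i) (op a) m))
    (fun i j h m => congrArg (restrictCoeffEquiv β hβ N i).symm (app_res g h m))

lemma app_baseChangeAdjSymm {M : Qcoh A} {N : Qcoh A'} (g : M ⟶ restrictCoeffObj β hβ N) (i : I)
    (m : M.sec i) (a : A'.ring i) : app (baseChangeAdjSymm β hβ g) i (tmulCoeff β M i m a) =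
      op a • (restrictCoeffEquiv β hβ N i).symm (app g i m) :=
  app_baseChangeLift β M N
    (fun i => (restrictCoeffEquiv β hβ N i).symm.toAddMonoidHom.comp (app g i).toAddMonoidHom)
    _ _ i m a

/-- The homomorphisms `M ⊗_A A' → N` are the homomorphisms `M → N`. -/
noncomputable def baseChangeHomEquiv (M : Qcoh A) (N : Qcoh A') :
    (baseChangeQcoh β M ⟶ N) ≃ (M ⟶ restrictCoeffObj β hβ N) where
  toFun := baseChangeAdj β hβ
  invFun := baseChangeAdjSymm β hβ
  left_inv f := baseChange_hom_ext β fun i m a => by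
    rw [app_baseChangeAdjSymm, app_baseChangeAdj, AddEquiv.symm_apply_apply, ← map_smul,
      op_smul_tmulCoeff, one_mul]
  right_inv g := hom_ext fun i m => by
    rw [app_baseChangeAdj, app_baseChangeAdjSymm, op_one, one_smul, AddEquiv.apply_symm_apply]

/-- The base change is left adjoint to the restriction of scalars. -/
noncomputable def baseChangeAdjunction : baseChange β ⊣ restrictCoeff β hβ :=
  Adjunction.mkOfHomEquiv
    { homEquiv := baseChangeHomEquiv β hβ
      homEquiv_naturality_left_symm := fun {M M' N} f g => baseChange_hom_ext β fun i m a => by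
        have h := congrArg (app (baseChangeAdjSymm β hβ g) i) (app_baseChangeMap β f i m a)
        refine Eq.trans ?_ (h.trans (app_baseChangeAdjSymm β hβ g i (app f i m) a)).symm
        exact app_baseChangeAdjSymm β hβ (M := M) (N := N) (f ≫ g) i m a
      homEquiv_naturality_right := fun f g => rfl }

lemma app_baseChangeAdjunction_unit (M : Qcoh A) (i : I) (m : M.sec i) :
    app ((baseChangeAdjunction β hβ).unit.app M) i m =
      restrictCoeffEquiv β hβ (baseChangeQcoh β M) i (tmulCoeff β M i m 1) := by
  simp only [baseChangeAdjunction, Adjunction.mkOfHomEquiv_unit_app]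
  rfl

end BaseChange

end Qcoh

lemma IsMatrixFlat.of_addEquiv {K : Type*} [CommRing K] {B B' : Type*} [Ring B] [Ring B']
    {θ : K →+* B} {θ' : K →+* B'} {W W' : Type*} [AddCommGroup W] [Module B W] [AddCommGroup W']
    [Module B' W'] (e : W ≃+ W') (he : ∀ c w, e (θ c • w) = θ' c • e w) (h : IsMatrixFlat θ W) :
    IsMatrixFlat θ' W' := by
  intro l m n D' D hD x hx
  obtain ⟨y, hy⟩ := h D' D hD (fun i => e.symm (x i)) (fun j => e.injective (by
    simp only [map_sum, he, e.apply_symm_apply, hx, map_zero]))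
  refine ⟨fun k => e (y k), fun i => ?_⟩
  rw [← e.apply_symm_apply (x i), hy, map_sum]
  simp only [he]

lemma IsMatrixFlat.finsupp {K : Type*} [CommRing K] {B : Type*} [Ring B]
    {θ : K →+* B} {W : Type*} [AddCommGroup W] [Module B W] (h : IsMatrixFlat θ W) (S : Type*) :
    IsMatrixFlat θ (S →₀ W) := by
  classical
  intro l m n D' D hD x hx
  choose y hy using fun s => h D' D hD (fun i => x i s) (fun j => by
    simpa using DFunLike.congr_fun (hx j) s)
  -- The coordinatewise solutions are set to zero outside the finitely many coordinates in which
  -- some x_i is nonzero, so as to have finite support.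
  let T : Finset S := Finset.univ.biUnion fun i => (x i).support
  refine ⟨fun k => Finsupp.onFinset T (fun s => if s ∈ T then y s k else 0)
    (fun s hs => by by_contra hsT; exact hs (if_neg hsT)), fun i => ?_⟩
  ext s
  rw [Finsupp.finsetSum_apply]
  simp only [Finsupp.smul_apply, Finsupp.onFinset_apply]
  by_cases hs : s ∈ T
  · simp only [if_pos hs]
    exact hy s i
  · simp only [if_neg hs, smul_zero, Finset.sum_const_zero]
    by_contra hx0
    exact hs (Finset.mem_biUnion.2 ⟨i, Finset.mem_univ i, Finsupp.mem_support_iff.2 hx0⟩)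

/-- A minimal element of the complement can be added. This drives the inductions over charts: for l
∈ D the intersection l ∩ i is again in D. -/
lemma IsLowerSet.exists_insert {I : Type*} [PartialOrder I] [Finite I] {D : Set I}
    (hD : IsLowerSet D) {n : ℕ} (hn : Dᶜ.ncard = n + 1) :
    ∃ i, IsLowerSet (insert i D) ∧ (insert i D)ᶜ.ncard = n := by
  obtain ⟨i, hi⟩ : ∃ i, Minimal (· ∈ Dᶜ) i :=
    (Set.toFinite Dᶜ).exists_minimal (Set.nonempty_of_ncard_ne_zero (by rw [hn]; simp))
  have hlt {l : I} (hl : l < i) : l ∈ D := by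
    by_contra h
    exact hl.not_ge (hi.2 h hl.le)
  refine ⟨i, ?_, ?_⟩
  · rintro a b hba (rfl | ha)
    · obtain hb | rfl := hba.lt_or_eq
      · exact Or.inr (hlt hb)
      · exact Or.inl rfl
    · exact Or.inr (hD hba ha)
  · rw [show (insert i D)ᶜ = Dᶜ \ {i} by ext; simp [and_comm],
      Set.ncard_sdiff_singleton_of_mem hi.1, hn]
    rfl

namespace Qcoh

variable {K : Type v} [CommRing K] {I : Type w} [SemilatticeInf I] {A : NCScheme.{u} K I}

/-! ### Modules flat over the base, and quasi-coherent flat covers. -/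

section Flat

variable (A) in
/-- The modules all of whose components are flat over `K`. -/
def isFlat : ObjectProperty (Qcoh A) := fun X =>
  ∀ i, IsMatrixFlat (IsReduction.opHom (algebraMap K (A.ring i))) (X.sec i)

instance : (isFlat A).IsClosedUnderIsomorphisms where
  of_iso e h i := (h i).of_linearEquiv ((comp A i).mapIso e).toLinearEquiv

open ZeroObject in
instance : (isFlat A).ContainsZero where
  exists_zero := ⟨0, isZero_zero _, fun i =>
    have := (isZero_iff (0 : Qcoh A)).1 (isZero_zero _) i
    IsMatrixFlat.of_subsingleton⟩

instance : (isFlat A).IsClosedUnderExtensions where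
  prop_X₂_of_shortExact {S} hS h₁ h₃ i := by
    obtain ⟨h, h', h''⟩ := (shortExact_iff S).1 hS i
    exact (h₁ i).of_exact (app S.f i) (app S.g i) h h' h'' (h₃ i)

lemma isFlat_of_isLocallyFree
    (hA : ∀ i, IsMatrixFlat (IsReduction.opHom (algebraMap K (A.ring i))) (A.ring i))
    (F : Qcoh A) (hF : isLocallyFree A F) : isFlat A F := by
  obtain ⟨n, hF⟩ := hF
  intro i
  obtain ⟨e⟩ := hF i
  exact ((hA i).finsupp (Fin n)).of_linearEquiv
    ((Finsupp.linearEquivFunOnFinite _ (A.ring i) (Fin n)).trans e.symm)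

end Flat

section Pullback

lemma pullback_ext {X Y Z : Qcoh A} {f : X ⟶ Z} {g : Y ⟶ Z} {i : I} {x y : (pullback f g).sec i}
    (h₁ : app (pullback.fst f g) i x = app (pullback.fst f g) i y)
    (h₂ : app (pullback.snd f g) i x = app (pullback.snd f g) i y) : x = y :=
  Types.ext_of_isPullback (((IsPullback.of_hasPullback f g).map (comp A i)).map
    (forget (ModuleCat.{u} (A.ring i)ᵐᵒᵖ))) h₁ h₂

lemma pullback_exists {X Y Z : Qcoh A} (f : X ⟶ Z) (g : Y ⟶ Z) {i : I} (x : X.sec i) (y : Y.sec i)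
    (h : app f i x = app g i y) : ∃ z : (pullback f g).sec i,
      app (pullback.fst f g) i z = x ∧ app (pullback.snd f g) i z = y :=
  Types.exists_of_isPullback (((IsPullback.of_hasPullback f g).map (comp A i)).map
    (forget (ModuleCat.{u} (A.ring i)ᵐᵒᵖ))) x y h

lemma bijective_app_pullback_snd {X Y Z : Qcoh A} (f : X ⟶ Z) (g : Y ⟶ Z) {i : I}
    (h : Function.Bijective (app f i)) : Function.Bijective (app (pullback.snd f g) i) := by
  have hw (z : (pullback f g).sec i) :
      app f i (app (pullback.fst f g) i z) = app g i (app (pullback.snd f g) i z) := by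
    rw [← app_comp, pullback.condition, app_comp]
  refine ⟨fun x y hxy => pullback_ext (h.1 ?_) hxy, fun y => ?_⟩
  · rw [hw, hw, hxy]
  · obtain ⟨x, hx⟩ := h.2 (app g i y)
    obtain ⟨z, -, hz⟩ := pullback_exists f g x y hx
    exact ⟨z, hz⟩

/-- A pullback of an epimorphism is an epimorphism with the same kernel. -/
lemma shortExact_pullback {X Y Z : Qcoh A} (f : X ⟶ Z) (g : Y ⟶ Z) [Epi g] :
    (ShortComplex.mk (pullback.lift 0 (kernel.ι g) (by rw [kernel.condition, zero_comp]))
      (pullback.fst f g) (pullback.lift_fst _ _ _)).ShortExact := by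
  have : Mono (pullback.lift (f := f) (g := g) 0 (kernel.ι g)
      (by rw [kernel.condition, zero_comp])) := by
    have : Mono (pullback.lift (f := f) (g := g) 0 (kernel.ι g)
      (by rw [kernel.condition, zero_comp]) ≫ pullback.snd f g) := by
      rw [pullback.lift_snd]
      infer_instance
    exact mono_of_mono _ (pullback.snd f g)
  refine (shortExact_iff _).2 fun i => ⟨(mono_iff _).1 inferInstance i,
    (epi_iff (pullback.fst f g)).1 inferInstance i, fun x => ⟨fun hx => ?_, ?_⟩⟩
  · have hk := (exact_iff _).1 (ShortComplex.exact_kernel g) i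
    have h1 : app g i (app (pullback.snd f g) i x) = 0 := by
      rw [← app_comp, ← pullback.condition, app_comp]
      exact (congrArg (app f i) hx).trans (map_zero _)
    obtain ⟨y, hy⟩ := (hk _).1 h1
    refine ⟨y, pullback_ext ?_ ?_⟩
    · refine Eq.trans ?_ hx.symm
      change app (pullback.lift (f := f) (g := g) 0 (kernel.ι g) _ ≫ pullback.fst f g) i y = 0
      rw [pullback.lift_fst, app_zero]
    · refine Eq.trans ?_ hy
      change app (pullback.lift (f := f) (g := g) 0 (kernel.ι g) _ ≫ pullback.snd f g) i y = _
      rw [pullback.lift_snd]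
  · rintro ⟨y, rfl⟩
    change app (pullback.lift (f := f) (g := g) 0 (kernel.ι g) _ ≫ pullback.fst f g) i y = 0
    rw [pullback.lift_fst, app_zero]

end Pullback

section Free

variable (A) in
/-- The free module with basis `S`. -/
noncomputable def free (S : Type u) : Qcoh A :=
  Data.toQcoh
    { V := fun i => ModuleCat.of (A.ring i)ᵐᵒᵖ (S →₀ A.ring i)
      r := fun i j h => Finsupp.mapRange.addMonoidHom (A.res h).toAddMonoidHom
      r_smul := fun i j h a m => by
        ext s
        exact map_mul (A.res h) (m s) a
      r_self := fun i m => by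
        ext s
        exact A.res_self (m s)
      r_r := fun i j l h h' m => by
        ext s
        exact A.res_res h h' (m s)
      bijective := fun i j h q hq => by
        let V : ModuleCat.{u} (A.ring j)ᵐᵒᵖ := ModuleCat.of (A.ring j)ᵐᵒᵖ (S →₀ A.ring j)
        let p : (S →₀ A.ring i) →+ RightTensor (A.res h) V :=
          Finsupp.liftAddHom fun s => AddMonoidHom.mk'
            (fun a => RightTensor.tmul (A.res h) (M := V) (Finsupp.single s 1) a)
            (fun a a' => RightTensor.tmul_add_right (A.res h) (M := V) _ _ _)
        have hq' (s : S) (b : A.ring j) (a : A.ring i) :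
            q (RightTensor.tmul (A.res h) (M := V) (Finsupp.single s b) a) =
              Finsupp.single s (A.res h b * a) := by
          refine (hq (Finsupp.single s b) a).trans ?_
          ext t
          refine (congrArg (fun z : A.ring i => z * a) (DFunLike.congr_fun
            (Finsupp.mapRange_single (f := A.res h) (hf := map_zero _) (a := s) (b := b)) t)).trans ?_
          by_cases hst : s = t
          · subst hst
            rw [Finsupp.single_eq_same, Finsupp.single_eq_same]
          · rw [Finsupp.single_eq_of_ne' hst, Finsupp.single_eq_of_ne' hst, zero_mul]
        have hp (s : S) (a : A.ring i) : p (Finsupp.single s a) =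
            RightTensor.tmul (A.res h) (M := V) (Finsupp.single s 1) a :=
          Finsupp.liftAddHom_apply_single _ s a
        refine Function.bijective_iff_has_inverse.2 ⟨p, fun x => ?_, fun x => ?_⟩
        · refine DFunLike.congr_fun (RightTensor.addHom_ext (g := p.comp q) (g' := AddMonoidHom.id _)
            fun (m : S →₀ A.ring j) a => ?_) x
          induction m using Finsupp.induction_linear with
          | zero => 
            refine (congrArg (p.comp q) (RightTensor.zero_tmul (A.res h) (M := V) a)).trans ?_
            refine Eq.trans ?_ (RightTensor.zero_tmul (A.res h) (M := V) a).symm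
            exact map_zero _
          | add m m' hm hm' =>
            refine (congrArg (p.comp q) (RightTensor.tmul_add_left (A.res h) (M := V) m m' a)).trans ?_
            refine Eq.trans ?_ (RightTensor.tmul_add_left (A.res h) (M := V) m m' a).symm
            exact (map_add _ _ _).trans (congrArg₂ (· + ·) hm hm')
          | single s b =>
            refine (congrArg p (hq' s b a)).trans ((hp _ _).trans ?_)
            refine (RightTensor.tmul_balanced (A.res h) (M := V) (Finsupp.single s 1) b a).symm.trans ?_
            refine congrArg (RightTensor.tmul (A.res h) (M := V) · a) ?_
            ext t
            by_cases hst : s = t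
            · subst hst
              simp [V]
            · simp [V, hst]
        · refine DFunLike.congr_fun (Finsupp.addHom_ext (f := q.comp p) (g := AddMonoidHom.id _)
            fun s a => ?_) x
          refine (congrArg q (hp s a)).trans ((hq' s 1 a).trans ?_)
          rw [map_one, one_mul]
          rfl }

/-- The linear combinations of basis elements as elements of the free module. -/
noncomputable def freeEquiv (S : Type u) (i : I) :
    (S →₀ A.ring i) ≃ₗ[(A.ring i)ᵐᵒᵖ] (free A S).sec i := LinearEquiv.refl _ _

lemma res_freeEquiv (S : Type u) {i j : I} (h : i ≤ j) (s : S) (a : A.ring j) :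
    (free A S).res h (freeEquiv S j (Finsupp.single s a)) =
      freeEquiv S i (Finsupp.single s (A.res h a)) :=
  Finsupp.mapRange_single (f := A.res h) (hf := map_zero _)

/-- The homomorphism from a component of a free module given by the images of the basis. -/
noncomputable def freeLift {S : Type u} {i : I} {W : ModuleCat.{u} (A.ring i)ᵐᵒᵖ} (x : S → W) :
    (free A S).sec i →ₗ[(A.ring i)ᵐᵒᵖ] W :=
  (Finsupp.lsum ℕ fun s =>
    { toFun := fun a : A.ring i => op a • x s
      map_add' := fun a b => by rw [MulOpposite.op_add, add_smul]
      map_smul' := fun c a => by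
        rw [RingHom.id_apply, ← mul_smul]
        rfl }).comp (freeEquiv S i).symm.toLinearMap

lemma freeLift_single {S : Type u} {i : I} {W : ModuleCat.{u} (A.ring i)ᵐᵒᵖ} (x : S → W) (s : S)
    (a : A.ring i) : freeLift x (freeEquiv S i (Finsupp.single s a)) = op a • x s := by
  refine (Finsupp.lsum_single ℕ _ s a).trans ?_
  rfl

lemma free_addHom_ext {S : Type u} {i : I} {P : Type*} [AddCommGroup P]
    {g g' : (free A S).sec i →+ P} (H : ∀ s a, g (freeEquiv S i (Finsupp.single s a)) =
      g' (freeEquiv S i (Finsupp.single s a))) : g = g' :=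
  Finsupp.addHom_ext (M := A.ring i) H

variable [A.HasCartesianIntersections] (i : I)

/-- The homomorphism `T_i G → T_i X` from a localized free module given by the elements of `X_i` to
which the basis is mapped. -/
noncomputable def localizeFreeLift (X : Qcoh A) {S : Type u} (x : S → X.sec i) :
    (localize i).obj (free A S) ⟶ (localize i).obj X :=
  homMk (fun l => ((restrictRight (A.res (inf_le_left : l ⊓ i ≤ l))).map (ModuleCat.ofHom
      (freeLift (W := X.sec (l ⊓ i)) fun s => X.res inf_le_right (x s)))).hom)
    (fun l j h => DFunLike.congr_fun (free_addHom_ext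
      (g := (freeLift (W := X.sec (l ⊓ i)) fun s =>
        X.res inf_le_right (x s)).toAddMonoidHom.comp ((free A S).res (inf_le_inf_right i h)))
      (g' := (X.res (inf_le_inf_right i h)).comp (freeLift (W := X.sec (j ⊓ i)) fun s =>
        X.res inf_le_right (x s)).toAddMonoidHom) (fun s a => by
        change freeLift (W := X.sec (l ⊓ i)) (fun s => X.res inf_le_right (x s))
          ((free A S).res (inf_le_inf_right i h)
            (freeEquiv S (j ⊓ i) (Finsupp.single s a))) =
          X.res (inf_le_inf_right i h) (freeLift (W := X.sec (j ⊓ i))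
            (fun s => X.res inf_le_right (x s)) (freeEquiv S (j ⊓ i) (Finsupp.single s a)))
        rw [res_freeEquiv, freeLift_single, freeLift_single, res_smul, res_res])))

lemma app_localizeFreeLift (X : Qcoh A) {S : Type u} (x : S → X.sec i) (l : I)
    (m : (free A S).sec (l ⊓ i)) :
    app (localizeFreeLift i X x) l (localizeEquiv i (free A S) l m) =
      localizeEquiv i X l (freeLift (fun s => X.res inf_le_right (x s)) m) := rfl

/-- X_{l ∩ i} is generated over A_{l ∩ i} by X_i, whose elements are the basis here. -/
lemma epi_localizeFreeLift (X : Qcoh A) :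
    Epi (localizeFreeLift i X (S := X.sec i) id) := by
  rw [epi_iff]
  intro l y
  obtain ⟨y, rfl⟩ := (localizeEquiv i X l).surjective y
  suffices ∃ m, freeLift (S := X.sec i) (fun s => X.res (inf_le_right : l ⊓ i ≤ i) (id s)) m = y by
    obtain ⟨m, rfl⟩ := this
    exact ⟨localizeEquiv i _ l m, app_localizeFreeLift i X id l m⟩
  induction y using X.sec_induction (inf_le_right : l ⊓ i ≤ i) with
  | zero => exact ⟨0, map_zero _⟩
  | add x y hx hy =>
    obtain ⟨x, rfl⟩ := hx
    obtain ⟨y, rfl⟩ := hy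
    exact ⟨x + y, map_add _ _ _⟩
  | smul m a => exact ⟨_, freeLift_single _ m a⟩

variable {i}

lemma isMatrixFlat_localize (M : Qcoh A) (l : I)
    (h : IsMatrixFlat (IsReduction.opHom (algebraMap K (A.ring (l ⊓ i)))) (M.sec (l ⊓ i))) :
    IsMatrixFlat (IsReduction.opHom (algebraMap K (A.ring l))) (((localize i).obj M).sec l) :=
  h.of_addEquiv (localizeEquiv i M l) fun c w => by
    rw [IsReduction.opHom_smul, ← A.res_algebraMap inf_le_left]
    exact localizeEquiv_smul i M l _ w

/-- Induction over charts: if X is flat on a lower set D, add a minimal chart i outside D. Choose a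
localized free module mapping onto T_i X and pull back along X → T_i X; the result still maps onto
X. At i it is isomorphic to the localized free module, as X_i = (T_i X)_i. At l ∈ D it is an
extension of the flat X_l by the kernel of a surjection onto X_{l ∩ i}, which is flat because l ∩ i
∈ D. -/
lemma exists_isFlat [IsNoetherianRing K] [Finite I]
    (hA : ∀ i, IsMatrixFlat (IsReduction.opHom (algebraMap K (A.ring i))) (A.ring i))
    (X : Qcoh A) : ∃ (P : Qcoh A) (_ : isFlat A P) (p : P ⟶ X), Epi p := by
  suffices ∀ (n : ℕ) (D : Set I), Dᶜ.ncard = n → IsLowerSet D → ∀ X : Qcoh A,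
      (∀ l ∈ D, IsMatrixFlat (IsReduction.opHom (algebraMap K (A.ring l))) (X.sec l)) →
      ∃ (P : Qcoh A) (_ : isFlat A P) (p : P ⟶ X), Epi p from
    this _ ∅ rfl isLowerSet_empty X (fun l hl => hl.elim)
  intro n
  induction n with
  | zero =>
    intro D hD _ X hX
    rw [Set.ncard_eq_zero, Set.compl_empty_iff] at hD
    subst hD
    exact ⟨X, fun l => hX l trivial, 𝟙 X, inferInstance⟩
  | succ n hn =>
    intro D hD hD' X hX
    obtain ⟨i, hlower, hcard⟩ := hD'.exists_insert hD
    let g := localizeFreeLift i X (S := X.sec i) id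
    have hg : Epi g := epi_localizeFreeLift i X
    let f := (toLocalize i).app X
    have hG (l : I) : IsMatrixFlat (IsReduction.opHom (algebraMap K (A.ring l)))
        (((localize i).obj (free A (X.sec i))).sec l) :=
      isMatrixFlat_localize _ l (((hA _).finsupp _).of_linearEquiv (freeEquiv _ _))
    obtain ⟨P, hP, p, hp⟩ := hn _ hcard hlower (pullback f g) (by
      rintro l (rfl | hl)
      · exact (hG l).of_linearEquiv (LinearEquiv.ofBijective _
          (bijective_app_pullback_snd f g (bijective_app_toLocalize l X le_rfl))).symm
      · obtain ⟨h1, h2, h3⟩ := (shortExact_iff _).1 (shortExact_pullback f g) l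
        refine IsMatrixFlat.of_exact _ _ h1 h2 h3 ?_ (hX l hl)
        have hk := (exact_iff _).1 (ShortComplex.exact_kernel g) l
        exact (hG l).ker (app (kernel.ι g) l) (app g l) ((mono_iff (kernel.ι g)).1 inferInstance l)
          ((epi_iff g).1 hg l) hk (isMatrixFlat_localize X l (hX _ (hD' inf_le_left hl))))
    exact ⟨P, hP, p ≫ pullback.fst f g, epi_comp _ _⟩

end Free

section Reduction

variable {K' : Type v'} [CommRing K'] {A' : NCScheme.{u} K' I}
  {β : A.alg ⋙ forget₂ (AlgCat.{u} K) RingCat.{u} ⟶ A'.alg ⋙ forget₂ (AlgCat.{u} K') RingCat.{u}}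
  {b : ℕ} {r : Fin b → K} (hπ : ∀ i, IsReduction r (algebraMap K (A.ring i)) (coeffHom β i))

include hπ

/-- With J generated by the r_j, only injectivity after reduction needs flatness: X₁ ∩ J X₂ = J X₁
componentwise, because X₃ is flat over K. -/
lemma exactOn_baseChange [IsNoetherianRing K] [PreservesFiniteColimits (baseChange β)] :
    (baseChange β).ExactOn (isFlat A) where
  prop_X₁ S hS h₂ h₃ i := by
    obtain ⟨h, h', h''⟩ := (shortExact_iff S).1 hS i
    exact (h₂ i).ker (app S.f i) (app S.g i) h h' h'' (h₃ i)
  map S hS _ _ h₃ := by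
    have : Epi S.g := hS.epi_g
    have hex := (exact_iff _).1 (hS.exact.map_of_epi_of_preservesCokernel (baseChange β)
      inferInstance inferInstance)
    refine (shortExact_iff _).2 fun i => ⟨?_, (epi_iff ((baseChange β).map S.g)).1 inferInstance i,
      hex i⟩
    rw [injective_iff_map_eq_zero]
    intro x hx
    obtain ⟨m, rfl⟩ := RightTensor.exists_tmul_one_of_surjective (coeffHom β i) (hπ i).surjective x
    have h1 : RightTensor.tmul (coeffHom β i) (app S.f i m) 1 = 0 :=
      (app_baseChangeMap β S.f i m 1).symm.trans hx
    rw [(hπ i).tmul_one_eq_zero_iff] at h1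
    obtain ⟨y, hy⟩ := h1
    obtain ⟨h, h', h''⟩ := (shortExact_iff S).1 hS i
    obtain ⟨z, hz⟩ := (h₃ i).exists_lift (app S.f i) (app S.g i) h h' h''
      (Matrix.of fun j (_ : Fin 1) => r j) y (fun _ => m) (fun _ => hy)
    exact ((hπ i).tmul_one_eq_zero_iff m).2 ⟨z, hz 0⟩

lemma isZero_of_isZero_baseChange (hr : IsNilpotent (Ideal.span (Set.range r))) (X : Qcoh A)
    (hX : IsZero ((baseChange β).obj X)) : IsZero X := by
  rw [isZero_iff] at hX ⊢
  intro i
  have : Subsingleton (RightTensor (coeffHom β i) (X.sec i)) := hX i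
  exact (hπ i).subsingleton_of_subsingleton hr

end Reduction

end Qcoh

/-! ### Cohomological dimension of a module with projective components. -/

section Single

open DerivedCategory HomologicalComplex

/-- A lift of the degree 0 cocycle through W^{-1} → W^0 is a null-homotopy of g. -/
lemma Q_map_eq_zero_of_lift {C : Type*} [Category* C] [Abelian C] [HasDerivedCategory C] {F : C}
    {W : CochainComplex C ℤ} (g : (HomologicalComplex.single C (.up ℤ) 0).obj F ⟶ W)
    (h : F ⟶ W.X (-1)) (hh : h ≫ W.d (-1) 0 = (singleObjXSelf (.up ℤ) 0 F).inv ≫ g.f 0) :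
    Q.map g = 0 := by
  let H (i j : ℤ) (hij : (ComplexShape.up ℤ).Rel j i) :
      ((HomologicalComplex.single C (.up ℤ) 0).obj F).X i ⟶ W.X j :=
    if hi : i = 0 then
      (singleObjXIsoOfEq (.up ℤ) 0 F i hi).hom ≫ h ≫
        (W.XIsoOfEq (show -1 = j by have : j + 1 = i := hij; lia)).hom
    else 0
  have hg : g = Homotopy.nullHomotopicMap' H := by
    apply from_single_hom_ext
    rw [Homotopy.nullHomotopicMap'_f (k₂ := -1) (k₁ := 0) (k₀ := 1) (by simp) (by simp),
      single_obj_d, zero_comp, zero_add]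
    dsimp only [H]
    rw [dif_pos rfl, XIsoOfEq_rfl, Iso.refl_hom, Category.comp_id, Category.assoc, hh]
    exact ((singleObjXSelf (.up ℤ) 0 F).hom_inv_id_assoc (g.f 0)).symm
  rw [hg]
  exact (Q_map_eq_of_homotopy _ (Homotopy.nullHomotopy' H)).trans (Q.map_zero _ _)

end Single

namespace Qcoh

variable {K : Type v} [CommRing K] {I : Type w} [SemilatticeInf I] {A : NCScheme.{u} K I}

section Dimension

open DerivedCategory HomologicalComplex

/-- The complex `Z` has exact component at `l`. -/
def AcyclicAt (Z : CochainComplex (Qcoh A) ℤ) (l : I) : Prop :=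
  ∀ n : ℤ, Function.Exact (app (Z.d (n - 1) n) l) (app (Z.d n (n + 1)) l)

lemma exactAt_iff_app (Z : CochainComplex (Qcoh A) ℤ) (n : ℤ) : Z.ExactAt n ↔
    ∀ l, Function.Exact (app (Z.d (n - 1) n) l) (app (Z.d n (n + 1)) l) := by
  rw [Z.exactAt_iff' (n - 1) n (n + 1) (by simp) (by simp), exact_iff]
  rfl

lemma acyclic_iff_acyclicAt (Z : CochainComplex (Qcoh A) ℤ) :
    Z.Acyclic ↔ ∀ l, AcyclicAt Z l := by
  simp only [HomologicalComplex.Acyclic, exactAt_iff_app, AcyclicAt]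
  exact forall_comm

lemma acyclicAt_iff (Z : CochainComplex (Qcoh A) ℤ) (l : I) :
    AcyclicAt Z l ↔ (((comp A l).mapHomologicalComplex (.up ℤ)).obj Z).Acyclic := by
  refine forall_congr' fun n => ?_
  rw [HomologicalComplex.exactAt_iff' _ (n - 1) n (n + 1) (by simp) (by simp)]
  exact (ShortComplex.ShortExact.moduleCat_exact_iff_function_exact
    ((Z.sc' (n - 1) n (n + 1)).map (comp A l))).symm

lemma acyclicAt_mappingCone_iff {Z Z' : CochainComplex (Qcoh A) ℤ} (f : Z ⟶ Z') (l : I) :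
    AcyclicAt (CochainComplex.mappingCone f) l ↔
      QuasiIso (((comp A l).mapHomologicalComplex (.up ℤ)).map f) := by
  let _ : HasDerivedCategory (ModuleCat.{u} (A.ring l)ᵐᵒᵖ) := HasDerivedCategory.standard _
  rw [acyclicAt_iff, ← acyclic_mappingCone_iff, ← isZero_Q_obj_iff, ← isZero_Q_obj_iff]
  exact (Q.mapIso (CochainComplex.mappingCone.mapHomologicalComplexIso f (comp A l))).isZero_iff

variable [A.HasCartesianIntersections] (i : I)

/-- Homomorphisms F → T_i X are homomorphisms F_i → X_i. At i the image of g lies in the image of d,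
so projectivity of F_i gives a lift there, which quasi-coherence extends to F_{l ∩ i} → X_{l ∩ i}.
-/
lemma exists_lift_localize {F X Y : Qcoh A} [Module.Projective (A.ring i)ᵐᵒᵖ (F.sec i)] (d : X ⟶ Y)
    (g : F ⟶ Y) (h : ∀ m, ∃ x, app d i x = app g i m) :
    ∃ h : F ⟶ (localize i).obj X, h ≫ (localize i).map d = g ≫ (toLocalize i).app Y := by
  obtain ⟨h, hh⟩ := Module.projective_lifting_property (app d i).rangeRestrict
    ((app g i).codRestrict (LinearMap.range (app d i)) h) (app d i).surjective_rangeRestrict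
  have hh (m : F.sec i) : app d i (h m) = app g i m :=
    congrArg Subtype.val (LinearMap.congr_fun hh m)
  choose h' hh' using fun l => F.exists_sec_extension (inf_le_right : l ⊓ i ≤ i)
    (P := X.sec (l ⊓ i)) ((X.res inf_le_right).comp h.toAddMonoidHom) (fun a m => by
      refine (congrArg (X.res inf_le_right) (map_smul h (op a) m)).trans ?_
      exact X.res_smul inf_le_right a (h m))
  have hres {l j : I} (hlj : l ≤ j) (m : F.sec (j ⊓ i)) :
      h' l (F.res (inf_le_inf_right i hlj) m) = X.res (inf_le_inf_right i hlj) (h' j m) := by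
    induction m using F.sec_induction (inf_le_right : j ⊓ i ≤ i) with
    | zero => simp only [map_zero]
    | add x y hx hy => simp only [map_add, hx, hy]
    | smul m a =>
      rw [res_smul, res_res, map_smul, hh', map_smul, hh', res_smul]
      exact congrArg (op (A.res _ a) • ·) (X.res_res _ _ (h m)).symm
  refine ⟨homMk
    (fun l =>
      { toFun := fun m => localizeEquiv i X l (h' l (F.res inf_le_left m))
        map_add' := fun m m' => by
          rw [map_add, map_add]
          exact map_add (localizeEquiv i X l) _ _
        map_smul' := fun a m => by
          refine congrArg (localizeEquiv i X l) ?_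
          refine (congrArg (h' l) (F.res_smul inf_le_left a.unop m)).trans ?_
          exact map_smul (h' l) _ _ })
    (fun l j hlj m => congrArg (localizeEquiv i X l) (by
      refine Eq.trans ?_ (hres hlj _)
      rw [res_res, res_res])), hom_ext fun l m => ?_⟩
  refine congrArg (localizeEquiv i Y l) ((?_ : app d (l ⊓ i) (h' l (F.res inf_le_left m)) =
    app g (l ⊓ i) (F.res inf_le_left m)).trans (app_res g inf_le_left m))
  refine LinearMap.congr_fun (f := (app d (l ⊓ i)).comp (h' l)) (F.sec_hom_ext
    (inf_le_right : l ⊓ i ≤ i) fun m => ?_) _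
  rw [LinearMap.comp_apply, hh', app_res, ← hh]
  exact app_res d _ _

/-- The map of complexes `Z → T_i Z`. -/
noncomputable abbrev toLocalizeComplex (Z : CochainComplex (Qcoh A) ℤ) :
    Z ⟶ ((localize i).mapHomologicalComplex (.up ℤ)).obj Z where
  f n := (toLocalize i).app (Z.X n)
  comm' n m _ := ((toLocalize i).naturality (Z.d n m)).symm

lemma isIso_toLocalizeComplex (Z : CochainComplex (Qcoh A) ℤ) :
    IsIso (toLocalizeComplex i (((localize i).mapHomologicalComplex (.up ℤ)).obj Z)) :=
  have (n : ℤ) : IsIso ((toLocalizeComplex i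
      (((localize i).mapHomologicalComplex (.up ℤ)).obj Z)).f n) :=
    inferInstanceAs (IsIso ((toLocalize i).app ((localize i).obj (Z.X n))))
  HomologicalComplex.Hom.isIso_of_components _

/-- Represent f by a map F → W and a quasi-isomorphism T_i Z → W. As T_i is exact and idempotent, W
→ T_i W is a quasi-isomorphism, so W may be replaced by T_i W. Now W is exact in degree 0 since Z
sits in degrees ≤ -1, so the cocycle F → W^0 lifts to T_i W^{-1} by projectivity of F_i. -/
lemma Q_map_eq_zero_of_localize {F : Qcoh A} [Module.Projective (A.ring i)ᵐᵒᵖ (F.sec i)]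
    (Z : CochainComplex (Qcoh A) ℤ) (hZ : Z.IsStrictlyLE (-1))
    (f : Q.obj ((HomologicalComplex.single (Qcoh A) (.up ℤ) 0).obj F) ⟶
      Q.obj (((localize i).mapHomologicalComplex (.up ℤ)).obj Z)) : f = 0 := by
  obtain ⟨W, g, s, hs, rfl⟩ := left_fac f
  suffices Q.map g = 0 by rw [this, zero_comp]
  rw [isIso_Q_map_iff_quasiIso] at hs
  have h1 : s ≫ toLocalizeComplex i W = toLocalizeComplex i _ ≫
      ((localize i).mapHomologicalComplex (.up ℤ)).map s := by
    ext n : 1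
    exact (toLocalize i).naturality (s.f n)
  have h2 : QuasiIso (s ≫ toLocalizeComplex i W) := by
    rw [h1]
    have := isIso_toLocalizeComplex i Z
    infer_instance
  have h3 : QuasiIso (toLocalizeComplex i W) := quasiIso_of_comp_left s _
  have h4 := (isIso_Q_map_iff_quasiIso _ _).2 h3
  rw [← cancel_mono (Q.map (toLocalizeComplex i W)), zero_comp, ← Q.map_comp]
  have hW : W.ExactAt 0 := by
    have h5 : (((localize i).mapHomologicalComplex (.up ℤ)).obj Z).ExactAt 0 := by
      have := isStrictlyLE_mapHomologicalComplex (L := localize i) Z (-1)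
      exact CochainComplex.exactAt_of_isLE _ (-1) 0 (by lia)
    exact (quasiIsoAt_iff_exactAt s 0 h5).1 inferInstance
  obtain ⟨h, hh⟩ := exists_lift_localize i (W.d (-1) 0)
    ((singleObjXSelf (.up ℤ) 0 F).inv ≫ g.f 0) (fun m => by
      refine ((exactAt_iff_app W 0).1 hW i _).1 ?_
      rw [← app_comp, Category.assoc, g.comm, single_obj_d, zero_comp, comp_zero, app_zero])
  exact Q_map_eq_zero_of_lift _ h (hh.trans (Category.assoc _ _ _))

lemma homVanishes_localize {F : Qcoh A} [Module.Projective (A.ring i)ᵐᵒᵖ (F.sec i)] {n : ℤ}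
    (Z : CochainComplex (Qcoh A) ℤ) (hZ : Z.IsStrictlyLE n) {p : ℤ} (hp : n < p) :
    HomVanishes ((singleFunctor (Qcoh A) 0).obj F)
      (Q.obj (((localize i).mapHomologicalComplex (.up ℤ)).obj Z)) p := by
  intro f
  let e : Q.obj (((localize i).mapHomologicalComplex (.up ℤ)).obj (Z⟦p⟧)) ≅
      (Q.obj (((localize i).mapHomologicalComplex (.up ℤ)).obj Z))⟦p⟧ :=
    Q.mapIso ((((localize i).mapHomologicalComplex (.up ℤ)).commShiftIso p).app Z) ≪≫
      ((Q (C := Qcoh A)).commShiftIso p).app _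
  rw [← cancel_mono e.inv, zero_comp]
  refine Q_map_eq_zero_of_localize i (Z⟦p⟧) ?_ (f ≫ e.inv)
  rw [CochainComplex.isStrictlyLE_iff]
  exact fun j hj => Z.isZero_of_isStrictlyLE n (j + p) (by lia)

/-- k counts the charts at which Z need not be acyclic. The cone of Z → T_i Z is acyclic on D,
because both terms are, and also at i, where the map is an isomorphism. Since Hom(F, T_i Z[p]) = 0
for p > n, each chart costs one degree. Taking D empty gives a bound uniform in Z. -/
lemma homVanishes_of_acyclicAt [Finite I] (F : Qcoh A)
    (hF : ∀ i, Module.Projective (A.ring i)ᵐᵒᵖ (F.sec i)) (n : ℤ) (k : ℕ) (D : Set I)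
    (hD : Dᶜ.ncard = k) (hD' : IsLowerSet D) (Z : CochainComplex (Qcoh A) ℤ)
    (hZ : Z.IsStrictlyLE n) (hZD : ∀ l ∈ D, AcyclicAt Z l) (p : ℤ) (hp : n + k < p) :
    HomVanishes ((singleFunctor (Qcoh A) 0).obj F) (Q.obj Z) p := by
  induction k generalizing D Z p with
  | zero =>
    rw [Set.ncard_eq_zero, Set.compl_empty_iff] at hD
    subst hD
    refine HomVanishes.of_isZero ?_ p
    rw [isZero_Q_obj_iff, acyclic_iff_acyclicAt]
    exact fun l => hZD l trivial
  | succ k hk =>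
    obtain ⟨i, hlower, hcard⟩ := hD'.exists_insert hD
    let η := toLocalizeComplex i Z
    have hcone : (CochainComplex.mappingCone η).IsStrictlyLE n := by
      rw [CochainComplex.isStrictlyLE_iff]
      intro j hj
      rw [CochainComplex.mappingCone.isZero_X_iff]
      exact ⟨Z.isZero_of_isStrictlyLE n _ (by lia),
        (localize i).map_isZero (Z.isZero_of_isStrictlyLE n _ (by lia))⟩
    have := hF i
    refine HomVanishes.obj₁ (mappingCone_triangle_distinguished η) (p := p - 1) (by lia)
      (hk _ hcard hlower _ hcone ?_ (p - 1) (by push_cast at hp; lia))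
      (homVanishes_localize i Z hZ (by lia))
    intro l hl
    rw [acyclicAt_mappingCone_iff]
    obtain rfl | hl := hl
    · have (m : ℤ) : IsIso ((((comp A l).mapHomologicalComplex (.up ℤ)).map η).f m) :=
        (ConcreteCategory.isIso_iff_bijective _).2 (bijective_app_toLocalize l (Z.X m) le_rfl)
      have := HomologicalComplex.Hom.isIso_of_components
        (((comp A l).mapHomologicalComplex (.up ℤ)).map η)
      infer_instance
    · have h1 := (acyclicAt_iff _ _).1 (hZD l hl)
      have h2 : AcyclicAt (((localize i).mapHomologicalComplex (.up ℤ)).obj Z) l :=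
        hZD (l ⊓ i) (hD' inf_le_left hl)
      exact ⟨fun m => (quasiIsoAt_iff_exactAt _ m (h1 m)).2 ((acyclicAt_iff _ _).1 h2 m)⟩

end Dimension

end Qcoh

/-! ### Matrices of scalars acting on powers of an object. -/

section MatrixMap

/-- An additive functor to modules over a `K`-algebra is `K`-linear. -/
def IsScalarCompatible {K : Type*} [CommRing K] {𝒜 : Type*} [Category* 𝒜] [Preadditive 𝒜]
    [Linear K 𝒜] {B : Type*} [Ring B] (H : 𝒜 ⥤ ModuleCat.{u} B) (θ : K →+* B) : Prop :=
  ∀ ⦃X Y : 𝒜⦄ (c : K) (f : X ⟶ Y) (x : H.obj X),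
    (H.map (c • f)).hom x = θ c • (H.map f).hom x

variable {K : Type*} [CommRing K] {𝒜 : Type*} [Category* 𝒜] [Preadditive 𝒜] [Linear K 𝒜]
  [HasFiniteBiproducts 𝒜]

/-- The object `X^n`. -/
noncomputable abbrev copower (n : ℕ) (X : 𝒜) : 𝒜 := ⨁ fun _ : Fin n => X

/-- The map `X^m → X^n` given by a matrix of scalars. -/
noncomputable def matrixMap {m n : ℕ} (D : Matrix (Fin m) (Fin n) K) (X : 𝒜) :
    copower m X ⟶ copower n X :=
  biproduct.matrix fun i j => D i j • 𝟙 X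

lemma matrixMap_π {m n : ℕ} (D : Matrix (Fin m) (Fin n) K) (X : 𝒜) (j : Fin n) :
    matrixMap D X ≫ biproduct.π _ j = ∑ i, D i j • biproduct.π _ i := by
  rw [matrixMap, biproduct.matrix_π, biproduct.desc_eq]
  exact Finset.sum_congr rfl fun i _ => by rw [Linear.comp_smul, Category.comp_id]

lemma isSummandOfSum_copower (n : ℕ) (X : 𝒜) : IsSummandOfSum X (copower n X) :=
  ⟨n, biproduct.π _, biproduct.ι _, biproduct.total⟩

variable {B : Type*} [Ring B] (H : 𝒜 ⥤ ModuleCat.{u} B) [H.Additive]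

omit [Linear K 𝒜] in
lemma copower_ext {n : ℕ} {X : 𝒜} {x y : H.obj (copower n X)}
    (h : ∀ j, (H.map (biproduct.π _ j)).hom x = (H.map (biproduct.π _ j)).hom y) : x = y := by
  have key (z : H.obj (copower n X)) :
      z = ∑ j, (H.map (biproduct.ι _ j)).hom ((H.map (biproduct.π _ j)).hom z) := by
    have h1 := congrArg (fun f => (H.map f).hom z) (biproduct.total (f := fun _ : Fin n => X))
    simp only [Functor.map_sum, Functor.map_comp, ModuleCat.hom_sum, ModuleCat.hom_comp,
      LinearMap.sum_apply, LinearMap.comp_apply] at h1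
    rw [H.map_id] at h1
    exact h1.symm
  rw [key x, key y]
  exact Finset.sum_congr rfl fun j _ => by rw [h]

omit [Linear K 𝒜] in
lemma copower_exists {n : ℕ} {X : 𝒜} (x : Fin n → H.obj X) :
    ∃ z : H.obj (copower n X), ∀ j, (H.map (biproduct.π _ j)).hom z = x j := by
  refine ⟨∑ i, (H.map (biproduct.ι _ i)).hom (x i), fun j => ?_⟩
  rw [map_sum, Finset.sum_eq_single j]
  · rw [← LinearMap.comp_apply, ← ModuleCat.hom_comp, ← H.map_comp, biproduct.ι_π_self, H.map_id]
    rfl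
  · intro i _ hij
    rw [← LinearMap.comp_apply, ← ModuleCat.hom_comp, ← H.map_comp, biproduct.ι_π_ne _ hij,
      H.map_zero]
    rfl
  · exact fun h => (h (Finset.mem_univ j)).elim

variable {H} {θ : K →+* B} (hH : IsScalarCompatible H θ)

include hH

lemma map_matrixMap_π {m n : ℕ} (D : Matrix (Fin m) (Fin n) K) (X : 𝒜) (j : Fin n)
    (x : H.obj (copower m X)) :
    (H.map (biproduct.π _ j)).hom ((H.map (matrixMap D X)).hom x) =
      ∑ i, θ (D i j) • (H.map (biproduct.π _ i)).hom x := by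
  have h := congrArg (fun f => (H.map f).hom x) (matrixMap_π D X j)
  simp only [Functor.map_sum, Functor.map_comp, ModuleCat.hom_sum, ModuleCat.hom_comp,
      LinearMap.sum_apply, LinearMap.comp_apply, hH _ _ _] at h
  exact h

/-- In coordinates, exactness at the middle term is the defining property of `IsMatrixFlat`,
together with D' D = 0. -/
lemma exact_matrixMap {l m n : ℕ} {D' : Matrix (Fin l) (Fin m) K} {D : Matrix (Fin m) (Fin n) K}
    (hD : D'.IsSyzygy D) (X : 𝒜) (hX : IsMatrixFlat θ (H.obj X)) :
    Function.Exact (H.map (matrixMap D' X)).hom (H.map (matrixMap D X)).hom := by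
  intro x
  constructor
  · intro hx
    obtain ⟨y, hy⟩ := hX D' D hD (fun i => (H.map (biproduct.π _ i)).hom x) (fun j => by
      rw [← map_matrixMap_π hH, hx, map_zero])
    obtain ⟨z, hz⟩ := copower_exists H y
    refine ⟨z, copower_ext H fun j => ?_⟩
    rw [map_matrixMap_π hH, hy]
    simp only [hz]
  · rintro ⟨y, rfl⟩
    refine copower_ext H fun j => ?_
    rw [map_matrixMap_π hH, map_zero]
    simp only [map_matrixMap_π hH]
    exact hD.sum_smul_sum_smul _ j

/-- The power X^1 is used as the target so that the quotient by the r_j is again the cokernel of a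
matrix map; its single coordinate is `biproduct.π _ 0`. -/
lemma exact_matrixMap_column {b : ℕ} (r : Fin b → K) (X : 𝒜) {W : Type*} [Zero W]
    (f : H.obj X → W) (hf : ∀ x, f x = 0 ↔ ∃ y : Fin b → H.obj X, x = ∑ j, θ (r j) • y j) :
    Function.Exact (H.map (matrixMap (Matrix.of fun j (_ : Fin 1) => r j) X)).hom
      (fun x => f ((H.map (biproduct.π _ 0)).hom x)) := by
  intro x
  rw [hf]
  constructor
  · rintro ⟨y, hy⟩
    obtain ⟨z, hz⟩ := copower_exists H y
    refine ⟨z, copower_ext H fun j => ?_⟩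
    obtain rfl := Subsingleton.elim 0 j
    rw [map_matrixMap_π hH, hy]
    simp only [hz]
    rfl
  · rintro ⟨z, rfl⟩
    rw [map_matrixMap_π hH]
    exact ⟨_, rfl⟩

end MatrixMap

namespace Qcoh

variable {K : Type v} [CommRing K] {I : Type w} [SemilatticeInf I] {A : NCScheme.{u} K I}

/-! ### The resolution of P / mP by powers of P. -/

section Syzygy

variable (A) in
/-- The functor `Z ↦ (Z^n)_l`. -/
noncomputable abbrev evalComp (n : ℤ) (l : I) :
    CochainComplex (Qcoh A) ℤ ⥤ ModuleCat.{u} (A.ring l)ᵐᵒᵖ :=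
  HomologicalComplex.eval (Qcoh A) (.up ℤ) n ⋙ comp A l

lemma isScalarCompatible_evalComp (n : ℤ) (l : I) :
    IsScalarCompatible (evalComp A n l) (IsReduction.opHom (algebraMap K (A.ring l))) :=
  fun _ _ c f x => app_smul c (f.f n) l x

instance : HasFiniteBiproducts (CochainComplex (Qcoh A) ℤ) := Abelian.hasFiniteBiproducts

/-- The complexes which are cokernels of matrices of scalars. -/
def IsMatrixCokernel (P : CochainComplex (Qcoh A) ℤ) :
    ObjectProperty (CochainComplex (Qcoh A) ℤ) := fun Z =>
  ∃ (m n : ℕ) (D : Matrix (Fin m) (Fin n) K) (q : copower n P ⟶ Z),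
    (∀ i l, Function.Surjective ((evalComp A i l).map q).hom) ∧
    ∀ i l, Function.Exact ((evalComp A i l).map (matrixMap D P)).hom ((evalComp A i l).map q).hom

/-- The kernel of q is the image of D, and P being flat, that image is the cokernel of a syzygy
matrix D' of D. So the kernel is again the cokernel of a matrix. -/
lemma isSyzygyClosed_isMatrixCokernel [IsNoetherianRing K] (P : CochainComplex (Qcoh A) ℤ)
    (hP : ∀ i, isFlat A (P.X i)) : IsSyzygyClosed P (IsMatrixCokernel P) := by
  rintro Z ⟨m, n, D, q, hq, hDq⟩
  have hqe : Epi q := by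
    have (i : ℤ) : Epi (q.f i) := (epi_iff _).2 (hq i)
    exact HomologicalComplex.epi_of_epi_f q inferInstance
  have hD : matrixMap D P ≫ q = 0 := by
    ext i : 1
    exact hom_ext fun l x => (hDq i l).apply_apply_eq_zero x
  refine ⟨ShortComplex.mk (kernel.ι q) q (kernel.condition q),
    { exact := ShortComplex.exact_kernel q
      mono_f := inferInstanceAs (Mono (kernel.ι q))
      epi_g := hqe }, ?_, isSummandOfSum_copower n P, ⟨Iso.refl Z⟩⟩
  obtain ⟨l, D', hD'⟩ := D.exists_isSyzygy
  have hι (i : ℤ) (l : I) : Function.Injective ((evalComp A i l).map (kernel.ι q)).hom :=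
    (ModuleCat.mono_iff_injective _).1 inferInstance
  have hex (i : ℤ) (l : I) : Function.Exact ((evalComp A i l).map (kernel.ι q)).hom
      ((evalComp A i l).map q).hom := ((ShortComplex.ShortExact.moduleCat_exact_iff_function_exact _).1
    ((ShortComplex.exact_kernel q).map (evalComp A i l)))
  have hlift (i : ℤ) (l : I) (x) : ((evalComp A i l).map (kernel.ι q)).hom
      (((evalComp A i l).map (kernel.lift q (matrixMap D P) hD)).hom x) =
        ((evalComp A i l).map (matrixMap D P)).hom x := by
    rw [← LinearMap.comp_apply, ← ModuleCat.hom_comp, ← Functor.map_comp, kernel.lift_ι]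
  refine ⟨l, m, D', kernel.lift q (matrixMap D P) hD, fun i l y => ?_, fun i l x => ?_⟩
  · obtain ⟨x, hx⟩ := (hDq i l _).1 ((hex i l).apply_apply_eq_zero y)
    exact ⟨x, hι i l ((hlift i l x).trans hx)⟩
  · rw [← exact_matrixMap (isScalarCompatible_evalComp i l) hD' P (hP i l) x, ← hlift]
    exact (map_eq_zero_iff _ (hι i l)).symm

variable {K' : Type v'} [CommRing K'] {A' : NCScheme.{u} K' I}
  {β : A.alg ⋙ forget₂ (AlgCat.{u} K) RingCat.{u} ⟶ A'.alg ⋙ forget₂ (AlgCat.{u} K') RingCat.{u}}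
  (hβ : ∀ ⦃i j : I⦄ (h : i ≤ j), Function.Bijective (RightTensor.squareMap (A.res h)
    (A'.res h) (coeffHom β j) (coeffHom β i) (coeffHom_res β h)))
  {b : ℕ} {r : Fin b → K} (hπ : ∀ i, IsReduction r (algebraMap K (A.ring i)) (coeffHom β i))

include hπ

/-- The unit P → ρ L P is the projection of P onto its quotient by the r_j, that is, onto the
cokernel of the column P^b → P. -/
lemma isMatrixCokernel_restrictCoeff_baseChange (P : CochainComplex (Qcoh A) ℤ) :
    IsMatrixCokernel P (((restrictCoeff β hβ).mapHomologicalComplex (.up ℤ)).obj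
      (((baseChange β).mapHomologicalComplex (.up ℤ)).obj P)) := by
  let η := unitComplex (baseChangeAdjunction β hβ) P
  have hη (i : ℤ) (l : I) (x : (P.X i).sec l) : ((evalComp A i l).map η).hom x =
      restrictCoeffEquiv β hβ (baseChangeQcoh β (P.X i)) l (tmulCoeff β (P.X i) l x 1) :=
    app_baseChangeAdjunction_unit β hβ (P.X i) l x
  refine ⟨b, 1, Matrix.of fun j _ => r j, biproduct.π _ 0 ≫ η, fun i l y => ?_, fun i l x => ?_⟩
  · obtain ⟨x, hx⟩ := RightTensor.exists_tmul_one_of_surjective (coeffHom β l) (hπ l).surjective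
      ((restrictCoeffEquiv β hβ (baseChangeQcoh β (P.X i)) l).symm y)
    obtain ⟨z, hz⟩ := copower_exists (n := 1) (X := P) (evalComp A i l) (fun _ => x)
    refine ⟨z, ?_⟩
    rw [Functor.map_comp, ModuleCat.hom_comp, LinearMap.comp_apply, hz]
    refine (hη i l x).trans ?_
    exact congrArg (restrictCoeffEquiv β hβ (baseChangeQcoh β (P.X i)) l) hx
  · have h := exact_matrixMap_column (isScalarCompatible_evalComp i l) r P ((evalComp A i l).map η).hom
      (fun x => (Eq.congr_left (hη i l x)).trans ((AddEquiv.map_eq_zero_iff _).trans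
        ((hπ l).tmul_one_eq_zero_iff (M := (P.X i).sec l) x))) x
    rw [Functor.map_comp, ModuleCat.hom_comp, LinearMap.comp_apply]
    exact h

end Syzygy

end Qcoh

namespace Qcoh

variable {K : Type v} [CommRing K] {I : Type w} [SemilatticeInf I] {A : NCScheme.{u} K I}

/-! ### Coherence, and passage to the abstract form of generation. -/

section Coherent

lemma isCoherent_iff (M : Qcoh A) :
    isCoherent A M ↔ ∀ i, Module.Finite (A.ring i)ᵐᵒᵖ (M.sec i) := Iff.rfl

instance : (isCoherent A).IsClosedUnderIsomorphisms where
  of_iso e h := (isCoherent_iff _).2 fun i =>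
    have := (isCoherent_iff _).1 h i
    Module.Finite.equiv ((comp A i).mapIso e).toLinearEquiv

open ZeroObject in
instance : (isCoherent A).ContainsZero where
  exists_zero := ⟨0, isZero_zero _, fun i =>
    have : Subsingleton ((0 : Qcoh A).sec i) := (isZero_iff (0 : Qcoh A)).1 (isZero_zero _) i
    inferInstanceAs (Module.Finite (A.ring i)ᵐᵒᵖ ((0 : Qcoh A).sec i))⟩

lemma isCoherent_of_exact [∀ i, IsNoetherianRing (A.ring i)ᵐᵒᵖ] (S : ShortComplex (Qcoh A))
    (hS : S.Exact) (h₁ : isCoherent A S.X₁) (h₃ : isCoherent A S.X₃) : isCoherent A S.X₂ := by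
  intro i
  have : Module.Finite (A.ring i)ᵐᵒᵖ (S.X₁.sec i) := h₁ i
  have : Module.Finite (A.ring i)ᵐᵒᵖ (S.X₃.sec i) := h₃ i
  exact finite_of_exact (app S.f i) (app S.g i) ((exact_iff S).1 hS i)

lemma isCoherent_of_isSummandOfSum (Y Y' : Qcoh A) (h : IsSummandOfSum Y Y')
    (hY : isCoherent A Y) : isCoherent A Y' := by
  obtain ⟨n, π, ι, h⟩ := h
  intro i
  have : Module.Finite (A.ring i)ᵐᵒᵖ (Y.sec i) := hY i
  let g : (Fin n → Y.sec i) →ₗ[(A.ring i)ᵐᵒᵖ] Y'.sec i :=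
    ∑ j, (app (ι j) i).comp (LinearMap.proj j)
  refine Module.Finite.of_surjective g fun (y : Y'.sec i) => ⟨fun j => app (π j) i y, ?_⟩
  have h1 := congrArg (fun f => ((comp A i).map f).hom y) h
  simp only [Functor.map_sum, ModuleCat.hom_sum, LinearMap.sum_apply] at h1
  have h2 : g (fun j => app (π j) i y) = ∑ j, app (ι j) i (app (π j) i y) := by
    simp only [g, LinearMap.sum_apply, LinearMap.comp_apply, LinearMap.proj_apply]
  exact h2.trans h1

/-- Generators over A_i are also generators over A'_i. -/
lemma isCoherent_of_restrictCoeff {K' : Type v'} [CommRing K'] {A' : NCScheme.{u} K' I}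
    {β : A.alg ⋙ forget₂ (AlgCat.{u} K) RingCat.{u} ⟶
      A'.alg ⋙ forget₂ (AlgCat.{u} K') RingCat.{u}}
    (hβ : ∀ ⦃i j : I⦄ (h : i ≤ j), Function.Bijective (RightTensor.squareMap (A.res h)
      (A'.res h) (coeffHom β j) (coeffHom β i) (coeffHom_res β h)))
    (Y : Qcoh A') (hY : isCoherent A ((restrictCoeff β hβ).obj Y)) : isCoherent A' Y := by
  intro i
  let _ : Module (A.ring i)ᵐᵒᵖ (Y.sec i) := Module.compHom _ (RingHom.op (coeffHom β i))
  have : Module.Finite (A.ring i)ᵐᵒᵖ (Y.sec i) := hY i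
  exact finite_of_smul_eq (W := Y.sec i) (RingHom.op (coeffHom β i)) fun x w => rfl

end Coherent

lemma projective_of_isLocallyFree (F : Qcoh A) (hF : isLocallyFree A F) (i : I) :
    Module.Projective (A.ring i)ᵐᵒᵖ (F.sec i) := by
  obtain ⟨n, hF⟩ := hF
  obtain ⟨(e : F.sec i ≃ₗ[(A.ring i)ᵐᵒᵖ] (Fin n → A.ring i))⟩ := hF i
  have : Module.Free (A.ring i)ᵐᵒᵖ (A.ring i) :=
    Module.Free.of_equiv (MulOpposite.opLinearEquiv (A.ring i)ᵐᵒᵖ (M := A.ring i)).symm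
  have : Module.Free (A.ring i)ᵐᵒᵖ (Fin n → A.ring i) := Module.Free.function _ _ _
  have : Module.Free (A.ring i)ᵐᵒᵖ (F.sec i) := Module.Free.of_equiv e.symm
  exact Module.Projective.of_free

lemma generatesDMinusCoh_iff (F : Qcoh A) :
    GeneratesDMinusCoh F ↔ GeneratesBoundedAbove (isCoherent A) F := by
  refine forall_congr' fun M => imp_congr_right fun _ => imp_congr_right fun _ =>
    exists_congr fun p => ?_
  rw [nontrivial_iff_exists_ne 0, HomVanishes, not_forall]

end Qcoh

open Qcoh in
theorem lemma5p3 {k : Type u} [Field k]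
    {X : AlgebraicGeometry.Scheme.{u}} [X.Over (AlgebraicGeometry.Spec (CommRingCat.of k))]
    [AlgebraicGeometry.IsIntegral X]
    [AlgebraicGeometry.IsSeparated (X ↘ AlgebraicGeometry.Spec (CommRingCat.of k))]
    [AlgebraicGeometry.LocallyOfFiniteType (X ↘ AlgebraicGeometry.Spec (CommRingCat.of k))]
    [AlgebraicGeometry.QuasiCompact (X ↘ AlgebraicGeometry.Spec (CommRingCat.of k))]
    {I : Type w} [SemilatticeInf I] [Finite I] (𝒰 : AffineCovering X I)
    {R : Type v} [CommRing R] [IsLocalRing R] [IsArtinianRing R] [Algebra k R]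
    (hR : Function.Bijective (algebraMap k (IsLocalRing.ResidueField R)))
    (A : NCDeformation k 𝒰 R)
    (F : Qcoh A.toNCScheme) (hF : isLocallyFree A.toNCScheme F)
    (hF0 : GeneratesDMinusCoh (A.reductionQcoh F)) :
    GeneratesDMinusCoh F := by
  obtain ⟨b, r, hr⟩ := NCDeformation.exists_generators (R := R)
  have hnil : IsNilpotent (Ideal.span (Set.range r)) :=
    hr ▸ NCDeformation.isNilpotent_maximalIdeal
  have hπ := A.isReduction hr
  have hβ ⦃i j : I⦄ (h : i ≤ j) : Function.Bijective (RightTensor.squareMap (A.toNCScheme.res h)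
      ((𝒰.ncScheme k).res h) (coeffHom A.reduction j) (coeffHom A.reduction i)
      (coeffHom_res A.reduction h)) :=
    (hπ j).bijective_squareMap_reduction (hπ i) (A.toNCScheme.res_algebraMap h) _
  -- Flatness is known for the left action of R on A_i; R is central, so it passes to the right
  -- action.
  have hA (i : I) : IsMatrixFlat (IsReduction.opHom (algebraMap R (A.toNCScheme.ring i)))
      (A.toNCScheme.ring i) :=
    (A.isMatrixFlat i).of_addEquiv (AddEquiv.refl _) fun c x => ((hπ i).commutes c x)
  have := A.isNoetherianRing_op
  have : (baseChange A.reduction).IsLeftAdjoint := (baseChangeAdjunction A.reduction hβ).isLeftAdjoint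
  have : PreservesFiniteColimits (baseChange A.reduction) := inferInstance
  have hproj := projective_of_isLocallyFree F hF
  rw [generatesDMinusCoh_iff] at hF0 ⊢
  exact generatesBoundedAbove_of_map (baseChangeAdjunction A.reduction hβ) (exists_isFlat hA)
    (exactOn_baseChange hπ) (isZero_of_isZero_baseChange hπ hnil) isCoherent_of_exact
    isCoherent_of_isSummandOfSum (isCoherent_of_restrictCoeff hβ)
    (fun P hP => ⟨_, isSyzygyClosed_isMatrixCokernel P hP,
      isMatrixCokernel_restrictCoeff_baseChange hβ hπ P⟩) F (isFlat_of_isLocallyFree hA F hF)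
    -- With D empty no acyclicity is assumed, so all |I| charts are counted and d = n + |I|.
    (fun n => ⟨n + Nat.card I, fun Z hZ p hp => homVanishes_of_acyclicAt F hproj n _ ∅
      (by rw [Set.compl_empty, Set.ncard_univ]) isLowerSet_empty Z hZ (fun l hl => hl.elim) p hp⟩)
    hF0
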